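/- **Notation.** Let $T$ be a text over a finite ordered alphabet $\Sigma$ of size $\sigma\ge 2$ that terminates with a letter appearing nowhere else in $T$. A substring $w$ of $T$ that occurs at least twice is a *maximal repeat* if every string $wa$ and every string $aw$ ($a\in\Sigma$) occurs strictly fewer times in $T$ than $w$ (the empty string occurs $|T|+1$ times); let $\tilde e_T$ be the number of substrings $wa$ of $T$ plus the number of substrings $aw$ of $T$, with $w$ a maximal repeat and $a\in\Sigma$. The nodes of $\mathrm{CDAWG}(T)$ (*type-1 nodes*) are the classes, under equality of the sets of ending positions in $T$, of those substrings that are the longest with their set of beginning positions. The longest string of a node $v$ is denoted $\mathrm{value}(v)$, the source is the node of the empty string, and each edge leads from a node to the next node reached by reading one more letter and all letters forced by it. $\mathrm{L\text{-}CDAWG}(T)$ is obtained by inserting a *type-2 node* wherever the path from the source that spells out a substring $au$ of $T$, with $a\in\Sigma$ and $u$ the value of a type-1 node, ends in the middle of an edge. The *suffix link* of this type-2 node is the node with value $u$; that of a type-1 node $v$ other than the source is the node of the longest suffix of $\mathrm{value}(v)$ that does not belong to $v$. Each edge $e$, with original label $\mathrm{lab}(e)$, stores only its end points, the first letter of $\mathrm{lab}(e)$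 and the length $|\mathrm{lab}(e)|$; each node stores its type, its suffix link and its out-going edges, sorted by their first letters; the source is given. For an edge $e=(u,v)$ with $|\mathrm{lab}(e)|\ge2$ let $(e_1,\dots,e_k)$ be the path from the suffix link of $u$ that spells out $\mathrm{lab}(e)$; then $\mathrm{jump}(e)=(e_1,\dots,e_k)$ if $k\ge2$, and $\mathrm{jump}(e)=\mathrm{jump}(e_1)$ if $k=1$. A *straight-line program* (SLP) is a loop-free context-free grammar with exactly one production, $X\to a$ or $X\to YZ$, for each variable $X$, and a designated start variable. **Theorem.** There are a single algorithm (on a random access machine with words of $O(\log |T|)$ bits, which only copies and compares letters) and an absolute constant $C$ such that for all $\Sigma$ and $T$ as above, given $\mathrm{L\text{-}CDAWG}(T)$ without its edge labels and without $T$, the algorithm constructs in at most $C\,\tilde e_T\log_2\sigma$ steps an SLP with at most $C\,\tilde e_T$ productions, together with pairwise distinct variables $X(e)$, one for each edge $e$ of $\mathrm{L\text{-}CDAWG}(T)$, such that $X(e)$ derives $\mathrm{lab}(e)$ for every edge $e$ and the start variable derives $T$. Moreover, $X(e)\to \mathrm{lab}(e)$ is a production if $|\mathrm{lab}(e)|=1$;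 if $|\mathrm{lab}(e)|\ge2$, then $\mathrm{jump}(e)=(e'_1,\dots,e'_k)$ is defined, $k\ge 2$, and $X(e)$ is expanded by productions $X(e)\to X(e'_1)Y_1,\ Y_1\to X(e'_2)Y_2,\ \dots,\ Y_{k-2}\to X(e'_{k-1})X(e'_k)$ (just $X(e)\to X(e'_1)X(e'_2)$ if $k=2$); and the start variable is expanded in the same way along the path from the source that spells out $T$ (it is $X(e)$ if that path is a single edge $e$). -/

import Mathlib

namespace LinCDAWG

/-! ### Occurrences, maximal repeats, extensions -/

section Strings

variable {α : Type*}

/-- The (0-based) positions at which an occurrence of `x` in `T` begins.  The empty string begins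
at each of the `|T| + 1` positions `0, …, |T|`. -/
def begPos (T x : List α) : Set ℕ := {i | i ≤ T.length ∧ x <+: T.drop i}

/-- The positions at which an occurrence of `x` in `T` ends. -/
def endPos (T x : List α) : Set ℕ := {j | j ≤ T.length ∧ x <:+ T.take j}

/-- The number of occurrences of `x` in `T`. -/
noncomputable def occ (T x : List α) : ℕ := (begPos T x).ncard

/-- `w` is a maximal repeat of `T`: it occurs at least twice, and each of its left and right
extensions by one letter occurs strictly fewer times. -/
def IsMaxRepeat (T w : List α) : Prop :=
  w <:+: T ∧ 1 < occ T w ∧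
    (∀ a : α, occ T (w ++ [a]) < occ T w) ∧ (∀ a : α, occ T (a :: w) < occ T w)

/-- The right extensions of the maximal repeats of `T`. -/
def rightExt (T : List α) : Set (List α) :=
  {x | x <:+: T ∧ ∃ w a, IsMaxRepeat T w ∧ x = w ++ [a]}

/-- The left extensions of the maximal repeats of `T`. -/
def leftExt (T : List α) : Set (List α) :=
  {x | x <:+: T ∧ ∃ w a, IsMaxRepeat T w ∧ x = a :: w}

/-- The number of right extensions plus the number of left extensions of maximal repeats. -/
noncomputable def numExt (T : List α) : ℕ := (rightExt T).ncard + (leftExt T).ncard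

/-- `T` terminates with a letter that appears nowhere else in `T`. -/
def HasEndMarker (T : List α) : Prop := ∃ w d, T = w ++ [d] ∧ d ∉ w

end Strings

/-! ### The CDAWG and the L-CDAWG of a text -/

section Graph

variable {α : Type*}

/-- `x` and `y` have the same beginning positions in `T`. -/
def EqL (T x y : List α) : Prop := begPos T x = begPos T y

/-- `x` and `y` have the same ending positions in `T`. -/
def EqR (T x y : List α) : Prop := endPos T x = endPos T y

/-- The substring `x` of `T` is the longest string with its beginning positions, that is, the path
that spells out `x` from the source of the CDAWG of `T` ends at a node. -/
def Explicit (T x : List α) : Prop := x <:+: T ∧ ∀ y, EqL T x y → y.length ≤ x.length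

/-- `x` is the longest string of a CDAWG node.  A node of the CDAWG is the class, under equality of
ending positions, of an explicit string; we name it by its longest member. -/
def IsValue (T x : List α) : Prop := Explicit T x ∧ ∀ y, EqR T x y → y.length ≤ x.length

/-- A point of the CDAWG: `off` is read downwards from the CDAWG node whose longest string is
`base`.  The point is the node itself if `off = []`; otherwise it is in the middle of an edge. -/
@[ext] structure Point (α : Type*) where
  base : List α
  off : List α

/-- The longest string that leads from the source to the point `v`. -/
def Point.str (v : Point α) : List α := v.base ++ v.off

/-- The path that spells out the substring `y` of `T` from the source of the CDAWG ends at the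
point `v`: `y = s ++ v.off`, where `s` is the longest explicit prefix of `y`, and `s` belongs to
the node `v.base`. -/
def EndsAt (T y : List α) (v : Point α) : Prop :=
  y <:+: T ∧ IsValue T v.base ∧ ∃ s, y = s ++ v.off ∧ Explicit T s ∧ EqR T s v.base ∧
    ∀ γ, γ <+: v.off → γ ≠ [] → ¬ Explicit T (s ++ γ)

/-- Type-1 nodes: the nodes of the CDAWG. -/
def IsType1 (T : List α) (v : Point α) : Prop := IsValue T v.base ∧ v.off = []

/-- Type-2 nodes: points in the middle of a CDAWG edge at which the path that spells out `a :: u`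
ends, for a letter `a` and the longest string `u` of a CDAWG node. -/
def IsType2 (T : List α) (v : Point α) : Prop :=
  v.off ≠ [] ∧ ∃ a u, IsValue T u ∧ EndsAt T (a :: u) v

/-- The nodes of the L-CDAWG. -/
def IsNode (T : List α) (v : Point α) : Prop := IsType1 T v ∨ IsType2 T v

/-- `(u, x, v)` is an edge of the L-CDAWG with its original label `x`: reading `x` from the node `u`
leads to the node `v`, without meeting a node in between. -/
def IsEdge (T : List α) (u : Point α) (x : List α) (v : Point α) : Prop :=
  IsNode T u ∧ IsNode T v ∧ x ≠ [] ∧ EndsAt T (u.str ++ x) v ∧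
    ∀ y, y <+: x → y ≠ [] → y ≠ x → ∀ w, EndsAt T (u.str ++ y) w → ¬ IsNode T w

/-- Suffix links.  From a type-1 node: to the node of the longest suffix of its longest string that
does not belong to it.  From the type-2 node at which `a :: u` ends: to the node of `u`.  The source
has no suffix link. -/
def IsSLink (T : List α) (v w : Point α) : Prop :=
  (IsType1 T v ∧ IsType1 T w ∧ ∃ y, y <:+ v.base ∧ ¬ EqR T y v.base ∧
      (∀ z, z <:+ v.base → y.length < z.length → EqR T z v.base) ∧ EndsAt T y w) ∨
  (IsType2 T v ∧ ∃ a u, IsValue T u ∧ EndsAt T (a :: u) v ∧ w = ⟨u, []⟩)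

/-- The L-CDAWG of `T` as a data structure.  Stored are only the numbers of nodes and edges, the
source, the types and suffix links of the nodes, and the end points, first letter and label length
of each edge; the out-going edges of a node are consecutive and sorted by their first letters
(node `i` has the edges `first i, …, first i + deg i - 1`).  The numbering is otherwise arbitrary.
The entry `slink root` is without meaning.  The fields `point` and `label` are not stored; they say
which node and which edge label of the L-CDAWG the numbers stand for. -/
structure LCDAWG [LinearOrder α] (T : List α) where
  nodes : ℕ
  edges : ℕ
  root : Fin nodes
  type2 : Fin nodes → Bool
  slink : Fin nodes → Fin nodes
  first : Fin nodes → ℕ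
  deg : Fin nodes → ℕ
  hi : Fin edges → Fin nodes
  lo : Fin edges → Fin nodes
  chr : Fin edges → α
  slen : Fin edges → ℕ
  point : Fin nodes → Point α
  label : Fin edges → List α
  point_injective : Function.Injective point
  point_range : ∀ v, (∃ i, point i = v) ↔ IsNode T v
  edge_injective : Function.Injective fun e => (point (hi e), label e, point (lo e))
  edge_range : ∀ u x v, (∃ e, point (hi e) = u ∧ label e = x ∧ point (lo e) = v) ↔ IsEdge T u x v
  root_spec : point root = ⟨[], []⟩
  type2_spec : ∀ i, type2 i = true ↔ IsType2 T (point i)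
  slink_spec : ∀ i, i ≠ root → IsSLink T (point i) (point (slink i))
  chr_spec : ∀ e, (label e).head? = some (chr e)
  slen_spec : ∀ e, slen e = (label e).length
  out_le : ∀ i, first i + deg i ≤ edges
  out_spec : ∀ i (e : Fin edges), hi e = i ↔ first i ≤ e ∧ (e : ℕ) < first i + deg i
  out_sorted : ∀ e e', hi e = hi e' → e < e' → chr e < chr e'

variable [LinearOrder α] {T : List α}

/-- `p` is a path of edges that starts at the node `i`. -/
def LCDAWG.IsPathFrom (L : LCDAWG T) : Fin L.nodes → List (Fin L.edges) → Prop
  | _, [] => True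
  | i, e :: p => L.hi e = i ∧ L.IsPathFrom (L.lo e) p

/-- The label string of a path. -/
def LCDAWG.pathLabel (L : LCDAWG T) (p : List (Fin L.edges)) : List α := p.flatMap L.label

/-- `p` is the edge suffix link of `e`: the path from the suffix link of `e.hi` that spells out the
label of `e`. -/
def LCDAWG.IsESuf (L : LCDAWG T) (e : Fin L.edges) (p : List (Fin L.edges)) : Prop :=
  2 ≤ L.slen e ∧ L.IsPathFrom (L.slink (L.hi e)) p ∧ L.pathLabel p = L.label e

/-- `p` is the jump link of `e`: edge suffix links are followed until a path of at least two edges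
is reached. -/
inductive LCDAWG.IsJump (L : LCDAWG T) : Fin L.edges → List (Fin L.edges) → Prop
  | done {e p} : L.IsESuf e p → 2 ≤ p.length → L.IsJump e p
  | step {e e₁ p} : L.IsESuf e [e₁] → L.IsJump e₁ p → L.IsJump e p

end Graph

/-! ### Straight-line programs -/

section SLPs

/-- A straight-line program with variables `0, …, size - 1`: each variable has exactly one
production, of the form `X → a` (`Sum.inl a`) or `X → YZ` (`Sum.inr (Y, Z)`), without loops. -/
structure SLP (α : Type*) where
  size : ℕ
  rule : Fin size → α ⊕ (Fin size × Fin size)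
  start : Fin size
  acyclic : WellFounded fun j i : Fin size => ∃ k, rule i = Sum.inr (j, k) ∨ rule i = Sum.inr (k, j)

variable {α : Type*}

/-- The phrase of a variable: the string that it produces. -/
noncomputable def SLP.phrase (R : SLP α) : Fin R.size → List α :=
  R.acyclic.fix fun i ih =>
    match h : R.rule i with
    | Sum.inl a => [a]
    | Sum.inr (j, k) => ih j ⟨k, Or.inl h⟩ ++ ih k ⟨j, Or.inr h⟩

theorem SLP.phrase_inl (R : SLP α) {i : Fin R.size} {a : α} (h : R.rule i = Sum.inl a) :
    R.phrase i = [a] := by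
  rw [SLP.phrase, WellFounded.fix_eq]
  split
  · simp_all
  · simp_all

theorem SLP.phrase_inr (R : SLP α) {i j k : Fin R.size} (h : R.rule i = Sum.inr (j, k)) :
    R.phrase i = R.phrase j ++ R.phrase k := by
  rw [SLP.phrase, WellFounded.fix_eq]
  split
  · simp_all
  · next j' k' h' =>
    obtain ⟨rfl, rfl⟩ : j' = j ∧ k' = k := by simpa [h] using h'.symm.trans h
    rfl

/-- The variable `v` is expanded along the list `p` by intermediate productions: for
`p = [e₁, …, e_k]` the productions are `v → X(e₁) Y₁`, `Y₁ → X(e₂) Y₂`, …, and finally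
`Y → X(e_{k-1}) X(e_k)`.  For `p = [e]` it says that `v` is `X(e)`. -/
inductive SLP.Expands (R : SLP α) {E : Type*} (X : E → Fin R.size) : Fin R.size → List E → Prop
  | single (e : E) : R.Expands X (X e) [e]
  | cons {v y : Fin R.size} {e : E} {p : List E} :
      R.rule v = Sum.inr (X e, y) → R.Expands X y p → R.Expands X v (e :: p)

end SLPs

/-! ### The machine model: a random access machine over a general ordered alphabet

A machine has integer registers, finitely many integer arrays and finitely many letter arrays (those
that its program mentions), all with random access.  Letters can be copied and compared, and nothing
else.  Programs are structured; each operation, each memory access, each test and each assignment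
takes one step. -/

section Machine

/-- A state of the machine; a letter cell may be blank. -/
structure State (α : Type*) where
  reg : ℕ → ℕ
  mem : ℕ → ℕ → ℕ
  chr : ℕ → ℕ → Option α

/-- Integer expressions. -/
inductive Expr
  | const (k : ℕ)
  | reg (r : ℕ)
  | read (a : ℕ) (i : Expr)
  | plus (e f : Expr)
  | minus (e f : Expr)
  | half (e : Expr)

/-- Tests.  `chrLt a i b j` compares the letter in cell `i` of letter array `a` with the letter in
cell `j` of letter array `b`; it fails if one of them is blank. -/
inductive Test
  | lt (e f : Expr)
  | eq (e f : Expr)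
  | chrLt (a : ℕ) (i : Expr) (b : ℕ) (j : Expr)
  | chrEq (a : ℕ) (i : Expr) (b : ℕ) (j : Expr)

/-- Programs. -/
inductive Prog
  | skip
  | set (r : ℕ) (e : Expr)
  | write (a : ℕ) (i e : Expr)
  | copyChr (a : ℕ) (i : Expr) (b : ℕ) (j : Expr)
  | seq (p q : Prog)
  | ite (c : Test) (p q : Prog)
  | loop (c : Test) (p : Prog)

variable {α : Type*}

/-- The value of an expression (`minus` is truncated subtraction, `half` rounds down). -/
def Expr.val (s : State α) : Expr → ℕ
  | .const k => k
  | .reg r => s.reg r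
  | .read a i => s.mem a (i.val s)
  | .plus e f => e.val s + f.val s
  | .minus e f => e.val s - f.val s
  | .half e => e.val s / 2

/-- All values that arise in the evaluation of the expression are at most `B`. -/
def Expr.Fits (B : ℕ) (s : State α) : Expr → Prop
  | .const k => k ≤ B
  | .reg r => s.reg r ≤ B
  | .read a i => i.Fits B s ∧ s.mem a (i.val s) ≤ B
  | .plus e f => e.Fits B s ∧ f.Fits B s ∧ e.val s + f.val s ≤ B
  | .minus e f => e.Fits B s ∧ f.Fits B s
  | .half e => e.Fits B s

/-- The number of steps that the evaluation of the expression takes. -/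
def Expr.cost : Expr → ℕ
  | .const _ => 1
  | .reg _ => 1
  | .read _ i => i.cost + 1
  | .plus e f => e.cost + f.cost + 1
  | .minus e f => e.cost + f.cost + 1
  | .half e => e.cost + 1

/-- The test succeeds. -/
def Test.Holds [LinearOrder α] (s : State α) : Test → Prop
  | .lt e f => e.val s < f.val s
  | .eq e f => e.val s = f.val s
  | .chrLt a i b j => ∃ x y, s.chr a (i.val s) = some x ∧ s.chr b (j.val s) = some y ∧ x < y
  | .chrEq a i b j => s.chr a (i.val s) = s.chr b (j.val s)

/-- All values that arise in the test are at most `B`. -/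
def Test.Fits (B : ℕ) (s : State α) : Test → Prop
  | .lt e f | .eq e f | .chrLt _ e _ f | .chrEq _ e _ f => e.Fits B s ∧ f.Fits B s

/-- The number of steps that the test takes. -/
def Test.cost : Test → ℕ
  | .lt e f | .eq e f | .chrLt _ e _ f | .chrEq _ e _ f => e.cost + f.cost + 1

/-- Assign the value `x` to register `r`. -/
def State.setReg (s : State α) (r x : ℕ) : State α :=
  { s with reg := Function.update s.reg r x }

/-- Write the value `x` into cell `i` of integer array `a`. -/
def State.setMem (s : State α) (a i x : ℕ) : State α :=
  { s with mem := Function.update s.mem a (Function.update (s.mem a) i x) }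

/-- Write `x` into cell `i` of letter array `a`. -/
def State.setChr (s : State α) (a i : ℕ) (x : Option α) : State α :=
  { s with chr := Function.update s.chr a (Function.update (s.chr a) i x) }

/-- `Exec B p s t s'`: started in the state `s`, the program `p` halts after `t` steps in the state
`s'`, and all integers that arise in the computation, addresses included, are at most `B`. -/
inductive Exec [LinearOrder α] (B : ℕ) : Prog → State α → ℕ → State α → Prop
  | skip {s} : Exec B .skip s 1 s
  | set {s r e} : e.Fits B s → Exec B (.set r e) s (e.cost + 1) (s.setReg r (e.val s))
  | write {s a i e} : i.Fits B s → e.Fits B s →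
      Exec B (.write a i e) s (i.cost + e.cost + 1) (s.setMem a (i.val s) (e.val s))
  | copyChr {s a i b j} : i.Fits B s → j.Fits B s →
      Exec B (.copyChr a i b j) s (i.cost + j.cost + 1)
        (s.setChr a (i.val s) (s.chr b (j.val s)))
  | seq {p q s t s₁ t₁ s₂} : Exec B p s t s₁ → Exec B q s₁ t₁ s₂ →
      Exec B (.seq p q) s (t + t₁) s₂
  | ite_true {c p q s t s₁} : c.Fits B s → c.Holds s → Exec B p s t s₁ →
      Exec B (.ite c p q) s (c.cost + t) s₁
  | ite_false {c p q s t s₁} : c.Fits B s → ¬ c.Holds s → Exec B q s t s₁ →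
      Exec B (.ite c p q) s (c.cost + t) s₁
  | loop_false {c p s} : c.Fits B s → ¬ c.Holds s → Exec B (.loop c p) s c.cost s
  | loop_true {c p s t s₁ t₁ s₂} : c.Fits B s → c.Holds s → Exec B p s t s₁ →
      Exec B (.loop c p) s₁ t₁ s₂ → Exec B (.loop c p) s (c.cost + t + t₁) s₂

/-- An array of length `n` as memory contents, with the cells beyond it set to `d`. -/
def cells {β : Type*} (d : β) {n : ℕ} (f : Fin n → β) (i : ℕ) : β :=
  if h : i < n then f ⟨i, h⟩ else d

/-- The initial state: the stored part of the L-CDAWG is in registers 0–2, integer arrays 0–6 and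
letter array 0; all else is zero or blank. -/
def LCDAWG.initState [LinearOrder α] {T : List α} (L : LCDAWG T) : State α where
  reg := fun
    | 0 => L.nodes
    | 1 => L.edges
    | 2 => L.root
    | _ => 0
  mem := fun
    | 0 => cells 0 fun i => if L.type2 i then 1 else 0
    | 1 => cells 0 fun i => (L.slink i : ℕ)
    | 2 => cells 0 L.first
    | 3 => cells 0 L.deg
    | 4 => cells 0 fun e => (L.hi e : ℕ)
    | 5 => cells 0 fun e => (L.lo e : ℕ)
    | 6 => cells 0 L.slen
    | _ => fun _ => 0
  chr := fun
    | 0 => cells none fun e => some (L.chr e)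
    | _ => fun _ => none

/-- The state contains the straight-line program `R` with a table of the variables `X e`: the number
of productions and the start variable are in registers 0 and 1; integer array 7 tells whether the
production of a variable is `X → a` (entry 0, the letter is in letter array 1) or `X → YZ` (entry 1,
with `Y` in array 8 and `Z` in array 9); and integer array 10 holds the table. -/
def State.Stores (s : State α) (R : SLP α) {m : ℕ} (X : Fin m → Fin R.size) : Prop :=
  s.reg 0 = R.size ∧ s.reg 1 = R.start ∧
  (∀ i a, R.rule i = Sum.inl a → s.mem 7 i = 0 ∧ s.chr 1 i = some a) ∧
  (∀ i j k, R.rule i = Sum.inr (j, k) → s.mem 7 i = 1 ∧ s.mem 8 i = j ∧ s.mem 9 i = k) ∧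
  ∀ e : Fin m, s.mem 10 e = X e

end Machine

end LinCDAWG

namespace LinCDAWG

/-! ### Occurrences -/

section Strings

variable {α : Type*} {T x y z : List α}

/-! Let `m` be the number of edges. Let `e` be an edge below `u` whose label `x` has length at least
2, and let `w` be the suffix link of `u`. Then `w` is a type-1 node, and for some letter `c` the
path of `c·str(w)` ends at `u` (`IsSLink.exists_cons`), so reading below `u` amounts to reading
after `c·str(w)`. If `y` is a proper nonempty prefix of `x`, then `str(w)y` is not explicit: left
extensions of explicit strings end at nodes (`isNode_of_cons`), and `e` has no node inside. On the
other hand `str(w)x` is explicit (`explicit_slink_append`). Hence the edge suffix link of `e` runs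
from `w` exactly to the next type-1 node, through type-2 nodes only (`LCDAWG.exists_isESuf`).

A type-2 node has exactly one out-going edge. So the edge suffix link is determined by its first
edge `e₁`, the edge below `w` with the first letter of `e`, and it consists of `e₁` alone if and
only if the two labels have equal length. Since strings of nodes shorten along suffix links, jump
links exist: the jump link of `e` is an edge `g` followed by the unique chain down to the next
type-1 node. The remainders of these chains depend only on the edge where they start, so all jump
links can share them. This leaves `m` variables for edges, `m` for an edge label continued to the
next type-1 node, and fewer than `m` for the path of the text.

Edges below type-1 nodes inject into the right extensions of maximal repeats, and type-2 nodes, with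
one edge each, into the left extensions; so `m ≤ numExt T` (`LCDAWG.edges_le`).

For the running time, `e₁` is found by binary search among at most `σ` sorted edges; this is the
only source of the logarithm. An edge whose edge suffix link is a single edge is marked. To resolve
it, links are followed to an unmarked edge, whose rule is copied to all edges on the way, which lose
their marks; so this costs linear time in total. The path of the text is the longest path from the
source; it is found in a topological order and followed backwards. -/

theorem infix_iff_endPos_nonempty : x <:+: T ↔ (endPos T x).Nonempty := by
  constructor
  · rintro ⟨p, q, rfl⟩
    refine ⟨(p ++ x).length, by simp, ?_⟩
    rw [List.take_left]
    exact List.suffix_append p x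
  · rintro ⟨j, _, h⟩
    exact h.isInfix.trans (List.take_prefix _ _).isInfix

theorem length_le_of_mem_endPos {j : ℕ} (h : j ∈ endPos T x) : x.length ≤ j := by
  have := h.2.length_le
  rw [List.length_take] at this
  omega

theorem endPos_subset_of_suffix (h : y <:+ x) : endPos T x ⊆ endPos T y :=
  fun _ hj => ⟨hj.1, h.trans hj.2⟩

theorem mem_endPos_append {j : ℕ} :
    j ∈ endPos T (x ++ z) ↔ ∃ i, j = i + z.length ∧ i ∈ endPos T x ∧ z <+: T.drop i := by
  constructor
  · rintro ⟨hj, p, hp⟩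
    have hl := congrArg List.length hp
    simp only [List.length_append, List.length_take] at hl
    have hT : T = (p ++ x) ++ (z ++ T.drop j) := by
      conv_lhs => rw [← List.take_append_drop j T, ← hp]
      simp
    refine ⟨(p ++ x).length, by simp; omega, ⟨by simp; omega, ?_⟩, ?_⟩
    · rw [hT, List.take_left]; exact List.suffix_append p x
    · rw [hT, List.drop_left]; exact List.prefix_append _ _
  · rintro ⟨i, rfl, ⟨hi, p, hp⟩, q, hq⟩
    have hT : T = (p ++ (x ++ z)) ++ q := by
      rw [← List.take_append_drop i T, ← hp, ← hq]; simp
    have hl := congrArg List.length hp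
    simp only [List.length_append, List.length_take] at hl
    have : i + z.length = (p ++ (x ++ z)).length := by simp; omega
    refine ⟨by rw [this, hT]; simp, ?_⟩
    rw [this, hT, List.take_left]
    exact List.suffix_append _ _

theorem mem_begPos_iff {i : ℕ} : i ∈ begPos T x ↔ i + x.length ∈ endPos T x := by
  have h : i ∈ endPos T ([] : List α) ↔ i ≤ T.length := by simp [endPos]
  have := @mem_endPos_append _ T [] x (i + x.length)
  rw [List.nil_append] at this
  rw [this]
  constructor
  · rintro ⟨h1, h2⟩
    exact ⟨i, rfl, h.2 h1, h2⟩
  · rintro ⟨k, hk, h1, h2⟩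
    obtain rfl : i = k := by omega
    exact ⟨h1.1, h2⟩

theorem EqR.symm (h : EqR T x y) : EqR T y x := Eq.symm h

theorem EqR.append (h : EqR T x y) (z : List α) : EqR T (x ++ z) (y ++ z) := by
  ext j
  rw [mem_endPos_append, mem_endPos_append, h]

theorem EqR.infix (h : EqR T x y) (hx : x <:+: T) : y <:+: T := by
  rw [infix_iff_endPos_nonempty] at *
  rwa [← h]

/-- Both strings end at a common position of `T`, and two suffixes of the same prefix of `T` are
comparable. -/
theorem EqR.suffix (h : EqR T x y) (hx : x <:+: T) (hl : x.length ≤ y.length) : x <:+ y := by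
  obtain ⟨j, hj⟩ := infix_iff_endPos_nonempty.1 hx
  have hj' : j ∈ endPos T y := by rwa [← h]
  exact List.suffix_of_suffix_length_le hj.2 hj'.2 hl

/-- Squeezing: if a suffix of `y` has the ending positions of `y`, so do the strings in between. -/
theorem EqR.of_suffix_of_suffix (h : EqR T x y) (h1 : x <:+ z) (h2 : z <:+ y) : EqR T z y :=
  Set.Subset.antisymm ((endPos_subset_of_suffix h1).trans h.subset) (endPos_subset_of_suffix h2)

theorem nil_infix_drop {a : α} {i : ℕ} : [a] <+: T.drop i ↔ T[i]? = some a := by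
  rw [List.prefix_iff_eq_take, List.length_singleton, List.take_one, List.head?_drop]
  cases h : T[i]? <;> simp [eq_comm]

/-- A string can be prolonged without losing a beginning position exactly if one letter follows all
its occurrences. An occurrence at the end of `T` is followed by `none`, which differs from every
letter. -/
theorem explicit_iff :
    Explicit T x ↔ x <:+: T ∧ ∀ a, ∃ i ∈ endPos T x, T[i]? ≠ some a := by
  refine and_congr_right fun hx => ⟨fun h a => ?_, fun h y hy => ?_⟩
  · by_contra! hc
    have : EqL T x (x ++ [a]) := by
      ext i
      rw [mem_begPos_iff, mem_begPos_iff, mem_endPos_append]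
      constructor
      · intro hi
        exact ⟨_, by simp [add_assoc], hi, nil_infix_drop.2 (hc _ hi)⟩
      · rintro ⟨k, hk, h1, -⟩
        obtain rfl : i + x.length = k := by simp at hk; omega
        exact h1
    have := h _ this
    simp at this
  · by_contra! hlt
    obtain ⟨i, hi⟩ := infix_iff_endPos_nonempty.1 hx
    have key : ∀ i ∈ endPos T x, i - x.length ∈ begPos T y := by
      intro i hi
      have := length_le_of_mem_endPos hi
      rw [← hy, mem_begPos_iff, Nat.sub_add_cancel this]
      exact hi
    have hb : ∀ i ∈ endPos T x, x <+: T.drop (i - x.length) := by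
      intro i hi
      have := length_le_of_mem_endPos hi
      have : i - x.length ∈ begPos T x := by
        rw [mem_begPos_iff, Nat.sub_add_cancel this]; exact hi
      exact this.2
    obtain ⟨u, rfl⟩ := List.prefix_of_prefix_length_le (hb i hi) (key i hi).2 hlt.le
    obtain - | ⟨a, u⟩ := u
    · simp at hlt
    obtain ⟨j, hj, hja⟩ := h a
    have h1 := (mem_begPos_iff.1 (key j hj))
    rw [show x ++ a :: u = (x ++ [a]) ++ u by simp, mem_endPos_append] at h1
    obtain ⟨k, hk, h1, -⟩ := h1
    rw [mem_endPos_append] at h1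
    obtain ⟨l, hl, -, h1⟩ := h1
    have := length_le_of_mem_endPos hj
    simp only [List.length_append, List.length_cons] at hk hl
    obtain rfl : l = j := by omega
    exact hja (nil_infix_drop.1 h1)

theorem Explicit.of_suffix (h : Explicit T x) (hy : y <:+ x) : Explicit T y := by
  rw [explicit_iff] at *
  refine ⟨hy.isInfix.trans h.1, fun a => ?_⟩
  obtain ⟨i, hi, hn⟩ := h.2 a
  exact ⟨i, endPos_subset_of_suffix hy hi, hn⟩

theorem Explicit.of_eqR (h : Explicit T x) (hy : EqR T x y) : Explicit T y := by
  have := hy.infix h.1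
  rw [explicit_iff] at *
  exact ⟨this, by rw [← hy]; exact h.2⟩

theorem EqR.explicit_iff (hy : EqR T x y) : Explicit T x ↔ Explicit T y :=
  ⟨fun h => h.of_eqR hy, fun h => h.of_eqR (Eq.symm hy)⟩

theorem explicit_nil : Explicit T [] := by
  rw [explicit_iff]
  refine ⟨List.nil_infix, fun a => ⟨T.length, by simp [endPos], by simp⟩⟩

theorem explicit_of_suffix (h : x <:+ T) : Explicit T x := by
  rw [explicit_iff]
  exact ⟨h.isInfix, fun a => ⟨T.length, by simpa [endPos] using h, by simp⟩⟩

/-- A substring that is not explicit is always followed by the same letter. -/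
theorem forced_of_not_explicit (hx : x <:+: T) (h : ¬ Explicit T x) :
    ∃ a, ∀ i ∈ endPos T x, T[i]? = some a := by
  rw [explicit_iff] at h
  push Not at h
  exact h hx

theorem eqR_iff_subset (h : x <:+ y) : EqR T x y ↔ endPos T x ⊆ endPos T y :=
  ⟨fun h => h.subset, fun h' => h'.antisymm (endPos_subset_of_suffix h)⟩

/-- A longer string with the same ending positions has `x` as a suffix; by squeezing, the letter
before `x` in it is already forced. -/
theorem leftmax_iff (hx : x <:+: T) :
    (∀ y, EqR T x y → y.length ≤ x.length) ↔ ∀ a, ¬ EqR T x (a :: x) := by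
  constructor
  · intro h a ha
    have := h _ ha
    simp at this
  · intro h y hy
    by_contra! hl
    obtain ⟨u, hu⟩ := hy.suffix hx hl.le
    rcases List.eq_nil_or_concat u with rfl | ⟨u, a, rfl⟩
    · simp only [List.nil_append] at hu
      subst hu; simp at hl
    · refine h a (Eq.trans hy (Eq.symm (hy.of_suffix_of_suffix (List.suffix_cons a x) ?_)))
      exact ⟨u, by simpa using hu⟩

theorem isValue_iff : IsValue T x ↔ Explicit T x ∧ ∀ a, ¬ EqR T x (a :: x) :=
  and_congr_right fun h => leftmax_iff h.1

theorem IsValue.suffix (h : IsValue T y) (hxy : EqR T x y) : x <:+ y := by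
  have := h.2 x (Eq.symm hxy)
  exact hxy.suffix (hxy.symm.infix h.1.1) this

theorem IsValue.eq_of_eqR (h : IsValue T x) (h' : IsValue T y) (hxy : EqR T x y) : x = y :=
  (h'.suffix hxy).eq_of_length_le (h.2 y hxy)

theorem IsValue.infix (h : IsValue T x) : x <:+: T := h.1.1

theorem isValue_self : IsValue T T := by
  refine isValue_iff.2 ⟨explicit_of_suffix List.suffix_rfl, fun a h => ?_⟩
  have := (h.infix List.infix_rfl).length_le
  simp at this

/-- Forced letters are prepended until none is left; this ends because the string stays a substring
of `T`. -/
theorem Explicit.exists_value {x : List α} (h : Explicit T x) : ∃ b, IsValue T b ∧ EqR T x b := by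
  by_cases hv : IsValue T x
  · exact ⟨x, hv, rfl⟩
  · rw [isValue_iff] at hv
    push Not at hv
    obtain ⟨a, ha⟩ := hv h
    have h' := h.of_eqR ha
    have hl := h'.1.length_le
    obtain ⟨b, hb, hab⟩ := h'.exists_value
    exact ⟨b, hb, Eq.trans ha hab⟩
termination_by T.length - x.length
decreasing_by simp at hl ⊢; omega

/-! ### Points of the CDAWG -/

theorem exists_longest_explicit_prefix (s y : List α) (hs : Explicit T s) :
    ∃ γ δ, y = γ ++ δ ∧ Explicit T (s ++ γ) ∧
      ∀ ε, ε <+: δ → ε ≠ [] → ¬ Explicit T (s ++ γ ++ ε) := by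
  by_cases h : ∃ ε, ε <+: y ∧ ε ≠ [] ∧ Explicit T (s ++ ε)
  · obtain ⟨ε, ⟨y', rfl⟩, hne, he⟩ := h
    have : 0 < ε.length := List.length_pos_iff.2 hne
    obtain ⟨γ, δ, rfl, h1, h2⟩ := exists_longest_explicit_prefix (s ++ ε) y' he
    exact ⟨ε ++ γ, δ, by simp, by simpa using h1, by simpa using h2⟩
  · push Not at h
    exact ⟨[], y, by simp, by simpa using hs, by simpa using h⟩
termination_by y.length
decreasing_by subst_vars; simp; omega

theorem exists_endsAt (hy : y <:+: T) : ∃ v, EndsAt T y v := by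
  obtain ⟨γ, δ, rfl, h1, h2⟩ := exists_longest_explicit_prefix [] y (explicit_nil (T := T))
  obtain ⟨b, hb, hγ⟩ := h1.exists_value
  exact ⟨⟨b, δ⟩, hy, hb, γ, rfl, h1, hγ, h2⟩

variable {v w : Point α}

/-- Both decompositions cut `y` after its longest explicit prefix, and a class has only one value.
-/
theorem EndsAt.unique (h : EndsAt T y v) (h' : EndsAt T y w) : v = w := by
  obtain ⟨-, hv, s, hs, hse, hsv, hsm⟩ := h
  obtain ⟨-, hw, t, ht, hte, htw, htm⟩ := h'
  have key : s = t := by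
    have hp : s <+: y := ⟨_, hs.symm⟩
    have hq : t <+: y := ⟨_, ht.symm⟩
    rcases List.prefix_or_prefix_of_prefix hp hq with ⟨γ, rfl⟩ | ⟨γ, rfl⟩
    · by_contra hne
      refine hsm γ ?_ (by rintro rfl; simp at hne) hte
      rw [ht, List.append_assoc, List.append_cancel_left_eq] at hs
      exact ⟨_, hs⟩
    · by_contra hne
      refine htm γ ?_ (by rintro rfl; simp at hne) hse
      rw [hs, List.append_assoc, List.append_cancel_left_eq] at ht
      exact ⟨_, ht⟩
  subst key
  ext1
  · exact hv.eq_of_eqR hw (Eq.trans (hsv.symm) htw)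
  · rw [hs] at ht
    exact List.append_cancel_left ht

theorem EndsAt.eqR (h : EndsAt T y v) : EqR T y v.str := by
  obtain ⟨-, hv, s, rfl, -, hsv, -⟩ := h
  exact hsv.append _

theorem EndsAt.suffix (h : EndsAt T y v) : y <:+ v.str := by
  obtain ⟨-, hv, s, rfl, -, hsv, -⟩ := h
  obtain ⟨p, hp⟩ := hv.suffix hsv
  exact ⟨p, by simp [Point.str, ← hp]⟩

theorem EndsAt.isValue (h : EndsAt T y v) : IsValue T v.base := h.2.1

theorem Explicit.endsAt_iff (h : Explicit T y) : EndsAt T y v ↔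
    v.off = [] ∧ IsValue T v.base ∧ EqR T y v.base := by
  constructor
  · rintro ⟨-, hv, s, rfl, -, hsv, hsm⟩
    have : v.off = [] := by
      by_contra hne
      exact hsm _ List.prefix_rfl hne h
    rw [this, List.append_nil]
    exact ⟨rfl, hv, hsv⟩
  · rintro ⟨ho, hv, hy⟩
    refine ⟨h.1, hv, y, by simp [ho], h, hy, fun γ hγ hne => ?_⟩
    rw [ho, List.prefix_nil] at hγ
    exact absurd hγ hne

theorem EndsAt.explicit_iff (h : EndsAt T y v) : Explicit T y ↔ v.off = [] := by
  refine ⟨fun h' => (h'.endsAt_iff.1 h).1, fun ho => ?_⟩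
  obtain ⟨-, hv, s, rfl, hs, -⟩ := h
  simpa [ho] using hs

theorem EndsAt.isType1_iff (h : EndsAt T y v) : IsType1 T v ↔ Explicit T y := by
  rw [h.explicit_iff]
  exact ⟨fun h => h.2, fun h' => ⟨h.isValue, h'⟩⟩

/-- Below an explicit string, paths depend only on the CDAWG node of that string. -/
theorem EndsAt.of_eqR_explicit {s s' z : List α} (hs : Explicit T s) (hss : EqR T s s')
    (h : EndsAt T (s ++ z) v) : EndsAt T (s' ++ z) v := by
  obtain ⟨hi, hv, t, ht, hte, htv, htm⟩ := h
  have hp : s <+: t := by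
    rcases List.prefix_or_prefix_of_prefix (⟨_, rfl⟩ : s <+: s ++ z) ⟨_, ht.symm⟩ with h | ⟨γ, rfl⟩
    · exact h
    · by_cases hne : γ = []
      · simp [hne]
      · refine absurd hs (htm γ ?_ hne)
        rw [List.append_assoc, List.append_cancel_left_eq] at ht
        exact ⟨_, ht⟩
  obtain ⟨γ, rfl⟩ := hp
  rw [List.append_assoc, List.append_cancel_left_eq] at ht
  subst ht
  refine ⟨(hss.append _).infix hi, hv, s' ++ γ, by simp, hte.of_eqR (hss.append _),
    Eq.trans (Eq.symm (hss.append γ)) htv, fun δ hδ hne he => htm δ hδ hne ?_⟩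
  rw [(hss.append γ |>.append δ).explicit_iff]
  exact he

/-- Paths below a point depend only on the point. -/
theorem EndsAt.append_iff (h : EndsAt T y v) : EndsAt T (y ++ z) w ↔ EndsAt T (v.str ++ z) w := by
  obtain ⟨-, hv, s, rfl, hs, hsv, -⟩ := h
  rw [Point.str, List.append_assoc, List.append_assoc]
  exact ⟨fun h => h.of_eqR_explicit hs hsv,
    fun h => h.of_eqR_explicit (hs.of_eqR hsv) (hsv.symm)⟩

theorem IsNode.exists_endsAt (h : IsNode T v) : ∃ y, EndsAt T y v := by
  rcases h with h | ⟨-, a, u, -, h⟩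
  · exact ⟨v.base, h.1.1.endsAt_iff.2 ⟨h.2, h.1, rfl⟩⟩
  · exact ⟨_, h⟩

theorem EndsAt.str (h : EndsAt T y v) : EndsAt T v.str v := by
  have := (h.append_iff (z := []) (w := v))
  simp only [List.append_nil] at this
  exact this.1 h

theorem IsNode.endsAt (h : IsNode T v) : EndsAt T v.str v :=
  let ⟨_, h⟩ := h.exists_endsAt; h.str

theorem IsType1.not_isType2 (h : IsType1 T v) : ¬ IsType2 T v := fun h' => h'.1 h.2

theorem IsType1.str_eq (h : IsType1 T v) : v.str = v.base := by simp [Point.str, h.2]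

/-- Left extensions of explicit strings lead to nodes. -/
theorem isNode_of_cons {c : α} (hz : Explicit T z) (h : EndsAt T (c :: z) v) : IsNode T v := by
  by_cases ho : v.off = []
  · exact Or.inl ⟨h.isValue, ho⟩
  -- If `z` were always preceded by one letter `d`, an occurrence of `c :: z` would force `d = c`;
  -- then `c :: z` would have the ending positions of `z` and be explicit.
  · refine Or.inr ⟨ho, c, z, isValue_iff.2 ⟨hz, fun d hd => ho ?_⟩, h⟩
    have hd' := infix_iff_endPos_nonempty.1 h.1
    obtain ⟨j, hj⟩ := hd'
    have hj' : j ∈ endPos T (d :: z) := by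
      rw [← hd]; exact endPos_subset_of_suffix (List.suffix_cons c z) hj
    have : c :: z = d :: z :=
      (List.suffix_of_suffix_length_le hj.2 hj'.2 (by simp)).eq_of_length (by simp)
    rw [← this] at hd
    exact h.explicit_iff.1 (hz.of_eqR hd)

/-- The string of the suffix link, extended by one letter, leads to the node. -/
theorem IsSLink.exists_cons (h : IsSLink T v w) :
    IsType1 T w ∧ ∃ c, EndsAt T (c :: w.str) v := by
  rcases h with ⟨hv1, hw, y, hy, hne, hmax, hyw⟩ | ⟨hv2, a, u, hu, he, rfl⟩
  · refine ⟨hw, ?_⟩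
    obtain ⟨p, hp⟩ := hy
    rcases List.eq_nil_or_concat p with rfl | ⟨p, c, rfl⟩
    · simp only [List.nil_append] at hp
      exact absurd (by rw [hp]; rfl) hne
    · rw [List.concat_eq_append, List.append_assoc, List.singleton_append] at hp
      have hc : EqR T (c :: y) v.base := hmax _ ⟨p, hp⟩ (by simp)
      have hcs : c :: y <:+: T := hc.symm.infix hv1.1.infix
      have hey : Explicit T y :=
        hv1.1.1.of_suffix ((List.suffix_cons c y).trans ⟨p, hp⟩)
      have hvy : IsValue T y := by
        refine isValue_iff.2 ⟨hey, fun d hd => hne ?_⟩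
        obtain ⟨j, hj⟩ := infix_iff_endPos_nonempty.1 hcs
        have hj' : j ∈ endPos T (d :: y) := by
          rw [← hd]; exact endPos_subset_of_suffix (List.suffix_cons c y) hj
        have : c :: y = d :: y :=
          (List.suffix_of_suffix_length_le hj.2 hj'.2 (by simp)).eq_of_length (by simp)
        rw [← this] at hd
        exact Eq.trans hd hc
      have : y = w.str := by
        rw [hw.str_eq]
        exact hvy.eq_of_eqR hw.1 (hey.endsAt_iff.1 hyw).2.2
      rw [← this]
      refine ⟨c, Explicit.endsAt_iff ?_ |>.2 ⟨hv1.2, hv1.1, hc⟩⟩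
      exact hv1.1.1.of_eqR (Eq.symm hc)
  · exact ⟨⟨hu, rfl⟩, a, by simpa [Point.str] using he⟩

/-- The path from the suffix link of `v` that spells out the label of an edge below `v` is one
CDAWG edge. -/
theorem explicit_slink_append {u v w : Point α} {c : α} (hw : IsType1 T w)
    (hc : EndsAt T (c :: w.str) u) (he : IsEdge T u x v) : Explicit T (w.str ++ x) := by
  obtain ⟨hu, hv, hx, hxv, hin⟩ := he
  rw [← hc.append_iff] at hxv
  rcases hv with hv | ⟨ho, a, z, hz, hzv⟩
  · rw [hxv.isType1_iff] at hv
    exact hv.of_suffix (List.suffix_cons _ _)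
  · have hzr : EqR T (a :: z) (c :: w.str ++ x) := Eq.trans hzv.eqR (Eq.symm hxv.eqR)
    -- Two strings now end at `v` and are comparable as suffixes. Equal lengths give the claim; the
    -- other two cases contradict the left-maximality of a value or the absence of nodes inside the
    -- edge.
    rcases lt_trichotomy (a :: z).length (c :: w.str ++ x).length with hl | hl | hl
    · exfalso
      obtain ⟨p, hp⟩ := hzr.suffix hzv.1 hl.le
      obtain ⟨-, hvb, s, hs, -, hsv, -⟩ := hzv
      obtain ⟨-, -, t, ht, hte, htv, htm⟩ := hxv
      -- Both strings leave the same offset below the same CDAWG node, so they differ only in front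
      -- of their longest explicit prefixes `s` and `t`.
      have hpt : t = p ++ s := by
        rw [hs, ht, ← List.append_assoc] at hp
        exact (List.append_cancel_right hp).symm
      rw [hpt] at ht htv hte htm
      obtain - | ⟨c', p⟩ := p
      · simp only [List.nil_append] at hp
        rw [hp] at hl; simp at hl
      have hts : EqR T (p ++ s) (c' :: (p ++ s)) :=
        EqR.of_suffix_of_suffix (Eq.trans hsv (Eq.symm htv)) (List.suffix_append p s)
          (List.suffix_cons _ _)
      have ht2 : c :: (w.str ++ x) = c' :: (p ++ s ++ v.off) := ht
      have hcc := (List.cons_eq_cons.1 ht2).1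
      subst hcc
      replace ht2 := (List.cons_eq_cons.1 ht2).2
      -- Without its first letter, `t` keeps its ending positions. If it then goes beyond `w.str`,
      -- the explicit `t` gives a node inside the edge; otherwise `w.str` is always preceded by `c`.
      rcases List.prefix_or_prefix_of_prefix (⟨_, rfl⟩ : w.str <+: w.str ++ x) ⟨_, ht2.symm⟩
        with ⟨γ, hγ⟩ | ⟨γ, hγ⟩
      · by_cases hγ0 : γ = []
        · subst hγ0
          rw [List.append_nil] at hγ
          rw [← hγ, hw.str_eq] at hts
          exact (isValue_iff.1 hw.1).2 _ hts
        · have hxγ : x = γ ++ v.off := by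
            rw [← hγ, List.append_assoc, List.append_cancel_left_eq] at ht2
            exact ht2
          have hex : Explicit T (c :: w.str ++ γ) := by
            simpa [hγ] using hte
          obtain ⟨q, hq⟩ := exists_endsAt hex.1
          refine hin γ ⟨_, hxγ.symm⟩ hγ0 ?_ q ((hc.append_iff).1 hq)
            (Or.inl (hq.isType1_iff.2 hex))
          intro h
          rw [hxγ] at h
          simp [ho] at h
      · have := hts.append γ
        rw [List.cons_append, hγ, hw.str_eq] at this
        exact (isValue_iff.1 hw.1).2 _ this
    · have := (hzr.suffix hzv.1 hl.le).eq_of_length hl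
      simp only [List.cons_append, List.cons.injEq] at this
      rw [← this.2]
      exact hz.1
    · exfalso
      have h1 : c :: w.str ++ x <:+ a :: z := hzr.symm.suffix hxv.1 hl.le
      have h2 : c :: w.str ++ x <:+ z := by
        rcases List.suffix_cons_iff.1 h1 with h | h
        · rw [h] at hl; simp at hl
        · exact h
      exact (isValue_iff.1 hz).2 a
        (hzr.symm.of_suffix_of_suffix h2 (List.suffix_cons _ _))

/-- Otherwise the left extension by `c` would end at a node strictly inside the edge. -/
theorem not_explicit_slink_append {u v w : Point α} {c : α}
    (hc : EndsAt T (c :: w.str) u) (he : IsEdge T u x v) (hy : y <+: x) (hy0 : y ≠ [])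
    (hyx : y ≠ x) : ¬ Explicit T (w.str ++ y) := by
  intro hex
  obtain ⟨hu, hv, hx, hxv, hin⟩ := he
  rw [← hc.append_iff] at hxv
  obtain ⟨p, rfl⟩ := hy
  have hi : c :: w.str ++ y <:+: T :=
    List.IsInfix.trans ⟨[], p, by simp⟩ hxv.1
  obtain ⟨q, hq⟩ := exists_endsAt hi
  exact hin y ⟨_, rfl⟩ hy0 hyx q (hc.append_iff.1 hq) (isNode_of_cons hex hq)

/-- The empty string is explicit, so each single letter already leads to a node. Hence edges with
longer labels start at nodes that have a suffix link. -/
theorem edge_length_root {v : Point α} (he : IsEdge T ⟨[], []⟩ x v) : x.length = 1 := by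
  obtain ⟨hu, hv, hx, hxv, hin⟩ := he
  obtain - | ⟨c, x⟩ := x
  · exact absurd rfl hx
  by_contra hl
  have hi : [c] <:+: T := List.IsInfix.trans ⟨[], x, by simp [Point.str]⟩ hxv.1
  obtain ⟨q, hq⟩ := exists_endsAt hi
  refine hin [c] ⟨x, rfl⟩ (by simp) (by rintro h; rw [← h] at hl; simp at hl) q
    (by simpa [Point.str] using hq) (isNode_of_cons explicit_nil hq)

end Strings

end LinCDAWG

namespace LinCDAWG

/-! ### Structure of the L-CDAWG -/

section Graph

namespace LCDAWG

variable {α : Type*} [LinearOrder α] {T : List α} (L : LCDAWG T)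

/-- The longest string that leads to a node. -/
def str (i : Fin L.nodes) : List α := (L.point i).str

/-- The last node of a path. -/
def pathEnd : Fin L.nodes → List (Fin L.edges) → Fin L.nodes
  | i, [] => i
  | _, e :: p => pathEnd (L.lo e) p

theorem isNode (i : Fin L.nodes) : IsNode T (L.point i) := (L.point_range _).1 ⟨i, rfl⟩

theorem isEdge (e : Fin L.edges) : IsEdge T (L.point (L.hi e)) (L.label e) (L.point (L.lo e)) :=
  (L.edge_range _ _ _).1 ⟨e, rfl, rfl, rfl⟩

theorem endsAt (i : Fin L.nodes) : EndsAt T (L.str i) (L.point i) := (L.isNode i).endsAt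

theorem endsAt_lo (e : Fin L.edges) : EndsAt T (L.str (L.hi e) ++ L.label e) (L.point (L.lo e)) :=
  (L.isEdge e).2.2.2.1

theorem label_ne_nil (e : Fin L.edges) : L.label e ≠ [] := (L.isEdge e).2.2.1

theorem slen_pos (e : Fin L.edges) : 0 < L.slen e := by
  rw [L.slen_spec]; exact List.length_pos_iff.2 (L.label_ne_nil e)

theorem label_eq_cons (e : Fin L.edges) : ∃ x, L.label e = L.chr e :: x :=
  ⟨_, List.eq_cons_of_mem_head? (L.chr_spec e)⟩

theorem edge_eq {e e' : Fin L.edges} (h : L.hi e = L.hi e') (hc : L.chr e = L.chr e') : e = e' := by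
  rcases lt_trichotomy e e' with hl | hl | hl
  · exact absurd hc (L.out_sorted _ _ h hl).ne
  · exact hl
  · exact absurd hc (L.out_sorted _ _ h.symm hl).ne'

theorem str_root : L.str L.root = [] := by simp [str, L.root_spec, Point.str]

theorem isType1_iff (i : Fin L.nodes) : IsType1 T (L.point i) ↔ L.type2 i = false := by
  rw [← Bool.not_eq_true, L.type2_spec]
  exact ⟨fun h => h.not_isType2, fun h => (L.isNode i).resolve_right h⟩

theorem explicit_str_iff (i : Fin L.nodes) : Explicit T (L.str i) ↔ L.type2 i = false := by
  rw [← isType1_iff, (L.endsAt i).isType1_iff]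

theorem eq_of_endsAt {i j : Fin L.nodes} {y : List α} (h : EndsAt T y (L.point i))
    (h' : EndsAt T y (L.point j)) : i = j := L.point_injective (h.unique h')

theorem slen_add_le (e : Fin L.edges) :
    (L.str (L.hi e)).length + L.slen e ≤ (L.str (L.lo e)).length := by
  have h : _ ≤ (L.str (L.lo e)).length := (L.endsAt_lo e).suffix.length_le
  simpa [L.slen_spec] using h

theorem str_lo_eq {e : Fin L.edges}
    (h : (L.str (L.hi e)).length + L.slen e = (L.str (L.lo e)).length) :
    L.str (L.hi e) ++ L.label e = L.str (L.lo e) :=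
  (L.endsAt_lo e).suffix.eq_of_length (by
    rw [List.length_append, ← L.slen_spec]; exact h)

theorem length_str_hi_lt (e : Fin L.edges) :
    (L.str (L.hi e)).length < (L.str (L.lo e)).length := by
  have := L.slen_add_le e
  have := L.slen_pos e
  omega

theorem length_str_le (i : Fin L.nodes) : (L.str i).length ≤ T.length :=
  (L.endsAt i).1.length_le

theorem pathLabel_cons (e : Fin L.edges) (p) : L.pathLabel (e :: p) = L.label e ++ L.pathLabel p :=
  List.flatMap_cons

theorem pathLabel_nil : L.pathLabel [] = [] := List.flatMap_nil

theorem pathLabel_append (p q) : L.pathLabel (p ++ q) = L.pathLabel p ++ L.pathLabel q :=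
  List.flatMap_append

theorem isPathFrom_append {i : Fin L.nodes} {p q : List (Fin L.edges)} :
    L.IsPathFrom i (p ++ q) ↔ L.IsPathFrom i p ∧ L.IsPathFrom (L.pathEnd i p) q := by
  induction p generalizing i with
  | nil => simp [IsPathFrom, pathEnd]
  | cons e p ih => simp [IsPathFrom, pathEnd, ih, and_assoc]

theorem pathEnd_append {i : Fin L.nodes} {p q : List (Fin L.edges)} :
    L.pathEnd i (p ++ q) = L.pathEnd (L.pathEnd i p) q := by
  induction p generalizing i with
  | nil => rfl
  | cons e p ih => simp [pathEnd, ih]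

theorem endsAt_pathEnd {i : Fin L.nodes} {p : List (Fin L.edges)} {y : List α}
    (hp : L.IsPathFrom i p) (hy : EndsAt T y (L.point i)) :
    EndsAt T (y ++ L.pathLabel p) (L.point (L.pathEnd i p)) := by
  induction p generalizing i y with
  | nil => simpa [pathLabel_nil, pathEnd] using hy
  | cons e p ih =>
    obtain ⟨rfl, hp⟩ := hp
    rw [pathLabel_cons, ← List.append_assoc]
    exact ih hp (hy.append_iff.2 (L.endsAt_lo e))

/-- The first edge of the path that spells out a string. -/
theorem exists_first_edge {i j : Fin L.nodes} {x : List α} (hx : x ≠ [])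
    (h : EndsAt T (L.str i ++ x) (L.point j)) : ∃ e, L.hi e = i ∧ L.label e <+: x := by
  classical
  -- The shortest nonempty prefix of `x` that leads to a node is the label of the first edge.
  have hex : ∃ k, 0 < k ∧ k ≤ x.length ∧ ∃ w, EndsAt T (L.str i ++ x.take k) w ∧ IsNode T w :=
    ⟨x.length, List.length_pos_iff.2 hx, le_rfl, _, by simpa using h, L.isNode j⟩
  obtain ⟨h0, hk, w, hw, hn⟩ := Nat.find_spec hex
  have hmin : ∀ k, k < Nat.find hex → _ := fun k => Nat.find_min hex
  generalize Nat.find hex = k at h0 hk hw hmin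
  have he : IsEdge T (L.point i) (x.take k) w := by
    refine ⟨L.isNode i, hn, ?_, hw, ?_⟩
    · intro h
      have := congrArg List.length h
      rw [List.length_take, List.length_nil] at this
      omega
    · intro y hy hy0 hyx v hv hvn
      have hl := hy.length_le
      rw [List.length_take] at hl
      have hyt : y = x.take y.length := List.prefix_iff_eq_take.1 (hy.trans (List.take_prefix _ _))
      refine hmin y.length ?_ ⟨List.length_pos_iff.2 hy0, by omega, v, ?_, hvn⟩
      · by_contra hc
        refine hyx (hyt.trans ?_)
        congr 1; omega
      · rw [← hyt]; exact hv
  obtain ⟨e, he1, he2, -⟩ := (L.edge_range _ _ _).2 he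
  exact ⟨e, L.point_injective he1, he2 ▸ List.take_prefix _ _⟩

theorem exists_path {i j : Fin L.nodes} (x : List α) (h : EndsAt T (L.str i ++ x) (L.point j)) :
    ∃ p, L.IsPathFrom i p ∧ L.pathLabel p = x ∧ L.pathEnd i p = j := by
  by_cases hx : x = []
  · subst hx
    exact ⟨[], trivial, rfl, L.eq_of_endsAt (L.endsAt i) (by simpa using h)⟩
  · obtain ⟨e, rfl, z, hz⟩ := L.exists_first_edge hx h
    have hl : z.length < x.length := by
      have := L.slen_pos e
      rw [L.slen_spec] at this
      rw [← hz, List.length_append]; omega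
    have hz' : EndsAt T (L.str (L.lo e) ++ z) (L.point j) := by
      rw [← hz, ← List.append_assoc] at h
      exact (L.endsAt_lo e).append_iff.1 h
    obtain ⟨p, hp, rfl, hj⟩ := exists_path z hz'
    exact ⟨e :: p, ⟨rfl, hp⟩, by rw [pathLabel_cons, hz], hj⟩
termination_by x.length

/-- The last edge of the longest path to a node. -/
theorem exists_primary_edge {i : Fin L.nodes} (hi : i ≠ L.root) :
    ∃ e, L.lo e = i ∧ (L.str (L.hi e)).length + L.slen e = (L.str i).length := by
  have h : EndsAt T (L.str L.root ++ L.str i) (L.point i) := by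
    rw [str_root]; exact L.endsAt i
  obtain ⟨p, hp, hl, hpe⟩ := L.exists_path _ h
  rcases List.eq_nil_or_concat p with rfl | ⟨p, e, rfl⟩
  · exact absurd hpe.symm hi
  · rw [List.concat_eq_append] at *
    rw [isPathFrom_append] at hp
    rw [pathEnd_append] at hpe
    have h1 : L.hi e = L.pathEnd L.root p := hp.2.1
    have h2 : L.lo e = i := hpe
    refine ⟨e, h2, le_antisymm (h2 ▸ L.slen_add_le e) ?_⟩
    have h3 := (L.endsAt_pathEnd hp.1 (L.endsAt L.root)).suffix.length_le
    rw [str_root, List.nil_append, ← h1] at h3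
    have h4 := congrArg List.length hl
    rw [pathLabel_append, List.length_append, pathLabel_cons, pathLabel_nil, List.append_nil,
      ← L.slen_spec] at h4
    rw [← h4]
    exact Nat.add_le_add_right h3 _

theorem exists_text_node : ∃ i, L.str i = T := by
  obtain ⟨i, hi⟩ := (L.point_range ⟨T, []⟩).2 (Or.inl ⟨isValue_self, rfl⟩)
  exact ⟨i, by simp [str, hi, Point.str]⟩

theorem str_eq_text {i : Fin L.nodes} (h : (L.str i).length = T.length) : L.str i = T :=
  (L.endsAt i).1.eq_of_length h

/-! ### Type-2 nodes -/

/-- The string of a type-2 node is not explicit, so one letter is forced after it, and edges below a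
node differ in their first letters. There is an edge because an occurrence can be continued to the
end of `T`, which leads to a type-1 node. -/
theorem exists_unique_edge {i : Fin L.nodes} (hi : L.type2 i = true) :
    ∃ e, L.hi e = i ∧ ∀ e', L.hi e' = i → e' = e := by
  have hne : ¬ Explicit T (L.str i) := by rw [explicit_str_iff, hi]; simp
  obtain ⟨a, ha⟩ := forced_of_not_explicit (L.endsAt i).1 hne
  obtain ⟨p, q, hpq⟩ := (L.endsAt i).1
  have hs : L.str i ++ q <:+ T := ⟨p, by rw [← List.append_assoc]; exact hpq⟩
  obtain ⟨v, hv⟩ := exists_endsAt hs.isInfix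
  obtain ⟨j, rfl⟩ := (L.point_range v).2 (Or.inl (hv.isType1_iff.2 (explicit_of_suffix hs)))
  have hq : q ≠ [] := by
    rintro rfl
    rw [List.append_nil] at hs
    exact hne (explicit_of_suffix hs)
  obtain ⟨e, he, -⟩ := L.exists_first_edge hq hv
  have key : ∀ e, L.hi e = i → L.chr e = a := by
    intro e he
    obtain ⟨x, hx⟩ := L.label_eq_cons e
    have h := (L.endsAt_lo e).1
    rw [he, hx, infix_iff_endPos_nonempty] at h
    obtain ⟨k, hk⟩ := h
    obtain ⟨l, -, hl, hla⟩ := mem_endPos_append.1 hk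
    have h1 := nil_infix_drop.1 (List.IsPrefix.trans (⟨x, rfl⟩ : [L.chr e] <+: _) hla)
    rw [ha l hl] at h1
    exact (Option.some.inj h1).symm
  exact ⟨e, he, fun e' he' => L.edge_eq (he'.trans he.symm) ((key _ he').trans (key _ he).symm)⟩

/-- This lets the program find the only edge below a type-2 node with one memory access. -/
theorem first_eq {e : Fin L.edges} (hi : L.type2 (L.hi e) = true) : L.first (L.hi e) = e := by
  obtain ⟨e₁, he₁, hu⟩ := L.exists_unique_edge hi
  have h := (L.out_spec (L.hi e) e).1 rfl
  have hle := L.out_le (L.hi e)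
  have : L.hi ⟨L.first (L.hi e), by omega⟩ = L.hi e := by
    rw [L.out_spec]; simp only; omega
  have h2 := (hu _ this).trans (hu _ rfl).symm
  exact congrArg Fin.val h2

/-- The edges from a node to the next type-1 node. -/
inductive Chain : Fin L.nodes → List (Fin L.edges) → Prop
  | nil {i} : L.type2 i = false → Chain i []
  | cons {e p} : L.type2 (L.hi e) = true → Chain (L.lo e) p → Chain (L.hi e) (e :: p)

variable {L} in
theorem Chain.unique {i : Fin L.nodes} {p q : List (Fin L.edges)} (hp : L.Chain i p)
    (hq : L.Chain i q) : p = q := by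
  induction hp generalizing q with
  | nil h =>
    cases hq with
    | nil => rfl
    | cons h' => simp [h] at h'
  | @cons e p h _ ih =>
    generalize hi : L.hi e = i at hq
    cases hq with
    | nil h' => rw [← hi, h] at h'; cases h'
    | @cons e' q h' hq =>
      obtain ⟨e₁, -, hu⟩ := L.exists_unique_edge h
      obtain rfl : e = e' := (hu _ rfl).trans (hu _ hi.symm).symm
      rw [ih hq]

theorem exists_chain (i : Fin L.nodes) : ∃ p, L.Chain i p := by
  by_cases h : L.type2 i = true
  · obtain ⟨e, rfl, -⟩ := L.exists_unique_edge h
    have := L.length_str_hi_lt e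
    have := L.length_str_le (L.lo e)
    obtain ⟨p, hp⟩ := exists_chain (L.lo e)
    exact ⟨_, .cons h hp⟩
  · exact ⟨[], .nil (by simpa using h)⟩
termination_by T.length - (L.str i).length

/-- The string that leads from a node to the next type-1 node. -/
noncomputable def rest (i : Fin L.nodes) : List α := L.pathLabel (L.exists_chain i).choose

variable {L} in
theorem Chain.rest_eq {i : Fin L.nodes} {p : List (Fin L.edges)} (hp : L.Chain i p) :
    L.rest i = L.pathLabel p := by
  rw [rest, (L.exists_chain i).choose_spec.unique hp]

theorem rest_type1 {i : Fin L.nodes} (h : L.type2 i = false) : L.rest i = [] :=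
  (Chain.nil h).rest_eq

theorem rest_type2 {e : Fin L.edges} (h : L.type2 (L.hi e) = true) :
    L.rest (L.hi e) = L.label e ++ L.rest (L.lo e) := by
  obtain ⟨p, hp⟩ := L.exists_chain (L.lo e)
  rw [(Chain.cons h hp).rest_eq, hp.rest_eq, pathLabel_cons]

/-- A path to a type-1 node through type-2 nodes only. -/
theorem chain_of_path {i : Fin L.nodes} {p : List (Fin L.edges)} (hp : L.IsPathFrom i p)
    (hi : L.type2 (L.pathEnd i p) = false)
    (h : ∀ q, q <+: p → q ≠ p → L.type2 (L.pathEnd i q) = true) : L.Chain i p := by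
  induction p generalizing i with
  | nil => exact .nil hi
  | cons e p ih =>
    obtain ⟨rfl, hp⟩ := hp
    refine .cons (h [] List.nil_prefix (by simp)) (ih hp hi fun q hq hne => ?_)
    exact h (e :: q) (List.cons_prefix_cons.2 ⟨rfl, hq⟩) (by simpa using hne)

/-! ### Edge suffix links and jump links -/

theorem exists_cons_slink {i : Fin L.nodes} (hi : i ≠ L.root) :
    L.type2 (L.slink i) = false ∧ ∃ c, EndsAt T (c :: L.str (L.slink i)) (L.point i) := by
  rw [← isType1_iff]
  exact (L.slink_spec i hi).exists_cons

theorem length_slink_lt {i : Fin L.nodes} (hi : i ≠ L.root) :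
    (L.str (L.slink i)).length < (L.str i).length := by
  obtain ⟨-, c, hc⟩ := L.exists_cons_slink hi
  have h : _ ≤ (L.str i).length := hc.suffix.length_le
  simpa using h

theorem hi_ne_root {e : Fin L.edges} (he : 2 ≤ L.slen e) : L.hi e ≠ L.root := by
  intro h
  have := L.isEdge e
  rw [h, L.root_spec] at this
  have := edge_length_root this
  rw [L.slen_spec] at he
  omega

/-- `e₁` is the first edge of the edge suffix link of `e`. -/
def IsPar (e e₁ : Fin L.edges) : Prop := L.hi e₁ = L.slink (L.hi e) ∧ L.chr e₁ = L.chr e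

/-- The path lies on a single CDAWG edge: it ends at an explicit string and meets none before, so
all its inner nodes are of type 2. -/
theorem exists_isESuf {e : Fin L.edges} (he : 2 ≤ L.slen e) :
    ∃ e₁ p, L.IsESuf e (e₁ :: p) ∧ L.Chain (L.lo e₁) p ∧ L.IsPar e e₁ := by
  have hr := L.hi_ne_root he
  obtain ⟨hw, c, hc⟩ := L.exists_cons_slink hr
  have hex := explicit_slink_append ((L.isType1_iff _).2 hw) hc (L.isEdge e)
  obtain ⟨v, hv⟩ := exists_endsAt hex.1
  obtain ⟨j, rfl⟩ := (L.point_range v).2 (Or.inl (hv.isType1_iff.2 hex))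
  obtain ⟨p, hp, hpl, hpe⟩ := L.exists_path (i := L.slink (L.hi e)) _ hv
  obtain - | ⟨e₁, p⟩ := p
  · exact absurd hpl.symm (L.label_ne_nil e)
  refine ⟨e₁, p, ⟨he, hp, hpl⟩, L.chain_of_path hp.2 ?_ ?_, hp.1, ?_⟩
  · have : L.pathEnd (L.lo e₁) p = j := hpe
    rw [this, ← isType1_iff, hv.isType1_iff]
    exact hex
  · intro q ⟨q', hq'⟩ hne
    have hq1 : L.IsPathFrom (L.slink (L.hi e)) (e₁ :: q) := by
      rw [← hq'] at hp
      exact ⟨hp.1, (L.isPathFrom_append.1 hp.2).1⟩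
    have hq := L.endsAt_pathEnd hq1 (L.endsAt _)
    have hsplit : L.label e = L.pathLabel (e₁ :: q) ++ L.pathLabel q' := by
      rw [← hpl, ← hq', ← pathLabel_append, List.cons_append]
    have hq0 : q' ≠ [] := by
      rintro rfl
      simp [hne] at hq'
    have := not_explicit_slink_append (w := L.point (L.slink (L.hi e))) hc (L.isEdge e)
      ⟨_, hsplit.symm⟩ ?_ ?_
    · rw [← Bool.not_eq_false, ← isType1_iff]
      intro h
      exact this (hq.isType1_iff.1 h)
    · rw [pathLabel_cons]; simp [L.label_ne_nil]
    · intro h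
      rw [← h] at hsplit
      replace hsplit := List.self_eq_append_right.1 hsplit
      obtain - | ⟨e₂, q'⟩ := q'
      · exact hq0 rfl
      · rw [pathLabel_cons] at hsplit
        simp [L.label_ne_nil] at hsplit
  · have h1 := L.chr_spec e
    obtain ⟨x, hx⟩ := L.label_eq_cons e₁
    change L.pathLabel (e₁ :: p) = L.label e at hpl
    rw [← hpl, pathLabel_cons, hx] at h1
    simpa using h1

variable {L}

theorem IsPar.unique {e e₁ e₂ : Fin L.edges} (h₁ : L.IsPar e e₁) (h₂ : L.IsPar e e₂) : e₁ = e₂ :=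
  L.edge_eq (h₁.1.trans h₂.1.symm) (h₁.2.trans h₂.2.symm)

/-- Comparing two label lengths reveals whether the edge suffix link is a single edge; no label has
to be known. -/
theorem IsPar.isESuf {e e₁ : Fin L.edges} (h : L.IsPar e e₁) (he : 2 ≤ L.slen e) :
    ∃ p, L.IsESuf e (e₁ :: p) ∧ L.Chain (L.lo e₁) p ∧ (L.slen e₁ = L.slen e ↔ p = []) := by
  obtain ⟨e₂, p, hp, hc, h'⟩ := L.exists_isESuf he
  obtain rfl := h.unique h'
  refine ⟨p, hp, hc, ?_⟩
  have h1 := congrArg List.length hp.2.2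
  rw [pathLabel_cons, List.length_append, ← L.slen_spec, ← L.slen_spec] at h1
  constructor
  · intro h
    obtain - | ⟨e₂, q⟩ := p
    · rfl
    · have := L.slen_pos e₂
      rw [pathLabel_cons, List.length_append, ← L.slen_spec] at h1
      omega
  · rintro rfl
    simpa [pathLabel_nil] using h1

/-- The measure that keeps repeated edge suffix links from running in circles. -/
theorem IsPar.length_lt {e e₁ : Fin L.edges} (h : L.IsPar e e₁) (he : 2 ≤ L.slen e) :
    (L.str (L.hi e₁)).length < (L.str (L.hi e)).length := by
  rw [h.1]
  exact L.length_slink_lt (L.hi_ne_root he)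

variable (L) in
/-- `g` is the first edge of the jump link of `e`. -/
def IsJumpHead (e g : Fin L.edges) : Prop :=
  ∃ p, p ≠ [] ∧ L.IsJump e (g :: p) ∧ L.Chain (L.lo g) p

theorem IsPar.isJumpHead {e e₁ : Fin L.edges} (h : L.IsPar e e₁) (he : 2 ≤ L.slen e)
    (hs : L.slen e₁ ≠ L.slen e) : L.IsJumpHead e e₁ := by
  obtain ⟨p, hp, hc, hi⟩ := h.isESuf he
  have hp0 : p ≠ [] := fun h => hs (hi.2 h)
  have := List.length_pos_iff.2 hp0
  exact ⟨p, hp0, .done hp (by simp; omega), hc⟩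

theorem IsPar.isJumpHead_step {e e₁ g : Fin L.edges} (h : L.IsPar e e₁) (he : 2 ≤ L.slen e)
    (hs : L.slen e₁ = L.slen e) (hg : L.IsJumpHead e₁ g) : L.IsJumpHead e g := by
  obtain ⟨q, hq0, hq, hqc⟩ := hg
  obtain ⟨p, hp, hc, hi⟩ := h.isESuf he
  rw [hi.1 hs] at hp
  exact ⟨q, hq0, .step hp hq, hqc⟩

theorem IsJump.label_eq {e : Fin L.edges} {p : List (Fin L.edges)} (h : L.IsJump e p) :
    L.pathLabel p = L.label e := by
  induction h with
  | done h _ => exact h.2.2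
  | step h _ ih => rw [ih, ← h.2.2, pathLabel_cons, pathLabel_nil, List.append_nil]

/-- The reason why a rule `X(e) → X(g) Y` is correct when `Y` stands for the string from the end of
`g` to the next type-1 node. -/
theorem IsJumpHead.label_eq {e g : Fin L.edges} (h : L.IsJumpHead e g) :
    L.label e = L.label g ++ L.rest (L.lo g) := by
  obtain ⟨p, -, hp, hc⟩ := h
  rw [← hp.label_eq, pathLabel_cons, hc.rest_eq]

theorem IsJumpHead.type2 {e g : Fin L.edges} (h : L.IsJumpHead e g) :
    L.type2 (L.lo g) = true := by
  obtain ⟨p, hp0, hp, hc⟩ := h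
  generalize L.lo g = i at hc
  cases hc with
  | nil => exact absurd rfl hp0
  | cons h => exact h

/-! ### Counting -/

variable (L)

theorem deg_le_card [Fintype α] (i : Fin L.nodes) : L.deg i ≤ Fintype.card α := by
  have hle := L.out_le i
  have hi : ∀ j : Fin (L.deg i), L.hi ⟨L.first i + j, by omega⟩ = i := by
    intro j
    rw [L.out_spec]
    simp
  have hinj : Function.Injective fun j : Fin (L.deg i) =>
      L.chr ⟨L.first i + j, by omega⟩ := by
    intro j k h
    have := L.edge_eq ((hi j).trans (hi k).symm) h
    simpa [Fin.ext_iff] using this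
  simpa using Fintype.card_le_of_injective _ hinj

theorem nodes_le : L.nodes ≤ L.edges + 1 := by
  classical
  have : (Finset.univ.erase L.root) ⊆ Finset.univ.image L.lo := by
    intro i hi
    obtain ⟨e, he, -⟩ := L.exists_primary_edge (Finset.ne_of_mem_erase hi)
    exact Finset.mem_image.2 ⟨e, Finset.mem_univ _, he⟩
  have h1 := (Finset.card_le_card this).trans Finset.card_image_le
  rw [Finset.card_erase_of_mem (Finset.mem_univ _)] at h1
  simp at h1
  omega

end LCDAWG

/-! ### Maximal repeats and the number of edges -/

variable {α : Type*} {T x : List α}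

theorem finite_endPos : (endPos T x).Finite :=
  (Set.finite_Iic T.length).subset fun _ h => h.1

theorem occ_eq : occ T x = (endPos T x).ncard := by
  have : endPos T x = (· + x.length) '' begPos T x := by
    ext j
    constructor
    · intro hj
      have := length_le_of_mem_endPos hj
      exact ⟨j - x.length, by rw [mem_begPos_iff, Nat.sub_add_cancel this]; exact hj, by simp [this]⟩
    · rintro ⟨i, hi, rfl⟩
      exact mem_begPos_iff.1 hi
  rw [occ, this, Set.ncard_image_of_injective _ (add_left_injective _)]

/-- The longest strings of the CDAWG nodes are the text and maximal repeats. -/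
theorem IsValue.isMaxRepeat (h : IsValue T x) (hx : x ≠ T) : IsMaxRepeat T x := by
  obtain ⟨he, hl⟩ := isValue_iff.1 h
  obtain ⟨hi, hr⟩ := explicit_iff.1 he
  refine ⟨hi, ?_, fun a => ?_, fun a => ?_⟩
  · rw [occ_eq]
    -- A single occurrence that is not forced to continue must end at the end of `T`; the longest
    -- such string is `T` itself.
    by_contra! hc
    have h1 : (endPos T x).ncard = 1 := by
      have := (Set.ncard_pos finite_endPos).2 (infix_iff_endPos_nonempty.1 hi)
      omega
    obtain ⟨j, hj⟩ := Set.ncard_eq_one.1 h1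
    have hjT : j = T.length := by
      by_contra hne
      have hjl : j < T.length := lt_of_le_of_ne (hj ▸ Set.mem_singleton j : j ∈ endPos T x).1 hne
      obtain ⟨i, hi, hn⟩ := hr T[j]
      rw [hj, Set.mem_singleton_iff] at hi
      subst hi
      exact hn (List.getElem?_eq_getElem hjl)
    have : endPos T T = {T.length} := by
      ext k
      rw [Set.mem_singleton_iff]
      constructor
      · intro hk
        exact le_antisymm hk.1 (length_le_of_mem_endPos hk)
      · rintro rfl
        simp [endPos]
    exact hx (h.eq_of_eqR isValue_self (by rw [EqR, hj, this, hjT]))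
  · refine Set.ncard_lt_ncard ⟨fun i hi => ⟨hi.1, List.IsPrefix.trans ⟨_, rfl⟩ hi.2⟩, fun hs => ?_⟩
      ((Set.finite_Iic T.length).subset fun _ h => h.1)
    have := he.2 (x ++ [a]) (hs.antisymm fun i hi => ⟨hi.1, List.IsPrefix.trans ⟨_, rfl⟩ hi.2⟩)
    simp at this
  · rw [occ_eq, occ_eq]
    refine Set.ncard_lt_ncard ⟨endPos_subset_of_suffix (List.suffix_cons _ _), fun hs => ?_⟩
      finite_endPos
    exact hl a ((eqR_iff_subset (List.suffix_cons _ _)).2 hs)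

theorem infixes_subset : {x | x <:+: T} ⊆
    ((fun p : ℕ × ℕ => (T.drop p.1).take p.2) ''
      (↑(Finset.range (T.length + 1) ×ˢ Finset.range (T.length + 1)) : Set (ℕ × ℕ))) := by
  rintro x ⟨p, q, rfl⟩
  refine ⟨(p.length, x.length), by simp; omega, by simp⟩

theorem finite_infixes : {x | x <:+: T}.Finite :=
  ((Finset.finite_toSet _).image _).subset infixes_subset

theorem ncard_infixes_le : {x | x <:+: T}.ncard ≤ (T.length + 1) ^ 2 := by
  refine (Set.ncard_le_ncard infixes_subset ((Finset.finite_toSet _).image _)).trans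
    ((Set.ncard_image_le (Finset.finite_toSet _)).trans ?_)
  rw [Set.ncard_coe_finset]
  simp [sq]

theorem finite_rightExt : (rightExt T).Finite := finite_infixes.subset fun _ h => h.1

theorem finite_leftExt : (leftExt T).Finite := finite_infixes.subset fun _ h => h.1

theorem numExt_le : numExt T ≤ 2 * (T.length + 1) ^ 2 := by
  have h1 : (rightExt T).ncard ≤ {x | x <:+: T}.ncard :=
    Set.ncard_le_ncard (fun _ h => h.1) (finite_infixes (T := T))
  have h2 : (leftExt T).ncard ≤ {x | x <:+: T}.ncard :=
    Set.ncard_le_ncard (fun _ h => h.1) (finite_infixes (T := T))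
  have := ncard_infixes_le (T := T)
  unfold numExt
  omega

/-- An edge below a type-1 node is charged to the value of that node with the first letter of the
edge, and the only edge below a type-2 node to a left extension that ends there. The values involved
are not `T`, because they have an extension inside `T`, and so they are maximal repeats. -/
theorem LCDAWG.edges_le [LinearOrder α] (L : LCDAWG T) : L.edges ≤ numExt T := by
  classical
  have h1 : ∀ e, L.type2 (L.hi e) = false → L.str (L.hi e) ++ [L.chr e] ∈ rightExt T := by
    intro e he
    have hv : IsValue T (L.str (L.hi e)) := by
      rw [← L.isType1_iff] at he
      rw [str, he.str_eq]
      exact he.1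
    obtain ⟨x, hx⟩ := L.label_eq_cons e
    have hi : L.str (L.hi e) ++ [L.chr e] <:+: T := by
      refine List.IsInfix.trans ⟨[], x, ?_⟩ (L.endsAt_lo e).1
      rw [hx]; simp
    refine ⟨hi, _, _, hv.isMaxRepeat fun h => ?_, rfl⟩
    have := hi.length_le
    rw [h] at this
    simp at this
  have h2 : ∀ i, L.type2 i = true → ∃ y ∈ leftExt T, EndsAt T y (L.point i) := by
    intro i hi
    obtain ⟨-, a, u, hu, he⟩ := (L.type2_spec i).1 hi
    refine ⟨a :: u, ⟨he.1, u, a, hu.isMaxRepeat fun h => ?_, rfl⟩, he⟩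
    have := he.1.length_le
    rw [h] at this
    simp at this
  choose! y hy hye using h2
  have c1 : {e | L.type2 (L.hi e) = false}.ncard ≤ (rightExt T).ncard := by
    refine Set.ncard_le_ncard_of_injOn (fun e => L.str (L.hi e) ++ [L.chr e]) h1 ?_ finite_rightExt
    intro e _ e' _ h
    obtain ⟨h, hc⟩ := List.append_inj' h rfl
    refine L.edge_eq (L.eq_of_endsAt (L.endsAt _) ?_) (by simpa using hc)
    rw [h]
    exact L.endsAt _
  have c2 : {e | L.type2 (L.hi e) = true}.ncard ≤ (leftExt T).ncard := by
    refine Set.ncard_le_ncard_of_injOn (fun e => y (L.hi e)) (fun e he => hy _ he) ?_ finite_leftExt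
    intro e he e' he' h
    have : L.hi e = L.hi e' := by
      refine L.eq_of_endsAt (hye _ he) ?_
      have h : y (L.hi e) = y (L.hi e') := h
      rw [h]
      exact hye _ he'
    obtain ⟨e₁, -, hu⟩ := L.exists_unique_edge he
    exact (hu _ rfl).trans (hu _ this.symm).symm
  have c3 : (Set.univ : Set (Fin L.edges)).ncard ≤
      {e | L.type2 (L.hi e) = false}.ncard + {e | L.type2 (L.hi e) = true}.ncard := by
    refine le_trans (Set.ncard_le_ncard ?_ (Set.toFinite _)) (Set.ncard_union_le _ _)
    intro e _
    rcases h : L.type2 (L.hi e)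
    · exact Or.inl h
    · exact Or.inr h
  rw [Set.ncard_univ, Nat.card_fin] at c3
  unfold numExt
  omega

end Graph

end LinCDAWG

namespace LinCDAWG

/-! ### Reasoning about programs -/

section Machine

variable {α : Type*}

@[simp] theorem State.reg_setReg (s : State α) (r x r' : ℕ) :
    (s.setReg r x).reg r' = if r' = r then x else s.reg r' := Function.update_apply ..

@[simp] theorem State.mem_setReg (s : State α) (r x : ℕ) : (s.setReg r x).mem = s.mem := rfl

@[simp] theorem State.chr_setReg (s : State α) (r x : ℕ) : (s.setReg r x).chr = s.chr := rfl

@[simp] theorem State.reg_setMem (s : State α) (a i x : ℕ) : (s.setMem a i x).reg = s.reg := rfl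

@[simp] theorem State.mem_setMem (s : State α) (a i x a' j : ℕ) :
    (s.setMem a i x).mem a' j = if a' = a then if j = i then x else s.mem a' j else s.mem a' j := by
  simp only [State.setMem, Function.update_apply]
  split
  · next h => rw [h, Function.update_apply]
  · rfl

@[simp] theorem State.chr_setMem (s : State α) (a i x : ℕ) : (s.setMem a i x).chr = s.chr := rfl

@[simp] theorem State.reg_setChr (s : State α) (a i : ℕ) (x : Option α) :
    (s.setChr a i x).reg = s.reg := rfl

@[simp] theorem State.mem_setChr (s : State α) (a i : ℕ) (x : Option α) :
    (s.setChr a i x).mem = s.mem := rfl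

@[simp] theorem State.chr_setChr (s : State α) (a i : ℕ) (x : Option α) (a' j : ℕ) :
    (s.setChr a i x).chr a' j =
      if a' = a then if j = i then x else s.chr a' j else s.chr a' j := by
  simp only [State.setChr, Function.update_apply]
  split
  · next h => rw [h, Function.update_apply]
  · rfl

/-- All integers in the state are at most `M`. -/
def State.Bdd (M : ℕ) (s : State α) : Prop := (∀ r, s.reg r ≤ M) ∧ ∀ a i, s.mem a i ≤ M

/-- In states that are bounded by `M ≥ 1`, the expression is bounded by `e.weight * M`. -/
def Expr.weight : Expr → ℕ
  | .const k => k
  | .reg _ => 1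
  | .read _ i => max i.weight 1
  | .plus e f => e.weight + f.weight
  | .minus e f => max e.weight f.weight
  | .half e => e.weight

def Test.weight : Test → ℕ
  | .lt e f | .eq e f | .chrLt _ e _ f | .chrEq _ e _ f => max e.weight f.weight

def Prog.weight : Prog → ℕ
  | .skip => 0
  | .set _ e => e.weight
  | .write _ i e => max i.weight e.weight
  | .copyChr _ i _ j => max i.weight j.weight
  | .seq p q => max p.weight q.weight
  | .ite c p q => max c.weight (max p.weight q.weight)
  | .loop c p => max c.weight p.weight

variable {M B : ℕ} {s : State α}

theorem Expr.fits_of_bdd (hM : 1 ≤ M) (hs : s.Bdd M) (e : Expr) :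
    e.weight * M ≤ B → e.Fits B s ∧ e.val s ≤ e.weight * M := by
  induction e with
  | const k =>
    intro h
    exact ⟨(Nat.le_mul_of_pos_right k hM).trans h, Nat.le_mul_of_pos_right k hM⟩
  | reg r =>
    intro h
    simp only [weight, one_mul, Fits, val] at *
    exact ⟨(hs.1 r).trans h, hs.1 r⟩
  | read a i ih =>
    intro h
    simp only [weight, Fits, val] at *
    have h1 : 1 * M ≤ max i.weight 1 * M := Nat.mul_le_mul_right _ (le_max_right _ _)
    have h2 : i.weight * M ≤ max i.weight 1 * M := Nat.mul_le_mul_right _ (le_max_left _ _)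
    have := hs.2 a (i.val s)
    exact ⟨⟨(ih (h2.trans h)).1, by omega⟩, by omega⟩
  | plus e f ihe ihf =>
    intro h
    simp only [weight, Fits, val, add_mul] at *
    have h1 := ihe (by omega)
    have h2 := ihf (by omega)
    exact ⟨⟨h1.1, h2.1, by omega⟩, by omega⟩
  | minus e f ihe ihf =>
    intro h
    simp only [weight, Fits, val] at *
    have h1 : e.weight * M ≤ max e.weight f.weight * M := Nat.mul_le_mul_right _ (le_max_left _ _)
    have h2 : f.weight * M ≤ max e.weight f.weight * M := Nat.mul_le_mul_right _ (le_max_right _ _)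
    have h3 := ihe (h1.trans h)
    exact ⟨⟨h3.1, (ihf (h2.trans h)).1⟩, by omega⟩
  | half e ih =>
    intro h
    have := ih h
    simp only [weight, Fits, val] at *
    exact ⟨this.1, by omega⟩

theorem Expr.fits_of_weight_le {W : ℕ} (hM : 1 ≤ M) (hB : W * M ≤ B) (hs : s.Bdd M) {e : Expr}
    (he : e.weight ≤ W) : e.Fits B s :=
  (e.fits_of_bdd hM hs ((Nat.mul_le_mul_right M he).trans hB)).1

theorem Test.fits_of_weight_le {W : ℕ} (hM : 1 ≤ M) (hB : W * M ≤ B) (hs : s.Bdd M) {c : Test}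
    (hc : c.weight ≤ W) : c.Fits B s := by
  cases c <;>
  · simp only [Test.weight, max_le_iff] at hc
    exact ⟨Expr.fits_of_weight_le hM hB hs hc.1, Expr.fits_of_weight_le hM hB hs hc.2⟩

theorem State.Bdd.setReg (hs : s.Bdd M) {r x : ℕ} (hx : x ≤ M) : (s.setReg r x).Bdd M := by
  refine ⟨fun r' => ?_, hs.2⟩
  rw [State.reg_setReg]
  split
  · exact hx
  · exact hs.1 r'

theorem State.Bdd.setMem (hs : s.Bdd M) {a i x : ℕ} (hx : x ≤ M) : (s.setMem a i x).Bdd M := by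
  refine ⟨hs.1, fun a' j => ?_⟩
  rw [State.mem_setMem]
  split_ifs
  · exact hx
  · exact hs.2 _ _
  · exact hs.2 _ _

/-- The registers, integer arrays and letter arrays that a program does not mention as targets keep
their contents. -/
def Prog.regs : Prog → List ℕ
  | .skip | .write .. | .copyChr .. => []
  | .set r _ => [r]
  | .seq p q | .ite _ p q => p.regs ++ q.regs
  | .loop _ p => p.regs

def Prog.mems : Prog → List ℕ
  | .skip | .set .. | .copyChr .. => []
  | .write a _ _ => [a]
  | .seq p q | .ite _ p q => p.mems ++ q.mems
  | .loop _ p => p.mems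

def Prog.chrs : Prog → List ℕ
  | .skip | .set .. | .write .. => []
  | .copyChr a _ _ _ => [a]
  | .seq p q | .ite _ p q => p.chrs ++ q.chrs
  | .loop _ p => p.chrs

/-- The states agree except for the targets of the program. -/
structure Prog.Frame (p : Prog) (s s' : State α) : Prop where
  reg : ∀ r, r ∉ p.regs → s'.reg r = s.reg r
  mem : ∀ a, a ∉ p.mems → s'.mem a = s.mem a
  chr : ∀ a, a ∉ p.chrs → s'.chr a = s.chr a

theorem Prog.Frame.refl (p : Prog) (s : State α) : p.Frame s s :=
  ⟨fun _ _ => rfl, fun _ _ => rfl, fun _ _ => rfl⟩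

theorem Prog.Frame.trans {p : Prog} {s s' s'' : State α} (h : p.Frame s s') (h' : p.Frame s' s'') :
    p.Frame s s'' :=
  ⟨fun r hr => (h'.reg r hr).trans (h.reg r hr), fun a ha => (h'.mem a ha).trans (h.mem a ha),
    fun a ha => (h'.chr a ha).trans (h.chr a ha)⟩

theorem Prog.Frame.mono {p q : Prog} {s s' : State α} (h : p.Frame s s') (hr : p.regs ⊆ q.regs)
    (hm : p.mems ⊆ q.mems) (hc : p.chrs ⊆ q.chrs) : q.Frame s s' :=
  ⟨fun r h' => h.reg r fun h => h' (hr h), fun r h' => h.mem r fun h => h' (hm h),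
    fun r h' => h.chr r fun h => h' (hc h)⟩

variable [LinearOrder α]

theorem Exec.frame {p : Prog} {t : ℕ} {s' : State α} (h : Exec B p s t s') : p.Frame s s' := by
  induction h with
  | skip => exact .refl _ _
  | set =>
    refine ⟨fun r hr => ?_, fun _ _ => rfl, fun _ _ => rfl⟩
    rw [State.reg_setReg, if_neg (by simpa [Prog.regs] using hr)]
  | write =>
    refine ⟨fun _ _ => rfl, fun a ha => ?_, fun _ _ => rfl⟩
    funext j
    rw [State.mem_setMem, if_neg (by simpa [Prog.mems] using ha)]
  | copyChr =>
    refine ⟨fun _ _ => rfl, fun _ _ => rfl, fun a ha => ?_⟩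
    funext j
    rw [State.chr_setChr, if_neg (by simpa [Prog.chrs] using ha)]
  | seq _ _ ih ih' =>
    exact (ih.mono (List.subset_append_left _ _) (List.subset_append_left _ _)
      (List.subset_append_left _ _)).trans (ih'.mono (List.subset_append_right _ _)
      (List.subset_append_right _ _) (List.subset_append_right _ _))
  | ite_true _ _ _ ih =>
    exact ih.mono (List.subset_append_left _ _) (List.subset_append_left _ _)
      (List.subset_append_left _ _)
  | ite_false _ _ _ ih =>
    exact ih.mono (List.subset_append_right _ _) (List.subset_append_right _ _)
      (List.subset_append_right _ _)
  | loop_false => exact .refl _ _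
  | loop_true _ _ _ _ ih ih' =>
    exact Prog.Frame.trans (p := .loop _ _)
      (ih.mono (List.Subset.refl _) (List.Subset.refl _) (List.Subset.refl _)) ih'

/-- The program halts on `s`, with all intermediate integers at most `B` and all final ones at most
`M`, and `Q` holds of its running time and its final state. -/
def Run (B M : ℕ) (p : Prog) (s : State α) (Q : ℕ → State α → Prop) : Prop :=
  ∃ t s', Exec B p s t s' ∧ s'.Bdd M ∧ p.Frame s s' ∧ Q t s'

theorem Run.mono {p : Prog} {Q Q' : ℕ → State α → Prop} (h : Run B M p s Q)
    (hQ : ∀ t s', s'.Bdd M → p.Frame s s' → Q t s' → Q' t s') : Run B M p s Q' := by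
  obtain ⟨t, s', h1, h2, h3, h4⟩ := h
  exact ⟨t, s', h1, h2, h3, hQ t s' h2 h3 h4⟩

theorem Run.seq {p q : Prog} {Q : ℕ → State α → Prop}
    (h : Run B M p s fun t s' => Run B M q s' fun t' => Q (t + t')) :
    Run B M (.seq p q) s Q := by
  obtain ⟨t, s', h1, h2, h3, t', s'', h4, h5, h6, h7⟩ := h
  exact ⟨_, _, .seq h1 h4, h5, (h1.seq h4).frame, h7⟩

/-- The number of steps of a program without loops, at most. -/
def Prog.steps : Prog → ℕ
  | .skip => 1
  | .set _ e => e.cost + 1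
  | .write _ i e => i.cost + e.cost + 1
  | .copyChr _ i _ j => i.cost + j.cost + 1
  | .seq p q => p.steps + q.steps
  | .ite c p q => c.cost + max p.steps q.steps
  -- A default value: `Prog.wp` is false for loops, so no time bound rests on it.
  | .loop _ _ => 0

/-- Weakest preconditions of programs without loops. -/
def Prog.wp (M : ℕ) : Prog → State α → (State α → Prop) → Prop
  | .skip, s, Q => Q s
  | .set r e, s, Q => e.val s ≤ M ∧ Q (s.setReg r (e.val s))
  | .write a i e, s, Q => e.val s ≤ M ∧ Q (s.setMem a (i.val s) (e.val s))
  | .copyChr a i b j, s, Q => Q (s.setChr a (i.val s) (s.chr b (j.val s)))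
  | .seq p q, s, Q => p.wp M s fun s' => q.wp M s' Q
  | .ite c p q, s, Q => (c.Holds s → p.wp M s Q) ∧ (¬ c.Holds s → q.wp M s Q)
  | .loop _ _, _, _ => False

/-- Only stored values are tested against `M`; intermediate values are then at most `W * M ≤ B`
because of the weights. -/
theorem Prog.wp_exec {W : ℕ} (hM : 1 ≤ M) (hB : W * M ≤ B) {p : Prog} (hp : p.weight ≤ W)
    {Q : State α → Prop} (hs : s.Bdd M) (h : p.wp M s Q) :
    ∃ t s', Exec B p s t s' ∧ s'.Bdd M ∧ t ≤ p.steps ∧ Q s' := by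
  induction p generalizing s Q with
  | skip => exact ⟨_, _, .skip, hs, le_rfl, h⟩
  | set r e =>
    exact ⟨_, _, .set (Expr.fits_of_weight_le hM hB hs hp), hs.setReg h.1, le_rfl, h.2⟩
  | write a i e =>
    simp only [weight, max_le_iff] at hp
    exact ⟨_, _, .write (Expr.fits_of_weight_le hM hB hs hp.1)
      (Expr.fits_of_weight_le hM hB hs hp.2), hs.setMem h.1, le_rfl, h.2⟩
  | copyChr a i b j =>
    simp only [weight, max_le_iff] at hp
    exact ⟨_, _, .copyChr (Expr.fits_of_weight_le hM hB hs hp.1)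
      (Expr.fits_of_weight_le hM hB hs hp.2), hs, le_rfl, h⟩
  | seq p q ihp ihq =>
    simp only [weight, max_le_iff] at hp
    obtain ⟨t, s', h1, h2, h3, h4⟩ := ihp hp.1 hs h
    obtain ⟨t', s'', h5, h6, h7, h8⟩ := ihq hp.2 h2 h4
    exact ⟨_, _, .seq h1 h5, h6, by simp only [steps]; omega, h8⟩
  | ite c p q ihp ihq =>
    simp only [weight, max_le_iff] at hp
    by_cases hc : c.Holds s
    · obtain ⟨t, s', h1, h2, h3, h4⟩ := ihp hp.2.1 hs (h.1 hc)
      exact ⟨_, _, .ite_true (Test.fits_of_weight_le hM hB hs hp.1) hc h1, h2,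
        by simp only [steps]; omega, h4⟩
    · obtain ⟨t, s', h1, h2, h3, h4⟩ := ihq hp.2.2 hs (h.2 hc)
      exact ⟨_, _, .ite_false (Test.fits_of_weight_le hM hB hs hp.1) hc h1, h2,
        by simp only [steps]; omega, h4⟩
  | loop c p => exact h.elim

theorem Run.of_wp {W τ : ℕ} (hM : 1 ≤ M) (hB : W * M ≤ B) {p : Prog} (hp : p.weight ≤ W)
    {Q : ℕ → State α → Prop} (hs : s.Bdd M) (hτ : p.steps ≤ τ)
    (h : p.wp M s fun s' => ∀ t, t ≤ τ → Q t s') : Run B M p s Q := by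
  obtain ⟨t, s', h1, h2, h3, h4⟩ := Prog.wp_exec hM hB hp hs h
  exact ⟨t, s', h1, h2, h1.frame, h4 _ (h3.trans hτ)⟩

theorem Run.ite {W : ℕ} (hM : 1 ≤ M) (hB : W * M ≤ B) {c : Test} (hc : c.weight ≤ W) {p q : Prog}
    {Q : ℕ → State α → Prop} (hs : s.Bdd M)
    (hp : c.Holds s → Run B M p s fun t => Q (c.cost + t))
    (hq : ¬ c.Holds s → Run B M q s fun t => Q (c.cost + t)) : Run B M (.ite c p q) s Q := by
  have hf := Test.fits_of_weight_le hM hB hs hc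
  by_cases h : c.Holds s
  · obtain ⟨t, s', h1, h2, h3, h4⟩ := hp h
    have h5 := Exec.ite_true (q := q) hf h h1
    exact ⟨_, _, h5, h2, h5.frame, h4⟩
  · obtain ⟨t, s', h1, h2, h3, h4⟩ := hq h
    have h5 := Exec.ite_false (p := p) hf h h1
    exact ⟨_, _, h5, h2, h5.frame, h4⟩

/-- Loops: `Inv n s` is an invariant that says, in particular, that `n` steps are left. -/
theorem Run.loop {W : ℕ} (hM : 1 ≤ M) (hB : W * M ≤ B) {c : Test} (hc : c.weight ≤ W) {p : Prog}
    (Inv : ℕ → State α → Prop) {n : ℕ} (hs : s.Bdd M) (hn : Inv n s)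
    (h : ∀ n s', s'.Bdd M → p.Frame s s' → Inv n s' → c.Holds s' →
      Run B M p s' fun t s'' => ∃ n', t + c.cost + n' ≤ n ∧ Inv n' s'') :
    Run B M (.loop c p) s fun t s' => ∃ n', t + n' ≤ n + c.cost ∧ Inv n' s' ∧ ¬ c.Holds s' := by
  have key : ∀ n s', s'.Bdd M → p.Frame s s' → Inv n s' →
      ∃ t s'', Exec B (.loop c p) s' t s'' ∧ s''.Bdd M ∧
        ∃ n', t + n' ≤ n + c.cost ∧ Inv n' s'' ∧ ¬ c.Holds s'' := by
    intro n
    induction n using Nat.strong_induction_on with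
    | _ n ih =>
    intro s' hs' hf hi
    have hfit := Test.fits_of_weight_le hM hB hs' hc
    by_cases hh : c.Holds s'
    · obtain ⟨t, s'', h1, h2, h3, n', h4, h5⟩ := h n s' hs' hf hi hh
      -- Each test costs a step, so the budget `n` drops strictly in each round and serves as the
      -- induction variable.
      have hcost : 0 < c.cost := by cases c <;> exact Nat.succ_pos _
      obtain ⟨t', s₃, h6, h7, n'', h8, h9⟩ := ih n' (by omega) s'' h2 (hf.trans h3) h5
      exact ⟨_, _, .loop_true hfit hh h1 h6, h7, n'', by omega, h9⟩
    · exact ⟨_, _, .loop_false hfit hh, hs', n, by omega, hi, hh⟩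
  obtain ⟨t, s', h1, h2, h3⟩ := key n s hs (.refl _ _) hn
  exact ⟨t, s', h1, h2, h1.frame, h3⟩

end Machine

end LinCDAWG

namespace LinCDAWG

/-! ### The program -/

section Program

open Prog

/-- Register 5 becomes the variable for the string that is read from the edge in register 4 down to
the next type-1 node. -/
def restVar : Prog :=
  .ite (.eq (.read 0 (.read 5 (.reg 4))) (.const 1)) (.set 5 (.plus (.reg 4) (.reg 1)))
    (.set 5 (.reg 4))

/-- `for e in 0..m-1`, with `e` in register 3. -/
def forEdges (p : Prog) : Prog := .seq (.set 3 (.const 0)) (.loop (.lt (.reg 3) (.reg 1)) p)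

/-- Variable `e + m` stands for the label of `e` continued to the next type-1 node. If `e` itself
ends at a type-1 node, `X(e)` already serves this purpose, and `e + m` becomes a dummy with a letter
rule so that the numbering has no gaps. -/
def tailBody : Prog :=
  .seq (.write 10 (.reg 3) (.reg 3)) <|
  .seq (.copyChr 1 (.reg 3) 0 (.reg 3)) <|
  .seq (.ite (.eq (.read 0 (.read 5 (.reg 3))) (.const 1))
    (.seq (.set 4 (.read 2 (.read 5 (.reg 3)))) <|
      .seq restVar <|
      .seq (.write 7 (.plus (.reg 3) (.reg 1)) (.const 1)) <|
      .seq (.write 8 (.plus (.reg 3) (.reg 1)) (.reg 3))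
        (.write 9 (.plus (.reg 3) (.reg 1)) (.reg 5)))
    (.copyChr 1 (.plus (.reg 3) (.reg 1)) 0 (.reg 3))) <|
  .set 3 (.plus (.reg 3) (.const 1))

/-- The table of the variables, the letters, and the rules for the strings down to the next type-1
node. -/
def tailProg : Prog := forEdges tailBody

def searchBody : Prog :=
  .seq (.set 8 (.half (.plus (.reg 6) (.reg 7)))) <|
  .ite (.chrLt 0 (.reg 3) 0 (.reg 8)) (.set 7 (.reg 8)) (.set 6 (.reg 8))

/-- Binary search between registers 6 and 7 for the first letter of the edge in register 3. -/
def searchProg : Prog := .loop (.lt (.plus (.reg 6) (.const 1)) (.reg 7)) searchBody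

/-- The search range consists of the edges below the suffix link of the upper node of the edge. -/
def headInit : Prog :=
  .seq (.set 6 (.read 2 (.read 1 (.read 4 (.reg 3)))))
    (.set 7 (.plus (.reg 6) (.read 3 (.read 1 (.read 4 (.reg 3))))))

/-- Equal label lengths mean that the edge suffix link is a single edge, so the jump link must be
taken over from that edge later; otherwise the jump link is already known. -/
def headRule : Prog :=
  .seq (.write 11 (.reg 3) (.reg 6)) <|
  .ite (.eq (.read 6 (.reg 6)) (.read 6 (.reg 3)))
    (.write 12 (.reg 3) (.const 1))
    (.seq (.set 4 (.read 2 (.read 5 (.reg 6)))) <|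
      .seq restVar <|
      .seq (.write 7 (.reg 3) (.const 1)) <|
      .seq (.write 8 (.reg 3) (.reg 6)) (.write 9 (.reg 3) (.reg 5)))

def headBody : Prog :=
  .seq (.ite (.lt (.const 1) (.read 6 (.reg 3)))
    (.seq headInit (.seq searchProg headRule)) .skip)
  (.set 3 (.plus (.reg 3) (.const 1)))

/-- The first edges of the edge suffix links, and the rules of the edges whose jump link is their
edge suffix link.  The other edges with a jump link are marked in array 12. -/
def headProg : Prog := forEdges headBody

def walkProg : Prog := .loop (.eq (.read 12 (.reg 4)) (.const 1)) (.set 4 (.read 11 (.reg 4)))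

/-- A second pass over the walk, with the rule found at its end. Removing the marks ensures that no
edge is walked over twice as a marked edge. -/
def fillBody : Prog :=
  .seq (.set 7 (.read 11 (.reg 4))) <|
  .seq (.write 7 (.reg 4) (.const 1)) <|
  .seq (.write 8 (.reg 4) (.reg 5)) <|
  .seq (.write 9 (.reg 4) (.reg 6)) <|
  .seq (.write 12 (.reg 4) (.const 0)) <|
  .set 4 (.reg 7)

def fillProg : Prog := .loop (.eq (.read 12 (.reg 4)) (.const 1)) fillBody

def jumpInit : Prog :=
  .seq (.set 5 (.read 8 (.reg 4))) <| .seq (.set 6 (.read 9 (.reg 4))) <| .set 4 (.reg 3)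

def jumpBody : Prog :=
  .seq (.set 4 (.reg 3)) <| .seq walkProg <| .seq jumpInit <| .seq fillProg <|
  .set 3 (.plus (.reg 3) (.const 1))

/-- The rules of the marked edges: walk to an unmarked edge, and copy its rule. -/
def jumpProg : Prog := forEdges jumpBody

/-! ### Invariants of the memory -/

variable {α : Type*} [LinearOrder α] {T : List α}

namespace LCDAWG

/-- The input is still in memory. -/
structure Inp (L : LCDAWG T) (s : State α) : Prop where
  edges : s.reg 1 = L.edges
  root : s.reg 2 = L.root
  type2 : ∀ i : Fin L.nodes, s.mem 0 i = if L.type2 i then 1 else 0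
  slink : ∀ i : Fin L.nodes, s.mem 1 i = L.slink i
  first : ∀ i : Fin L.nodes, s.mem 2 i = L.first i
  deg : ∀ i : Fin L.nodes, s.mem 3 i = L.deg i
  hi : ∀ e : Fin L.edges, s.mem 4 e = L.hi e
  lo : ∀ e : Fin L.edges, s.mem 5 e = L.lo e
  slen : ∀ e : Fin L.edges, s.mem 6 e = L.slen e
  chr : ∀ e : Fin L.edges, s.chr 0 e = some (L.chr e)

/-- `M` bounds the integers in the computation, and `B` the intermediate ones. -/
structure Big (L : LCDAWG T) (B M : ℕ) : Prop where
  edges : 3 * L.edges + 2 ≤ M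
  nodes : L.nodes ≤ M
  length : T.length ≤ M
  -- All expressions in the programs have weight at most 4.
  bound : 4 * M ≤ B

variable {L : LCDAWG T} {s s' : State α} {B M : ℕ}

theorem Big.one_le (h : L.Big B M) : 1 ≤ M := by have := h.edges; omega

theorem inp_initState (L : LCDAWG T) : L.Inp L.initState := by
  constructor <;> simp [initState, cells]

theorem Inp.frame {p : Prog} (h : L.Inp s) (hf : p.Frame s s')
    (hr : 1 ∉ p.regs ∧ 2 ∉ p.regs) (hm : ∀ a < 7, a ∉ p.mems) (hc : 0 ∉ p.chrs) : L.Inp s' := by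
  have m := fun a ha => hf.mem a (hm a ha)
  constructor
  · rw [hf.reg _ hr.1, h.edges]
  · rw [hf.reg _ hr.2, h.root]
  · rw [m 0 (by decide)]; exact h.type2
  · rw [m 1 (by decide)]; exact h.slink
  · rw [m 2 (by decide)]; exact h.first
  · rw [m 3 (by decide)]; exact h.deg
  · rw [m 4 (by decide)]; exact h.hi
  · rw [m 5 (by decide)]; exact h.lo
  · rw [m 6 (by decide)]; exact h.slen
  · rw [hf.chr _ hc]; exact h.chr

/-- The variable for the string that is read from an edge down to the next type-1 node. -/
def restVar (L : LCDAWG T) (f : Fin L.edges) : ℕ :=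
  if L.type2 (L.lo f) then f + L.edges else f

/-- The rule `X → X(e) Y`, where `Y` stands for the string from the end of `e` down to the next
type-1 node, is stored at `i`. -/
def HasRule (L : LCDAWG T) (s : State α) (i : ℕ) (e : Fin L.edges) : Prop :=
  s.mem 7 i = 1 ∧ s.mem 8 i = e ∧ ∃ f, L.hi f = L.lo e ∧ s.mem 9 i = L.restVar f

def HasLetter (s : State α) (i : ℕ) (a : α) : Prop := s.mem 7 i = 0 ∧ s.chr 1 i = some a

/-- The result of `tailProg`, up to edge `k`. -/
structure TailSpec (L : LCDAWG T) (k : ℕ) (s : State α) : Prop where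
  table : ∀ e : Fin L.edges, e < k → s.mem 10 e = e
  letter : ∀ e : Fin L.edges, e < k → s.chr 1 e = some (L.chr e)
  rule : ∀ e : Fin L.edges, e < k → L.type2 (L.lo e) = true → L.HasRule s (e + L.edges) e
  dummy : ∀ e : Fin L.edges, e < k → L.type2 (L.lo e) = false →
    HasLetter s (e + L.edges) (L.chr e)

theorem exists_first {i : Fin L.nodes} (h : L.type2 i = true) :
    ∃ f, L.hi f = i ∧ L.first i = f := by
  obtain ⟨f, rfl, -⟩ := L.exists_unique_edge h
  exact ⟨f, rfl, L.first_eq h⟩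

/-- Letter rules have code 0, the initial contents of array 7, so they need no write; the invariant
has to record which cells are still zero. -/
theorem run_tailBody (hB : L.Big B M) (hs : s.Bdd M) (hi : L.Inp s) {e : Fin L.edges}
    (h3 : s.reg 3 = e) (h0 : ∀ i, i < L.edges ∨ e + L.edges ≤ i → s.mem 7 i = 0)
    (h : L.TailSpec e s) :
    Run B M tailBody s fun t s' => t ≤ 60 ∧ s'.reg 3 = e + 1 ∧
      (∀ i, i < L.edges ∨ e + 1 + L.edges ≤ i → s'.mem 7 i = 0) ∧ L.TailSpec (e + 1) s' := by
  refine Run.of_wp (τ := 60) hB.one_le hB.bound (by decide) hs (by decide) ?_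
  have hM := hB.edges
  have he := e.2
  have key : ∀ e' : Fin L.edges, (e' : ℕ) < e + 1 → e' = e ∨ (e' : ℕ) < e := by
    intro e'; rw [Fin.ext_iff]; omega
  have hc := hi.chr e
  obtain ⟨h1, h4, h5, h6⟩ := h
  simp only [HasRule, HasLetter] at *
  cases h2 : L.type2 (L.lo e)
  · simp [tailBody, LinCDAWG.restVar, Prog.wp, Expr.val, Test.Holds, h3, hi.lo, hi.type2, hi.first,
      hi.edges, h2]
    refine ⟨by omega, by omega, fun t ht => ⟨ht, by grind, ?_⟩⟩
    constructor <;> (try simp only [HasRule, HasLetter]) <;> simp <;> grind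
  · obtain ⟨f, hf, hff⟩ := exists_first h2
    have := f.2
    cases hf2 : L.type2 (L.lo f)
    · simp [tailBody, LinCDAWG.restVar, Prog.wp, Expr.val, Test.Holds, h3, hi.lo, hi.type2, hi.first, hi.edges, h2, hff, hf2]
      refine ⟨by omega, by omega, by omega, by omega, by omega, by omega, fun t ht => ⟨ht, by grind, ?_⟩⟩
      have : L.restVar f = f := by simp [restVar, hf2]
      constructor <;> (try simp only [HasRule, HasLetter]) <;> simp <;> grind
    · simp [tailBody, LinCDAWG.restVar, Prog.wp, Expr.val, Test.Holds, h3, hi.lo, hi.type2, hi.first, hi.edges, h2, hff, hf2]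
      have : L.restVar f = f + L.edges := by simp [restVar, hf2]
      refine ⟨by omega, by omega, by omega, by omega, by omega, by omega, by omega, fun t ht => ⟨ht, by grind, ?_⟩⟩
      constructor <;> (try simp only [HasRule, HasLetter]) <;> simp <;> grind

/-- In `Inv n k`, `n` is the remaining budget after `k` edges. The 3 is the cost of the loop test,
and the final 5 pays for the initialisation and the last test. -/
theorem run_forEdges (hB : L.Big B M) (hs : s.Bdd M) (hi : s.reg 1 = L.edges) {p : Prog}
    (h1 : 1 ∉ p.regs) (Inv : ℕ → ℕ → State α → Prop) {n : ℕ}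
    (hn : Inv n 0 (s.setReg 3 0))
    (h : ∀ n (e : Fin L.edges) s', s'.Bdd M → (forEdges p).Frame s s' → s'.reg 3 = e →
      Inv n e s' → Run B M p s' fun t s'' =>
        s''.reg 3 = e + 1 ∧ ∃ n', t + 3 + n' ≤ n ∧ Inv n' (e + 1) s'') :
    Run B M (forEdges p) s fun t s' => ∃ n', t + n' ≤ n + 5 ∧ Inv n' L.edges s' := by
  refine Run.seq (Run.of_wp (τ := 2) hB.one_le hB.bound (by decide) hs (by decide) ?_)
  refine ⟨by simp [Expr.val], fun t ht => ?_⟩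
  simp only [Expr.val]
  have hf1 : (forEdges p).Frame s (s.setReg 3 0) := by
    refine ⟨fun r hr => ?_, fun _ _ => rfl, fun _ _ => rfl⟩
    simp only [forEdges, regs, List.singleton_append, List.mem_cons, not_or] at hr
    simp [hr.1]
  have hloop := Run.loop (s := s.setReg 3 0) (c := .lt (.reg 3) (.reg 1)) (p := p) (n := n)
    hB.one_le hB.bound (by decide)
    (fun n s' => ∃ k ≤ L.edges, s'.reg 3 = k ∧ Inv n k s') (hs.setReg (Nat.zero_le _))
    ⟨0, Nat.zero_le _, by simp, hn⟩ ?_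
  · refine hloop.mono ?_
    rintro t' s' - hf ⟨n', h2, ⟨k, hk, h3, h4⟩, h5⟩
    have : s'.reg 1 = L.edges := by rw [hf.reg 1 h1]; simpa using hi
    simp only [Test.Holds, Expr.val, this, h3, not_lt] at h5
    obtain rfl : k = L.edges := by omega
    refine ⟨n', ?_, h4⟩
    simp only [Test.cost, Expr.cost] at h2
    omega
  · rintro n s' hs' hf ⟨k, hk, h3, h4⟩ hh
    have : s'.reg 1 = L.edges := by rw [hf.reg 1 h1]; simpa using hi
    simp only [Test.Holds, Expr.val, this, h3] at hh
    refine (h n ⟨k, hh⟩ s' hs' (hf1.trans ?_) h3 h4).mono ?_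
    · exact hf.mono (List.subset_append_right _ _) (List.subset_append_right _ _)
        (List.subset_append_right _ _)
    · rintro t s'' - - ⟨h5, n', h6, h7⟩
      exact ⟨n', h6, k + 1, hh, h5, h7⟩

theorem run_tailProg (hB : L.Big B M) (hs : s.Bdd M) (hi : L.Inp s) (h0 : ∀ i, s.mem 7 i = 0) :
    Run B M tailProg s fun t s' => t ≤ 63 * L.edges + 5 ∧
      (∀ i, i < L.edges → s'.mem 7 i = 0) ∧ L.TailSpec L.edges s' := by
  refine (run_forEdges hB hs hi.edges (by decide) (n := 63 * L.edges)
    (fun n k s' => n + 63 * k = 63 * L.edges ∧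
      (∀ i, i < L.edges ∨ k + L.edges ≤ i → s'.mem 7 i = 0) ∧ L.TailSpec k s') ?_ ?_).mono ?_
  · refine ⟨by omega, fun i _ => h0 i, ⟨?_, ?_, ?_, ?_⟩⟩ <;> intro e he <;> omega
  · rintro n e s' hs' hf h3 ⟨h4, h5, h6⟩
    refine (run_tailBody hB hs' (hi.frame hf (by decide) (by decide) (by decide)) h3 h5 h6).mono ?_
    rintro t s'' - - ⟨h7, h8, h9, h10⟩
    have := e.2
    exact ⟨h8, n - 63, by omega, by omega, h9, h10⟩
  · rintro t s' - - ⟨n, h1, h2, h3, h4⟩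
    exact ⟨by omega, fun i hi => h3 i (Or.inl hi), h4⟩

/-! ### Jump links -/

/-- Either half of a range of `a` cells has at most `⌈a/2⌉` cells. -/
theorem clog_le {a b : ℕ} (h : 2 * b ≤ a + 1) (ha : 2 ≤ a) : Nat.clog 2 b + 1 ≤ Nat.clog 2 a := by
  rw [Nat.clog_of_two_le (n := a) one_lt_two ha]
  exact Nat.add_le_add_right (Nat.clog_mono_right 2 (by omega)) 1

theorem run_searchProg (hB : L.Big B M) (hs : s.Bdd M) (hi : L.Inp s) {e g : Fin L.edges}
    (h3 : s.reg 3 = e) (hg : L.chr g = L.chr e) (h6 : L.first (L.hi g) ≤ s.reg 6)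
    (h6g : s.reg 6 ≤ g) (h7g : g < s.reg 7) (h7 : s.reg 7 ≤ L.first (L.hi g) + L.deg (L.hi g)) :
    Run B M searchProg s fun t s' =>
      t ≤ 20 * Nat.clog 2 (s.reg 7 - s.reg 6) + 5 ∧ s'.reg 6 = g := by
  have hle := L.out_le (L.hi g)
  refine (Run.loop (n := 20 * Nat.clog 2 (s.reg 7 - s.reg 6)) hB.one_le hB.bound (by decide)
    (fun n s' => n = 20 * Nat.clog 2 (s'.reg 7 - s'.reg 6) ∧ L.first (L.hi g) ≤ s'.reg 6 ∧
      s'.reg 6 ≤ g ∧ g < s'.reg 7 ∧ s'.reg 7 ≤ L.first (L.hi g) + L.deg (L.hi g)) hs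
    ⟨rfl, h6, h6g, h7g, h7⟩ ?_).mono ?_
  · rintro n s' hs' hf ⟨rfl, h4, h5, h6, h7⟩ hh
    have hi' := hi.frame hf (by decide) (by decide) (by decide)
    have h3' : s'.reg 3 = e := by rw [hf.reg 3 (by decide), h3]
    simp only [Test.Holds, Expr.val] at hh
    generalize ha : s'.reg 6 = a at *
    generalize hb : s'.reg 7 = b at *
    -- The midpoint is again an edge below the node of `g`, so the sorting of first letters tells on
    -- which side `g` lies.
    obtain ⟨q, hq⟩ : ∃ q : Fin L.edges, (a + b) / 2 = q := ⟨⟨(a + b) / 2, by omega⟩, rfl⟩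
    have hqh : L.hi q = L.hi g := by
      rw [L.out_spec]; omega
    have hM := hs'.1 7
    rw [hb] at hM
    refine Run.of_wp (τ := 15) hB.one_le hB.bound (by decide) hs' (by decide) ?_
    simp only [searchBody, Prog.wp, Expr.val, Test.Holds]
    simp [h3', hi'.chr, ha, hb, hq]
    refine ⟨by omega, fun hlt => ⟨by omega, fun t ht => ⟨?_, h4, h5, ?_, by omega⟩⟩, fun hle => ⟨by omega, fun t ht => ⟨?_, by omega, ?_, h6, h7⟩⟩⟩
    · have := clog_le (a := b - a) (b := q - a) (by omega) (by omega)
      simp only [Test.cost, Expr.cost]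
      omega
    · by_contra hc
      rcases lt_or_eq_of_le (not_lt.1 hc) with h | h
      · have := L.out_sorted q g hqh h
        rw [hg] at this
        exact lt_asymm this hlt
      · rw [h, hg] at hlt
        exact lt_irrefl _ hlt
    · have := clog_le (a := b - a) (b := b - q) (by omega) (by omega)
      simp only [Test.cost, Expr.cost]
      omega
    · by_contra hc
      have := L.out_sorted g q hqh.symm (not_le.1 hc)
      rw [hg] at this
      exact absurd this (not_lt.2 hle)
  · rintro t s' - hf ⟨n, h1, ⟨rfl, h4, h5, h6, h7⟩, hh⟩
    simp only [Test.Holds, Expr.val] at hh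
    simp only [Test.cost, Expr.cost] at h1
    exact ⟨by omega, by omega⟩

end LCDAWG
end Program
end LinCDAWG

namespace LinCDAWG

/-! ### Rules of jump links and walks along marked edges -/

section Program

open Prog

variable {α : Type*} [LinearOrder α] {T : List α}

namespace LCDAWG

variable {L : LCDAWG T} {s s' : State α} {B M : ℕ}

/-- The rule of an edge with a jump link is stored. -/
def HasJump (L : LCDAWG T) (s : State α) (e : Fin L.edges) : Prop :=
  ∃ g, L.IsJumpHead e g ∧ L.HasRule s e g

/-- The edge is marked: its jump link is that of the first edge of its edge suffix link. -/
structure JumpSpec (L : LCDAWG T) (k : ℕ) (s : State α) : Prop where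
  marked : ∀ e : Fin L.edges, s.mem 12 e = 1 → e < k ∧ 2 ≤ L.slen e ∧
    ∃ e₁ : Fin L.edges, s.mem 11 e = e₁ ∧ L.IsPar e e₁ ∧ L.slen e₁ = L.slen e
  jump : ∀ e : Fin L.edges, e < k → 2 ≤ L.slen e → s.mem 12 e = 1 ∨ L.HasJump s e
  zero : ∀ e : Fin L.edges, k ≤ e ∨ L.slen e = 1 → s.mem 7 e = 0

theorem run_headRule (hB : L.Big B M) (hs : s.Bdd M) (hi : L.Inp s) {e e₁ : Fin L.edges}
    (h3 : s.reg 3 = e) (h6 : s.reg 6 = e₁) (he : 2 ≤ L.slen e) (hp : L.IsPar e e₁)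
    (hT : L.TailSpec L.edges s) (hJ : L.JumpSpec e s) :
    Run B M headRule s fun t s' => t ≤ 60 ∧ s'.reg 3 = e ∧ L.TailSpec L.edges s' ∧
      L.JumpSpec (e + 1) s' := by
  refine Run.of_wp (τ := 60) hB.one_le hB.bound (by decide) hs (by decide) ?_
  have hM := hB.edges
  have he1 := e.2
  have he2 := e₁.2
  have key : ∀ e' : Fin L.edges, (e' : ℕ) < e + 1 → e' = e ∨ (e' : ℕ) < e := by
    intro e'; rw [Fin.ext_iff]; omega
  obtain ⟨t1, t2, t3, t4⟩ := hT
  obtain ⟨j1, j2, j3⟩ := hJ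
  have hn : s.mem 12 e ≠ 1 := fun h => absurd (j1 e h).1 (lt_irrefl _)
  simp only [HasRule, HasLetter, HasJump] at *
  by_cases h : L.slen e₁ = L.slen e
  · simp [headRule, LinCDAWG.restVar, Prog.wp, Expr.val, Test.Holds, h3, h6, hi.slen, h]
    refine ⟨by omega, by omega, fun t ht => ⟨ht, ?_, ?_⟩⟩
    · constructor <;> (try simp only [HasRule, HasLetter]) <;> simp <;> grind
    · constructor <;> (try simp only [HasRule, HasJump]) <;> simp <;> grind
  · have hj := hp.isJumpHead he h
    obtain ⟨f, hf, hff⟩ := exists_first hj.type2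
    have := f.2
    cases hf2 : L.type2 (L.lo f)
    · have : L.restVar f = f := by simp [restVar, hf2]
      simp [headRule, LinCDAWG.restVar, Prog.wp, Expr.val, Test.Holds, h3, h6, hi.slen, h, hi.lo,
        hi.type2, hi.first, hff, hf2]
      refine ⟨by omega, by omega, by omega, by omega, by omega, fun t ht => ⟨ht, ?_, ?_⟩⟩
      · constructor <;> (try simp only [HasRule, HasLetter]) <;> simp <;> grind
      · constructor <;> (try simp only [HasRule, HasJump]) <;> simp <;> grind
    · have : L.restVar f = f + L.edges := by simp [restVar, hf2]
      simp [headRule, LinCDAWG.restVar, Prog.wp, Expr.val, Test.Holds, h3, h6, hi.slen, h, hi.lo,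
        hi.type2, hi.first, hi.edges, hff, hf2]
      refine ⟨by omega, by omega, by omega, by omega, by omega, by omega, fun t ht => ⟨ht, ?_, ?_⟩⟩
      · constructor <;> (try simp only [HasRule, HasLetter]) <;> simp <;> grind
      · constructor <;> (try simp only [HasRule, HasJump]) <;> simp <;> grind

theorem run_headBody (hB : L.Big B M) (hs : s.Bdd M) (hi : L.Inp s) {e : Fin L.edges} {D : ℕ}
    (hD : ∀ i, L.deg i ≤ D) (h3 : s.reg 3 = e) (hT : L.TailSpec L.edges s) (hJ : L.JumpSpec e s) :
    Run B M headBody s fun t s' => t ≤ 100 + 20 * Nat.clog 2 D ∧ s'.reg 3 = e + 1 ∧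
      L.TailSpec L.edges s' ∧ L.JumpSpec (e + 1) s' := by
  have hM := hB.edges
  have he := e.2
  have main : Run B M (.ite (.lt (.const 1) (.read 6 (.reg 3)))
      (.seq headInit (.seq searchProg headRule)) .skip) s fun t s' => t ≤ 95 + 20 * Nat.clog 2 D ∧
      s'.reg 3 = e ∧ L.TailSpec L.edges s' ∧ L.JumpSpec (e + 1) s' := by
    refine Run.ite hB.one_le hB.bound (by decide) hs ?_ ?_
    · intro h
      simp only [Test.Holds, Expr.val, h3, hi.slen] at h
      obtain ⟨e₁, p, -, -, hp⟩ := L.exists_isESuf h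
      have hout := (L.out_spec (L.hi e₁) e₁).1 rfl
      have hle := L.out_le (L.hi e₁)
      refine Run.seq (Run.of_wp (τ := 15) hB.one_le hB.bound (by decide) hs (by decide) ?_)
      simp [headInit, Prog.wp, Expr.val, h3, hi.hi, hi.slink, hi.first, hi.deg, ← hp.1]
      refine ⟨by omega, by omega, fun t ht => ?_⟩
      generalize hs1 : (s.setReg 6 (L.first (L.hi e₁))).setReg 7
        (L.first (L.hi e₁) + L.deg (L.hi e₁)) = s1
      have hs1' : s1.Bdd M := by
        rw [← hs1]; exact (hs.setReg (by omega)).setReg (by omega)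
      have hf1 : headInit.Frame s s1 := by
        rw [← hs1]
        refine ⟨fun r hr => ?_, fun _ _ => rfl, fun _ _ => rfl⟩
        simp [headInit, regs] at hr
        simp [hr]
      have h6 : s1.reg 6 = L.first (L.hi e₁) := by rw [← hs1]; simp
      have h7 : s1.reg 7 = L.first (L.hi e₁) + L.deg (L.hi e₁) := by rw [← hs1]; simp
      have hT1 : L.TailSpec L.edges s1 := by
        rw [← hs1]; exact ⟨hT.1, hT.2, hT.3, hT.4⟩
      have hJ1 : L.JumpSpec e s1 := by
        rw [← hs1]; exact ⟨hJ.1, hJ.2, hJ.3⟩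
      have h31 : s1.reg 3 = e := by rw [← hs1]; simpa using h3
      clear hs1
      have hi1 := hi.frame hf1 (by decide) (by decide) (by decide)
      refine Run.seq ((run_searchProg hB hs1' hi1 h31 hp.2 h6.ge (h6 ▸ hout.1) (h7 ▸ hout.2)
        h7.le).mono ?_)
      rintro t2 s2 hs2 hf2 ⟨ht2, h62⟩
      have hi2 := hi1.frame hf2 (by decide) (by decide) (by decide)
      have m2 := fun a ha => hf2.mem a ha
      have c2 : s2.chr 1 = s1.chr 1 := hf2.chr 1 (by decide)
      have hT2 : L.TailSpec L.edges s2 := by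
        obtain ⟨t1, t2, t3, t4⟩ := hT1
        constructor <;> (try simp only [HasRule, HasLetter] at *) <;>
          simpa only [m2 7 (by decide), m2 8 (by decide), m2 9 (by decide), m2 10 (by decide), c2]
      have hJ2 : L.JumpSpec e s2 := by
        obtain ⟨t1, t2, t3⟩ := hJ1
        constructor <;> (try simp only [HasRule, HasJump] at *) <;>
          simpa only [m2 7 (by decide), m2 8 (by decide), m2 9 (by decide), m2 11 (by decide),
            m2 12 (by decide)]
      refine (run_headRule hB hs2 hi2 (by rw [hf2.reg 3 (by decide), h31]) h62 h hp hT2 hJ2).mono ?_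
      rintro t3 s3 - - ⟨h1, h2, h3, h4⟩
      refine ⟨?_, h2, h3, h4⟩
      have : Nat.clog 2 (s1.reg 7 - s1.reg 6) ≤ Nat.clog 2 D := by
        refine Nat.clog_mono_right 2 (le_trans (le_of_eq ?_) (hD (L.hi e₁)))
        omega
      simp only [Test.cost, Expr.cost]
      omega
    · intro h
      simp only [Test.Holds, Expr.val, h3, hi.slen] at h
      refine Run.of_wp (τ := 1) hB.one_le hB.bound (by decide) hs (by decide) ?_
      simp only [Prog.wp, Test.cost, Expr.cost]
      intro t ht
      refine ⟨by omega, h3, hT, ⟨fun e' h => ?_, fun e' hlt h2 => ?_, fun e' h => ?_⟩⟩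
      · exact ⟨(hJ.1 e' h).1.trans (Nat.lt_succ_self _), (hJ.1 e' h).2⟩
      · refine hJ.2 e' ?_ h2
        refine lt_of_le_of_ne (by omega) fun h' => ?_
        rw [Fin.ext h'] at h2
        omega
      · exact hJ.3 e' (h.imp (fun h => by omega) id)
  refine Run.seq (main.mono ?_)
  rintro t s' hs' hf ⟨h1, h2, h4, h5⟩
  refine Run.of_wp (τ := 4) hB.one_le hB.bound (by decide) hs' (by decide) ?_
  simp only [Prog.wp, Expr.val, h2]
  refine ⟨by omega, fun t' ht' => ⟨by omega, by simp, ⟨h4.1, h4.2, h4.3, h4.4⟩, ⟨h5.1, h5.2, h5.3⟩⟩⟩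

theorem run_headProg (hB : L.Big B M) (hs : s.Bdd M) (hi : L.Inp s) {D : ℕ}
    (hD : ∀ i, L.deg i ≤ D) (hT : L.TailSpec L.edges s) (h7 : ∀ i, i < L.edges → s.mem 7 i = 0)
    (h12 : ∀ i, s.mem 12 i = 0) :
    Run B M headProg s fun t s' => t ≤ (103 + 20 * Nat.clog 2 D) * L.edges + 5 ∧
      L.TailSpec L.edges s' ∧ L.JumpSpec L.edges s' := by
  generalize hK : 103 + 20 * Nat.clog 2 D = K
  refine (run_forEdges hB hs hi.edges (by decide) (n := K * L.edges)
    (fun n k s' => n + K * k = K * L.edges ∧ L.TailSpec L.edges s' ∧ L.JumpSpec k s')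
    ?_ ?_).mono ?_
  · refine ⟨by omega, ⟨hT.1, hT.2, hT.3, hT.4⟩, ⟨fun e he => ?_, fun e he => ?_, fun e _ => ?_⟩⟩
    · simp [h12] at he
    · omega
    · exact h7 e e.2
  · rintro n e s' hs' hf h3 ⟨h4, h5, h6⟩
    refine (run_headBody hB hs' (hi.frame hf (by decide) (by decide) (by decide)) hD h3 h5 h6).mono ?_
    rintro t s'' - - ⟨h7, h8, h9, h10⟩
    have hle : K * (e + 1) ≤ K * L.edges := Nat.mul_le_mul_left K e.2
    rw [Nat.mul_succ] at hle
    refine ⟨h8, n - K, by omega, ?_, h9, h10⟩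
    rw [Nat.mul_succ]
    omega
  · rintro t s' - - ⟨n, h1, h2, h3, h4⟩
    exact ⟨by omega, h3, h4⟩

/-- From marked edge to first edge of the edge suffix link. -/
inductive Walk (L : LCDAWG T) : Fin L.edges → List (Fin L.edges) → Fin L.edges → Prop
  | nil (a) : L.Walk a [] a
  | cons {a b W c} : 2 ≤ L.slen a → L.IsPar a b → L.slen b = L.slen a → L.Walk b W c →
      L.Walk a (a :: W) c

theorem Walk.snoc {a b c : Fin L.edges} {W} (h : L.Walk a W b) (h1 : 2 ≤ L.slen b)
    (h2 : L.IsPar b c) (h3 : L.slen c = L.slen b) : L.Walk a (W ++ [b]) c := by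
  induction h with
  | nil a => exact .cons h1 h2 h3 (.nil _)
  | cons h4 h5 h6 _ ih => exact .cons h4 h5 h6 (ih h1 h2 h3)

/-- Suffix links shorten the strings of nodes, so a walk never returns to an edge. -/
theorem Walk.lt {a c : Fin L.edges} {W} (h : L.Walk a W c) :
    ∀ q ∈ W, (L.str (L.hi c)).length < (L.str (L.hi q)).length := by
  have key : (L.str (L.hi c)).length ≤ (L.str (L.hi a)).length ∧
      ∀ q ∈ W, (L.str (L.hi c)).length < (L.str (L.hi q)).length := by
    induction h with
    | nil => simp
    | cons h1 h2 h3 _ ih =>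
      have := h2.length_lt h1
      refine ⟨by omega, fun q hq => ?_⟩
      rcases List.mem_cons.1 hq with rfl | hq
      · omega
      · exact ih.2 q hq
  exact key.2

theorem Walk.isJumpHead {a c g : Fin L.edges} {W} (h : L.Walk a W c) (hg : L.IsJumpHead c g) :
    L.IsJumpHead a g := by
  induction h with
  | nil => exact hg
  | cons h1 h2 h3 _ ih => exact h2.isJumpHead_step h1 h3 (ih hg)

/-- The marked edges. -/
def marked (L : LCDAWG T) (s : State α) : Finset (Fin L.edges) :=
  Finset.univ.filter fun e => s.mem 12 e = 1

theorem run_walkProg (hB : L.Big B M) (hs : s.Bdd M) {e : Fin L.edges} (h4 : s.reg 4 = e)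
    (hm : ∀ e : Fin L.edges, s.mem 12 e = 1 → 2 ≤ L.slen e ∧
      ∃ e₁ : Fin L.edges, s.mem 11 e = e₁ ∧ L.IsPar e e₁ ∧ L.slen e₁ = L.slen e) :
    Run B M walkProg s fun t s' => ∃ W c, L.Walk e W c ∧ W.Nodup ∧
      (∀ q ∈ W, s.mem 12 q = 1) ∧ s.mem 12 c ≠ 1 ∧ s'.reg 4 = c ∧ t ≤ 8 * W.length + 4 := by
  have hM := hB.edges
  have hcard : ∀ W : List (Fin L.edges), W.Nodup → (∀ q ∈ W, s.mem 12 q = 1) →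
      W.length ≤ (L.marked s).card := by
    intro W hW hq
    rw [← List.toFinset_card_of_nodup hW]
    refine Finset.card_le_card fun q h => ?_
    simpa [marked] using hq q (List.mem_toFinset.1 h)
  -- A walk passes distinct marked edges, so their number bounds its length; each of its steps costs
  -- at most 8.
  refine (Run.loop (n := 8 * (L.marked s).card) hB.one_le hB.bound (by decide)
    (fun n s' => ∃ W c, L.Walk e W c ∧ W.Nodup ∧ (∀ q ∈ W, s.mem 12 q = 1) ∧ s'.reg 4 = c ∧
      n + 8 * W.length = 8 * (L.marked s).card) hs
    ⟨[], e, .nil e, by simp, by simp, h4, by simp⟩ ?_).mono ?_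
  · rintro n s' hs' hf ⟨W, c, h1, h2, h3, h4, h5⟩ hh
    have m11 : s'.mem 11 = s.mem 11 := hf.mem 11 (by decide)
    have m12 : s'.mem 12 = s.mem 12 := hf.mem 12 (by decide)
    simp only [Test.Holds, Expr.val, h4, m12] at hh
    obtain ⟨h6, c', h7, h8, h9⟩ := hm c hh
    refine Run.of_wp (τ := 3) hB.one_le hB.bound (by decide) hs' (by decide) ?_
    simp only [Prog.wp, Expr.val, h4, m11, h7]
    have := c'.2
    have hc : c ∉ W := fun h => lt_irrefl _ (h1.lt c h)
    have hW : (W ++ [c]).Nodup := by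
      rw [List.nodup_append]
      refine ⟨h2, by simp, fun a ha b hb hab => hc ?_⟩
      rwa [← List.mem_singleton.1 hb, ← hab]
    have hq : ∀ q ∈ W ++ [c], s.mem 12 q = 1 := by
      intro q hq
      rcases List.mem_append.1 hq with h | h
      · exact h3 q h
      · rw [List.mem_singleton.1 h]; exact hh
    have hl := hcard _ hW hq
    simp only [List.length_append, List.length_singleton] at hl
    refine ⟨by omega, fun t ht => ⟨n - 8, ?_, W ++ [c], c', h1.snoc h6 h8 h9, hW, hq, by simp, ?_⟩⟩
    · simp only [Test.cost, Expr.cost]; omega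
    · simp only [List.length_append, List.length_singleton]; omega
  · rintro t s' - hf ⟨n, h1, ⟨W, c, h2, h3, h4, h5, h6⟩, hh⟩
    have m12 : s'.mem 12 = s.mem 12 := hf.mem 12 (by decide)
    simp only [Test.Holds, Expr.val, h5, m12] at hh
    simp only [Test.cost, Expr.cost] at h1
    exact ⟨W, c, h2, h3, h4, hh, h5, by omega⟩

/-- The list `W'` in the invariant is the part of the walk still to be filled; its marks are intact,
so the loop follows precisely `W` and stops at `c`. The rule of `c` is valid on all of `W` because
jump links are inherited. It is demanded only for nonempty `W`, since an unmarked edge with a label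
of one letter has no such rule. -/
theorem run_fillProg (hB : L.Big B M) (hs : s.Bdd M) {a c g f : Fin L.edges} {W}
    (h4 : s.reg 4 = a) (hw : L.Walk a W c) (hW : W.Nodup) (hq : ∀ q ∈ W, s.mem 12 q = 1)
    (hm : ∀ q ∈ W, ∃ e₁ : Fin L.edges, s.mem 11 q = e₁ ∧ L.IsPar q e₁)
    (hc : s.mem 12 c ≠ 1)
    (hg : W ≠ [] → s.reg 5 = g ∧ L.hi f = L.lo g ∧ s.reg 6 = L.restVar f ∧ L.IsJumpHead c g) :
    Run B M fillProg s fun t s' => t ≤ 25 * W.length + 4 ∧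
      (∀ e : Fin L.edges, s'.mem 12 e = if e ∈ W then 0 else s.mem 12 e) ∧
      (∀ e ∈ W, L.HasJump s' e) ∧
      ∀ i, (∀ q ∈ W, (q : ℕ) ≠ i) →
        s'.mem 7 i = s.mem 7 i ∧ s'.mem 8 i = s.mem 8 i ∧ s'.mem 9 i = s.mem 9 i := by
  have hM := hB.edges
  refine (Run.loop (n := 25 * W.length) hB.one_le hB.bound (by decide)
    (fun n s' => ∃ W' a', L.Walk a' W' c ∧ W'.Nodup ∧ (∀ q ∈ W', q ∈ W) ∧ s'.reg 4 = a' ∧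
      n = 25 * W'.length ∧
      (∀ e : Fin L.edges, s'.mem 12 e = if e ∈ W ∧ e ∉ W' then 0 else s.mem 12 e) ∧
      (∀ e ∈ W, e ∉ W' → L.HasJump s' e) ∧
      ∀ i, (∀ q ∈ W, (q : ℕ) ≠ i) →
        s'.mem 7 i = s.mem 7 i ∧ s'.mem 8 i = s.mem 8 i ∧ s'.mem 9 i = s.mem 9 i) hs ?_ ?_).mono ?_
  · refine ⟨W, a, hw, hW, fun _ => id, h4, rfl, fun e => ?_, fun e h h' => absurd h h', ?_⟩
    · rw [if_neg fun h => h.2 h.1]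
    · exact fun _ _ => ⟨rfl, rfl, rfl⟩
  · rintro n s' hs' hf ⟨W', a', h1, h2, h3, h4, h5, h6, h7, h8⟩ hh
    simp only [Test.Holds, Expr.val, h4] at hh
    cases h1 with
    | nil =>
      rw [h6] at hh
      split at hh
      · exact absurd hh (by simp)
      · exact absurd hh hc
    | @cons a' b W' c h9 h10 h11 h12 =>
      have haW := h3 a' List.mem_cons_self
      obtain ⟨b', hb', hpar⟩ := hm a' haW
      obtain rfl := hpar.unique h10
      obtain ⟨hg5, hgf, hg6, hgc⟩ := hg (List.ne_nil_of_mem haW)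
      have hj := h12.isJumpHead hgc
      have hj' := h10.isJumpHead_step h9 h11 hj
      have r5 : s'.reg 5 = g := by rw [hf.reg 5 (by decide), hg5]
      have r6 : s'.reg 6 = L.restVar f := by rw [hf.reg 6 (by decide), hg6]
      have m11 : s'.mem 11 = s.mem 11 := hf.mem 11 (by decide)
      have hb := b'.2
      have hgl := g.2
      have hrf := hs'.1 6
      rw [r6] at hrf
      refine Run.of_wp (τ := 20) hB.one_le hB.bound (by decide) hs' (by decide) ?_
      simp [fillBody, Prog.wp, Expr.val, h4, m11, hb', r5, r6]
      obtain ⟨h13, h14⟩ := List.nodup_cons.1 h2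
      refine ⟨by omega, by omega, by omega, hrf, by omega, fun t ht => ⟨W', ?_, b', h12, h14, ?_,
        rfl, ?_, ?_, ?_⟩⟩
      · simp only [Test.cost, Expr.cost]; rw [h5, List.length_cons]; omega
      · exact fun q hq => h3 q (List.mem_cons_of_mem _ hq)
      · intro e
        have := h6 e
        simp only [List.mem_cons] at this
        grind
      · intro e he heW
        have := h7 e he
        simp only [List.mem_cons, HasJump, HasRule] at this ⊢
        simp
        grind
      · intro i hi
        have := h8 i hi
        have := hi a' haW
        grind
  · rintro t s' - - ⟨n, h1, ⟨W', a', h2, h3, h4, h5, h6, h7, h8, h9⟩, hh⟩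
    simp only [Test.Holds, Expr.val, h5] at hh
    simp only [Test.cost, Expr.cost] at h1
    cases h2 with
    | nil =>
      exact ⟨by omega, by simpa using h7, by simpa using h8, h9⟩
    | @cons a' b W' c h10 h11 h12 h13 =>
      have := hq a' (h4 a' List.mem_cons_self)
      rw [h7, if_neg (by simp), this] at hh
      exact absurd rfl hh

end LCDAWG
end Program
end LinCDAWG

namespace LinCDAWG

/-! ### Amortised cost of the marked edges -/

section Program

open Prog

variable {α : Type*} [LinearOrder α] {T : List α}

namespace LCDAWG

variable {L : LCDAWG T} {s s' : State α} {B M : ℕ}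

/-- The marked edges act as a potential: each edge of the walk costs at most 8 in the first pass and
25 in the second, and then loses its mark. -/
theorem run_jumpBody (hB : L.Big B M) (hs : s.Bdd M) {e : Fin L.edges}
    (h3 : s.reg 3 = e) (hT : L.TailSpec L.edges s) (hJ : L.JumpSpec L.edges s) :
    Run B M jumpBody s fun t s' => t + 33 * (L.marked s').card ≤ 33 * (L.marked s).card + 40 ∧
      s'.reg 3 = e + 1 ∧ s'.mem 12 e ≠ 1 ∧
      (∀ e' : Fin L.edges, s'.mem 12 e' = 1 → s.mem 12 e' = 1) ∧
      L.TailSpec L.edges s' ∧ L.JumpSpec L.edges s' := by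
  have hM := hB.edges
  have he := e.2
  refine Run.seq (Run.of_wp (τ := 2) hB.one_le hB.bound (by decide) hs (by decide) ?_)
  simp only [Prog.wp, Expr.val, h3]
  refine ⟨by omega, fun t1 ht1 => ?_⟩
  have hs1 : (s.setReg 4 e).Bdd M := hs.setReg (by omega)
  refine Run.seq ((run_walkProg (e := e) (s := s.setReg 4 e) hB hs1 (by simp)
    fun e h => (hJ.1 e h).2).mono ?_)
  rintro t2 s2 hs2 hf2 ⟨W, c, hw, hW, hq, hc, h4, ht2⟩
  have m2 : ∀ a, s2.mem a = s.mem a := fun a => hf2.mem a (by simp [walkProg, mems])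
  have h32 : s2.reg 3 = e := by rw [hf2.reg 3 (by decide)]; simpa using h3
  simp only [State.mem_setReg] at hq hc
  refine Run.seq (Run.of_wp (τ := 12) hB.one_le hB.bound (by decide) hs2 (by decide) ?_)
  simp [jumpInit, Prog.wp, Expr.val, h4, m2, h32]
  refine ⟨hs.2 _ _, hs.2 _ _, by omega, fun t3 ht3 => ?_⟩
  generalize hs3 : ((s2.setReg 5 (s.mem 8 c)).setReg 6 (s.mem 9 c)).setReg 4 e = s3
  have hb3 : s3.Bdd M := by
    rw [← hs3]; exact ((hs2.setReg (hs.2 _ _)).setReg (hs.2 _ _)).setReg (by omega)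
  have m3 : ∀ a, s3.mem a = s.mem a := by rw [← hs3]; exact m2
  have r3 : s3.reg 3 = e := by rw [← hs3]; simpa using h32
  have r4 : s3.reg 4 = e := by rw [← hs3]; simp
  have r5 : s3.reg 5 = s.mem 8 c := by rw [← hs3]; simp
  have r6 : s3.reg 6 = s.mem 9 c := by rw [← hs3]; simp
  have c3 : s3.chr 1 = s.chr 1 := by
    rw [← hs3]; exact hf2.chr 1 (by decide)
  clear hs3
  -- Label lengths are constant along the walk, so the unmarked edge at its end has a rule to copy.
  have hwc : W ≠ [] → 2 ≤ L.slen c := by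
    intro h
    have key : L.slen c = L.slen e := by
      clear h hW hq ht2 h3 he h32 r3 r4
      clear hs1 hf2
      induction hw with
      | nil => rfl
      | cons h1 h2 h3 _ ih => exact (ih hc h4 r5 r6).trans h3
    rw [key]
    cases hw with
    | nil => exact absurd rfl h
    | cons h1 => exact h1
  -- For an empty walk any edges will do as witnesses.
  obtain ⟨g, f, hg⟩ : ∃ g f : Fin L.edges, W ≠ [] → s3.reg 5 = g ∧ L.hi f = L.lo g ∧
      s3.reg 6 = L.restVar f ∧ L.IsJumpHead c g := by
    by_cases h : W = []
    · exact ⟨e, e, fun h' => absurd h h'⟩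
    · obtain ⟨g, h1, -, h2, f, h3, h4⟩ := (hJ.2 c c.2 (hwc h)).resolve_left hc
      exact ⟨g, f, fun _ => ⟨by rw [r5, h2], h3, by rw [r6, h4], h1⟩⟩
  refine Run.seq ((run_fillProg hB hb3 r4 hw hW (by rwa [m3]) ?_ (by rwa [m3]) hg).mono ?_)
  · intro q hq'
    obtain ⟨-, -, e₁, h1, h2, -⟩ := hJ.1 q (hq q hq')
    exact ⟨e₁, by rw [m3, h1], h2⟩
  rintro t4 s4 hs4 hf4 ⟨ht4, h12, hj, hun⟩
  refine Run.of_wp (τ := 4) hB.one_le hB.bound (by decide) hs4 (by decide) ?_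
  have r34 : s4.reg 3 = e := by rw [hf4.reg 3 (by decide), r3]
  simp only [Prog.wp, Expr.val, r34]
  refine ⟨by omega, fun t5 ht5 => ⟨?_, by simp, ?_, ?_, ?_, ?_⟩⟩
  · have hcard : (L.marked s4).card + W.length = (L.marked s).card := by
      rw [← List.toFinset_card_of_nodup hW, ← Finset.card_union_of_disjoint]
      · congr 1
        ext q
        have := h12 q
        have := hq q
        rw [m3] at *
        simp only [marked, Finset.mem_union, Finset.mem_filter, Finset.mem_univ, true_and,
          List.mem_toFinset]
        grind
      · rw [Finset.disjoint_left]
        intro q hq1 hq2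
        simp only [marked, Finset.mem_filter] at hq1
        rw [h12, if_pos (List.mem_toFinset.1 hq2)] at hq1
        exact absurd hq1.2 (by simp)
    have : L.marked (s4.setReg 3 (e + 1)) = L.marked s4 := rfl
    rw [this]
    omega
  · simp only [State.mem_setReg]
    rw [h12]
    split
    · simp
    · next h =>
      rw [m3]
      cases hw with
      | nil => exact hc
      | cons => exact absurd List.mem_cons_self h
  · intro e' h
    simp only [State.mem_setReg] at h
    rw [h12, m3] at h
    split at h
    · simp at h
    · exact h
  · have hne : ∀ e' : Fin L.edges, ∀ q ∈ W, (q : ℕ) ≠ e' + L.edges := by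
      intro e' q _; omega
    have c4 : s4.chr 1 = s.chr 1 := by rw [hf4.chr 1 (by decide), c3]
    have m10 : s4.mem 10 = s.mem 10 := by rw [hf4.mem 10 (by decide), m3]
    obtain ⟨j1, j2, j3, j4⟩ := hT
    simp only [HasRule, HasLetter, m3] at *
    constructor
    · simpa [m10] using j1
    · simpa [c4] using j2
    · intro e' h1 h2
      obtain ⟨u1, u2, u3⟩ := hun _ (hne e')
      simpa [HasRule, u1, u2, u3] using j3 e' h1 h2
    · intro e' h1 h2
      obtain ⟨u1, u2, u3⟩ := hun _ (hne e')
      simpa [HasLetter, u1, c4] using j4 e' h1 h2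
  · have m11 : s4.mem 11 = s.mem 11 := by rw [hf4.mem 11 (by decide), m3]
    have hne : ∀ e' : Fin L.edges, e' ∉ W → ∀ q ∈ W, (q : ℕ) ≠ e' := by
      intro e' he' q hq' h
      exact he' (Fin.ext h ▸ hq')
    simp only [m3] at h12 hun
    constructor
    · intro e' h
      simp only [State.mem_setReg, m11] at h ⊢
      rw [h12] at h
      split at h
      · simp at h
      · exact hJ.1 e' h
    · intro e' h1 h2
      by_cases h : e' ∈ W
      · exact Or.inr (hj e' h)
      · obtain ⟨u1, u2, u3⟩ := hun _ (hne e' h)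
        have := hJ.2 e' h1 h2
        simp only [HasJump, HasRule] at this
        simpa [HasJump, HasRule, h12, h, u1, u2, u3] using this
    · intro e' h
      have hz := hJ.3 e' h
      have : e' ∉ W := by
        intro h'
        have h1 := (hJ.1 e' (hq e' h')).2.1
        have := e'.2
        omega
      simp only [State.mem_setReg]
      rw [(hun _ (hne e' this)).1]
      exact hz

/-- The bound 76 consists of 33 for the initial mark of an edge, 40 for its round and 3 for the loop
test. -/
theorem run_jumpProg (hB : L.Big B M) (hs : s.Bdd M) (hi : L.Inp s)
    (hT : L.TailSpec L.edges s) (hJ : L.JumpSpec L.edges s) :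
    Run B M jumpProg s fun t s' => t ≤ 76 * L.edges + 5 ∧ L.TailSpec L.edges s' ∧
      (∀ e, 2 ≤ L.slen e → L.HasJump s' e) ∧ ∀ e : Fin L.edges, L.slen e = 1 → s'.mem 7 e = 0 := by
  have hcard : ∀ s : State α, (L.marked s).card ≤ L.edges := by
    intro s
    refine (Finset.card_filter_le _ _).trans ?_
    simp
  refine (run_forEdges hB hs hi.edges (by decide) (n := 33 * (L.marked s).card + 43 * L.edges)
    (fun n k s' => n + 43 * k = 33 * (L.marked s').card + 43 * L.edges ∧
      (∀ e : Fin L.edges, e < k → s'.mem 12 e ≠ 1) ∧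
      L.TailSpec L.edges s' ∧ L.JumpSpec L.edges s')
    ?_ ?_).mono ?_
  · refine ⟨rfl, fun e he => by omega, ⟨hT.1, hT.2, hT.3, hT.4⟩, ⟨hJ.1, hJ.2, hJ.3⟩⟩
  · rintro n e s' hs' hf h3 ⟨h4, h5, h6, h7⟩
    refine (run_jumpBody hB hs' h3 h6 h7).mono ?_
    rintro t s'' - - ⟨h8, h9, h10, h11, h12, h13⟩
    have := e.2
    refine ⟨h9, 33 * (L.marked s'').card + 43 * L.edges - 43 * (e + 1), by omega, by omega,
      fun e' he' h => ?_, h12, h13⟩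
    rcases Nat.lt_succ_iff_lt_or_eq.1 he' with h' | h'
    · exact h5 e' h' (h11 e' h)
    · rw [Fin.ext h'] at h
      exact h10 h
  · rintro t s' - - ⟨n, h1, h2, h3, h4, h5⟩
    have := hcard s
    refine ⟨by omega, h4, fun e he => (h5.2 e e.2 he).resolve_left (h3 e e.2),
      fun e he => h5.3 e (Or.inr he)⟩

end LCDAWG
end Program
end LinCDAWG

namespace LinCDAWG

/-! ### The longest path -/

section Program

open Prog

def degBody : Prog :=
  .seq (.write 13 (.read 5 (.reg 3)) (.plus (.read 13 (.read 5 (.reg 3))) (.const 1)))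
    (.set 3 (.plus (.reg 3) (.const 1)))

/-- The in-degrees of the nodes. -/
def degProg : Prog := forEdges degBody

/-- Updates the length of the longest path to the end of the edge in register 6, and appends that
node to the queue if this was its last in-coming edge. -/
def visitBody : Prog :=
  .seq (.set 8 (.read 5 (.reg 6))) <|
  .seq (.set 9 (.plus (.read 15 (.reg 5)) (.read 6 (.reg 6)))) <|
  .seq (.ite (.lt (.read 15 (.reg 8)) (.reg 9))
    (.seq (.write 15 (.reg 8) (.reg 9)) (.write 16 (.reg 8) (.reg 6))) .skip) <|
  .seq (.write 13 (.reg 8) (.minus (.read 13 (.reg 8)) (.const 1))) <|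
  .seq (.ite (.eq (.read 13 (.reg 8)) (.const 0))
    (.seq (.write 14 (.reg 4) (.reg 8)) (.set 4 (.plus (.reg 4) (.const 1)))) .skip) <|
  .set 6 (.plus (.reg 6) (.const 1))

def visitProg : Prog := .loop (.lt (.reg 6) (.reg 7)) visitBody

/-- Register 10 keeps the node with the longest string among those taken from the queue so far; in
the end it is the node of `T`. -/
def nodeInit : Prog :=
  .seq (.set 5 (.read 14 (.reg 3))) <|
  .seq (.set 3 (.plus (.reg 3) (.const 1))) <|
  .seq (.ite (.lt (.read 15 (.reg 10)) (.read 15 (.reg 5))) (.set 10 (.reg 5)) .skip) <|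
  .seq (.set 6 (.read 2 (.reg 5))) <|
  .set 7 (.plus (.reg 6) (.read 3 (.reg 5)))

def orderInit : Prog :=
  .seq (.write 14 (.const 0) (.reg 2)) <|
  .seq (.set 3 (.const 0)) <|
  .seq (.set 4 (.const 1)) <|
  .set 10 (.reg 2)

/-- Visits the nodes in a topological order. -/
def orderProg : Prog :=
  .seq orderInit (.loop (.lt (.reg 3) (.reg 4)) (.seq nodeInit visitProg))

variable {α : Type*} [LinearOrder α] {T : List α}

namespace LCDAWG

variable {L : LCDAWG T} {s s' : State α} {B M : ℕ}

theorem run_degProg (hB : L.Big B M) (hs : s.Bdd M) (hi : L.Inp s) (h13 : ∀ i, s.mem 13 i = 0) :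
    Run B M degProg s fun t s' => t ≤ 20 * L.edges + 5 ∧
      ∀ v : Fin L.nodes, s'.mem 13 v = (Finset.univ.filter fun e => L.lo e = v).card := by
  have hM := hB.edges
  have hcard : ∀ k (v : Fin L.nodes),
      (Finset.univ.filter fun e : Fin L.edges => L.lo e = v ∧ (e : ℕ) < k).card ≤ L.edges := by
    intro k v
    refine (Finset.card_filter_le _ _).trans ?_
    simp
  refine (run_forEdges hB hs hi.edges (by decide) (n := 20 * L.edges)
    (fun n k s' => n + 20 * k = 20 * L.edges ∧ ∀ v : Fin L.nodes, s'.mem 13 v =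
      (Finset.univ.filter fun e : Fin L.edges => L.lo e = v ∧ (e : ℕ) < k).card) ?_ ?_).mono ?_
  · refine ⟨rfl, fun v => ?_⟩
    simp [h13]
  · rintro n e s' hs' hf h3 ⟨h4, h5⟩
    have hi' := hi.frame hf (by decide) (by decide) (by decide)
    have he := e.2
    have key : ∀ v, (Finset.univ.filter fun e' : Fin L.edges => L.lo e' = v ∧ (e' : ℕ) < e + 1).card
        = (Finset.univ.filter fun e' : Fin L.edges => L.lo e' = v ∧ (e' : ℕ) < e).card +
          if v = L.lo e then 1 else 0 := by
      intro v
      split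
      · next h =>
        rw [← Finset.card_insert_of_notMem (a := e) (by simp)]
        congr 1
        ext e'
        simp only [Finset.mem_filter, Finset.mem_univ, true_and, Finset.mem_insert, Fin.ext_iff]
        constructor
        · rintro ⟨h1, h2⟩; omega
        · rintro (h1 | ⟨h1, h2⟩)
          · rw [Fin.ext h1]
            exact ⟨Fin.ext_iff.1 h.symm, by omega⟩
          · exact ⟨h1, by omega⟩
      · next h =>
        rw [add_zero]
        congr 1
        ext e'
        simp only [Finset.mem_filter, Finset.mem_univ, true_and]
        refine and_congr_right fun h1 => ⟨fun h2 => ?_, fun h2 => by omega⟩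
        refine lt_of_le_of_ne (by omega) fun h3 => h ?_
        rw [← h1, Fin.ext h3]
    have hc := hcard e (L.lo e)
    obtain ⟨c, hcd⟩ : ∃ c : Fin L.nodes → ℕ, ∀ v, (Finset.univ.filter fun e' : Fin L.edges =>
      L.lo e' = v ∧ (e' : ℕ) < e).card = c v := ⟨_, fun _ => rfl⟩
    simp only [key]
    simp only [hcd] at h5 hc ⊢
    refine Run.of_wp (τ := 16) hB.one_le hB.bound (by decide) hs' (by decide) ?_
    simp [degBody, Prog.wp, Expr.val, h3, hi'.lo, h5]
    refine ⟨by omega, by omega, fun t ht => ⟨n - 20, by omega, by omega, fun v => ?_⟩⟩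
    by_cases h : v = L.lo e
    · subst h; simp
    · simp [h, Fin.val_inj]
  · rintro t s' - - ⟨n, h1, h2, h3⟩
    refine ⟨by omega, fun v => ?_⟩
    rw [h3]
    congr 1
    ext e
    simp

/-- The state of the traversal: `Q` is the queue of all nodes without in-coming edges outside of the
set `D` of edges that have been visited. -/
structure OrderSpec (L : LCDAWG T) (s : State α) (Q : List (Fin L.nodes))
    (D : Finset (Fin L.edges)) : Prop where
  nodup : Q.Nodup
  tail : s.reg 4 = Q.length
  queue : ∀ k (h : k < Q.length), s.mem 14 k = Q[k]
  indeg : ∀ v : Fin L.nodes,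
    s.mem 13 v = (Finset.univ.filter fun e => L.lo e = v ∧ e ∉ D).card
  mem : ∀ v, v ∈ Q ↔ ∀ e, L.lo e = v → e ∈ D
  le : ∀ e ∈ D, (L.str (L.hi e)).length + L.slen e ≤ s.mem 15 (L.lo e)
  pred : ∀ v : Fin L.nodes, s.mem 15 v ≠ 0 → ∃ e : Fin L.edges, s.mem 16 v = e ∧ L.lo e = v ∧
    (L.str (L.hi e)).length + L.slen e = s.mem 15 v

theorem lo_ne_root (e : Fin L.edges) : L.lo e ≠ L.root := by
  intro h
  have := L.length_str_hi_lt e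
  rw [h, str_root] at this
  simp at this

/-- The last edge of the longest path to `v` has been visited, which gives one inequality; the
recorded edge gives the other, because no edge leads beyond the longest string. Entry 0 means that
nothing is recorded, which remains so only at the source. -/
theorem OrderSpec.length_eq {Q : List (Fin L.nodes)} {D : Finset (Fin L.edges)}
    (h : L.OrderSpec s Q D) {v : Fin L.nodes} (hv : v ∈ Q) :
    s.mem 15 v = (L.str v).length := by
  by_cases hr : v = L.root
  · subst hr
    rw [str_root]
    by_contra hc
    obtain ⟨e, -, he, -⟩ := h.pred _ hc
    exact lo_ne_root e he
  · obtain ⟨e, he, hl⟩ := L.exists_primary_edge hr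
    have h1 := h.le e ((h.mem v).1 hv e he)
    have h2 := L.slen_pos e
    rw [he] at h1
    obtain ⟨e', -, he', hl'⟩ := h.pred v (by omega)
    have h3 := L.slen_add_le e'
    rw [he'] at h3
    omega

theorem run_visitBody (hB : L.Big B M) (hs : s.Bdd M) (hi : L.Inp s) {Q : List (Fin L.nodes)}
    {D : Finset (Fin L.edges)} (hO : L.OrderSpec s Q D) {e : Fin L.edges} (he : e ∉ D)
    (hu : L.hi e ∈ Q) (h5 : s.reg 5 = L.hi e) (h6 : s.reg 6 = e) :
    Run B M visitBody s fun t s' => t ≤ 60 ∧ s'.reg 6 = e + 1 ∧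
      ∃ Q', Q <+: Q' ∧ L.OrderSpec s' Q' (insert e D) := by
  have hM := hB.edges
  have hMl := hB.length
  have he' := e.2
  have hlo := (L.lo e).2
  have hMn := hB.nodes
  have hlen := hO.length_eq hu
  have hvQ : L.lo e ∉ Q := fun h => he ((hO.mem _).1 h e rfl)
  have hQ : Q.length + 1 ≤ L.nodes := by
    have := List.Nodup.length_le_card (List.nodup_cons.2 ⟨hvQ, hO.nodup⟩)
    simpa using this
  have hle := L.slen_add_le e
  have hle' := L.length_str_le (L.lo e)
  have hpos := L.slen_pos e
  have hcard : ∀ v, (Finset.univ.filter fun e' => L.lo e' = v ∧ e' ∉ insert e D).card =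
      if v = L.lo e then (Finset.univ.filter fun e' => L.lo e' = v ∧ e' ∉ D).card - 1
      else (Finset.univ.filter fun e' => L.lo e' = v ∧ e' ∉ D).card := by
    intro v
    split
    · next h =>
      rw [← Finset.card_erase_of_mem (a := e) (by simp [h, he])]
      congr 1
      ext e'
      simp only [Finset.mem_filter, Finset.mem_univ, true_and, Finset.mem_insert, Finset.mem_erase]
      tauto
    · next h =>
      congr 1
      ext e'
      simp only [Finset.mem_filter, Finset.mem_univ, true_and, Finset.mem_insert]
      grind
  -- The counter of a node reaches zero exactly when its last in-coming edge is visited; only then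
  -- does the node enter the queue.
  have hzero : (Finset.univ.filter fun e' => L.lo e' = L.lo e ∧ e' ∉ D).card - 1 = 0 ↔
      ∀ e', L.lo e' = L.lo e → e' ∈ insert e D := by
    have := hcard (L.lo e)
    rw [if_pos rfl] at this
    rw [← this, Finset.card_eq_zero, Finset.filter_eq_empty_iff]
    simp only [Finset.mem_univ, forall_const, not_and, not_not]
  obtain ⟨o1, o2, o3, o4, o5, o6, o7⟩ := hO
  have hb13 := hs.2 13 (L.lo e)
  obtain ⟨c, hc⟩ : ∃ c : Fin L.nodes → ℕ, ∀ v,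
      (Finset.univ.filter fun e' => L.lo e' = v ∧ e' ∉ D).card = c v := ⟨_, fun _ => rfl⟩
  simp only [hc] at hcard hzero o4
  rw [o4] at hb13
  have hmem : ∀ v, v ≠ L.lo e → ((∀ e', L.lo e' = v → e' ∈ insert e D) ↔ v ∈ Q) := by
    intro v hv
    rw [o5]
    refine forall_congr' fun e' => ⟨fun h h' => ?_, fun h h' => Finset.mem_insert_of_mem (h h')⟩
    refine Finset.mem_of_mem_insert_of_ne (h h') fun h2 => hv ?_
    rw [← h', h2]
  refine Run.of_wp (τ := 60) hB.one_le hB.bound (by decide) hs (by decide) ?_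
  by_cases hz : c (L.lo e) - 1 = 0
  · by_cases hlt : s.mem 15 (L.lo e) < (L.str (L.hi e)).length + L.slen e
    all_goals
      simp [visitBody, Prog.wp, Expr.val, Test.Holds, h5, h6, hi.lo, hi.slen, hlen, o4, hlt, hz, o2]
      repeat refine ⟨by omega, ?_⟩
      intro t ht
      refine ⟨ht, ?_⟩
      refine ⟨Q ++ [L.lo e], List.prefix_append _ _, ?_⟩
      constructor
      · rw [List.nodup_append]
        refine ⟨o1, by simp, fun a ha b hb hab => hvQ ?_⟩
        rwa [← List.mem_singleton.1 hb, ← hab]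
      · simp
      · intro k hk
        simp
        grind
      · intro v
        rw [hcard]
        simp [Fin.val_inj]
        grind
      · intro v
        rw [List.mem_append, List.mem_singleton]
        grind
      · simp [Fin.val_inj]
        grind
      · simp [Fin.val_inj]
        grind
  · by_cases hlt : s.mem 15 (L.lo e) < (L.str (L.hi e)).length + L.slen e
    all_goals
      simp [visitBody, Prog.wp, Expr.val, Test.Holds, h5, h6, hi.lo, hi.slen, hlen, o4, hlt, hz, o2]
      repeat refine ⟨by omega, ?_⟩
      intro t ht
      refine ⟨ht, ?_⟩
      refine ⟨Q, List.prefix_rfl, ?_⟩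
      constructor
      · exact o1
      · simpa using o2
      · simpa using o3
      · intro v
        rw [hcard]
        simp [Fin.val_inj]
        grind
      · intro v
        by_cases hv : v = L.lo e
        · subst hv
          exact ⟨fun h => absurd h hvQ, fun h => absurd (hzero.2 h) hz⟩
        · exact (hmem v hv).symm
      · simp [Fin.val_inj]
        grind
      · simp [Fin.val_inj]
        grind

theorem run_visitProg (hB : L.Big B M) (hs : s.Bdd M) (hi : L.Inp s) {Q : List (Fin L.nodes)}
    {D : Finset (Fin L.edges)} (hO : L.OrderSpec s Q D) {u : Fin L.nodes} (hu : u ∈ Q)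
    (h5 : s.reg 5 = u) (h6 : s.reg 6 = L.first u) (h7 : s.reg 7 = L.first u + L.deg u)
    (hD : ∀ e, L.hi e = u → e ∉ D) :
    Run B M visitProg s fun t s' => ∃ Q' D', Q <+: Q' ∧ L.OrderSpec s' Q' D' ∧
      (∀ e, e ∈ D' ↔ e ∈ D ∨ L.hi e = u) ∧ t + 64 * D.card ≤ 64 * D'.card + 4 := by
  have hle := L.out_le u
  refine (Run.loop (n := 64 * L.deg u) hB.one_le hB.bound (by decide)
    (fun n s' => ∃ Q' D' j, Q <+: Q' ∧ L.OrderSpec s' Q' D' ∧ s'.reg 6 = L.first u + j ∧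
      j ≤ L.deg u ∧ (∀ e, e ∈ D' ↔ e ∈ D ∨ (L.hi e = u ∧ e < L.first u + j)) ∧
      D'.card = D.card + j ∧ n + 64 * j = 64 * L.deg u) hs
      ⟨Q, D, 0, List.prefix_rfl, hO, h6, Nat.zero_le _, fun e => ?_, rfl, rfl⟩ ?_).mono ?_
  · refine ⟨Or.inl, fun h => h.resolve_right fun ⟨h1, h2⟩ => ?_⟩
    have := ((L.out_spec u e).1 h1).1
    omega
  · rintro n s' hs' hf ⟨Q', D', j, h8, h9, h10, h11, h12, h13, h14⟩ hh
    have r7 : s'.reg 7 = L.first u + L.deg u := by rw [hf.reg 7 (by decide), h7]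
    have r5 : s'.reg 5 = u := by rw [hf.reg 5 (by decide), h5]
    simp only [Test.Holds, Expr.val, h10, r7] at hh
    obtain ⟨e, he⟩ : ∃ e : Fin L.edges, L.first u + j = e := ⟨⟨L.first u + j, by omega⟩, rfl⟩
    have heu : L.hi e = u := by rw [L.out_spec]; omega
    have heD : e ∉ D' := by
      rw [h12, not_or]
      exact ⟨hD e heu, fun h => by omega⟩
    refine (run_visitBody hB hs' (hi.frame hf (by decide) (by decide) (by decide)) h9 heD
      (heu ▸ h8.subset hu) (by rw [r5, heu]) (by rw [h10, he])).mono ?_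
    rintro t s'' - - ⟨h15, h16, Q'', h17, h18⟩
    refine ⟨n - 64, ?_, Q'', insert e D', j + 1, h8.trans h17, h18, by omega, by omega,
      fun e' => ?_, ?_, by omega⟩
    · simp only [Test.cost, Expr.cost]; omega
    · rw [Finset.mem_insert, h12]
      constructor
      · rintro (rfl | h | ⟨h1, h2⟩)
        · exact Or.inr ⟨heu, by omega⟩
        · exact Or.inl h
        · exact Or.inr ⟨h1, by omega⟩
      · rintro (h | ⟨h1, h2⟩)
        · exact Or.inr (Or.inl h)
        · by_cases h3 : (e' : ℕ) = e
          · exact Or.inl (Fin.ext h3)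
          · exact Or.inr (Or.inr ⟨h1, by omega⟩)
    · rw [Finset.card_insert_of_notMem heD, h13]; omega
  · rintro t s' - hf ⟨n, h1, ⟨Q', D', j, h8, h9, h10, h11, h12, h13, h14⟩, hh⟩
    have r7 : s'.reg 7 = L.first u + L.deg u := by rw [hf.reg 7 (by decide), h7]
    simp only [Test.Holds, Expr.val, h10, r7] at hh
    simp only [Test.cost, Expr.cost] at h1
    obtain rfl : j = L.deg u := by omega
    refine ⟨Q', D', h8, h9, fun e => ?_, by omega⟩
    rw [h12]
    refine or_congr_right ⟨fun h => h.1, fun h => ⟨h, ?_⟩⟩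
    exact ((L.out_spec u e).1 h).2

theorem run_orderProg (hB : L.Big B M) (hs : s.Bdd M) (hi : L.Inp s)
    (h13 : ∀ v : Fin L.nodes, s.mem 13 v = (Finset.univ.filter fun e => L.lo e = v).card)
    (h15 : ∀ i, s.mem 15 i = 0) :
    Run B M orderProg s fun t s' => t ≤ 64 * L.edges + 50 * L.nodes + 20 ∧
      (∃ b : Fin L.nodes, s'.reg 10 = b ∧ L.str b = T) ∧
      ∀ v, v ≠ L.root → ∃ e : Fin L.edges, s'.mem 16 v = e ∧ L.lo e = v ∧
        (L.str (L.hi e)).length + L.slen e = (L.str v).length := by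
  have hM := hB.edges
  have hMn := hB.nodes
  have hroot := L.root.2
  refine Run.seq (Run.of_wp (τ := 9) hB.one_le hB.bound (by decide) hs (by decide) ?_)
  simp only [orderInit, Prog.wp, Expr.val, State.reg_setMem, State.reg_setReg, hi.root]
  simp
  refine ⟨by omega, by omega, by omega, fun t0 ht0 => ?_⟩
  generalize hs1 : (((s.setMem 14 0 ↑L.root).setReg 3 0).setReg 4 1).setReg 10 ↑L.root = s1
  have hb1 : s1.Bdd M := by
    rw [← hs1]
    exact (((hs.setMem (by omega)).setReg (by omega)).setReg (by omega)).setReg (by omega)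
  have hi1 : L.Inp s1 := by
    rw [← hs1]
    constructor <;> simp
    exacts [hi.edges, hi.root, hi.type2, hi.slink, hi.first, hi.deg, hi.hi, hi.lo, hi.slen, hi.chr]
  -- The source is the only node without in-coming edges.
  have hO1 : L.OrderSpec s1 [L.root] ∅ := by
    rw [← hs1]
    constructor
    · simp
    · simp
    · simp
    · intro v; simpa using h13 v
    · intro v
      rw [List.mem_singleton]
      constructor
      · rintro rfl e he
        exact absurd he (lo_ne_root e)
      · intro h
        by_contra hr
        obtain ⟨e, he, -⟩ := L.exists_primary_edge hr
        exact absurd (h e he) (Finset.notMem_empty _)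
    · simp
    · intro v h
      simp [h15] at h
  have h3 : s1.reg 3 = 0 := by rw [← hs1]; simp
  have h10 : s1.reg 10 = L.root := by rw [← hs1]; simp
  clear hs1
  refine (Run.loop (n := 64 * L.edges + 50 * L.nodes) hB.one_le hB.bound (by decide)
    (fun n s' => ∃ Q D h b, L.OrderSpec s' Q D ∧ s'.reg 3 = h ∧ h ≤ Q.length ∧
      (∀ e, e ∈ D ↔ L.hi e ∈ Q.take h) ∧ b ∈ Q ∧ s'.reg 10 = b ∧
      (∀ v ∈ Q.take h, (L.str v).length ≤ (L.str b).length) ∧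
      n + 64 * D.card + 50 * h = 64 * L.edges + 50 * L.nodes) hb1
      ⟨[L.root], ∅, 0, L.root, hO1, h3, Nat.zero_le _, by simp, by simp, h10, by simp, by simp⟩
      ?_).mono ?_
  · rintro n s' hs' hf ⟨Q, D, h, b, hO, h4, h5, h6, h7, h8, h9, h10⟩ hh
    have hi' := hi1.frame hf (by decide) (by decide) (by decide)
    simp only [Test.Holds, Expr.val, h4, hO.tail] at hh
    have hQn : Q.length ≤ L.nodes := by simpa using hO.nodup.length_le_card
    obtain ⟨u, hu⟩ : ∃ u, Q[h] = u := ⟨_, rfl⟩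
    have huQ : u ∈ Q := hu ▸ List.getElem_mem hh
    have hq := hO.queue h hh
    rw [hu] at hq
    have htake : Q.take (h + 1) = Q.take h ++ [u] := by rw [List.take_succ_eq_append_getElem hh, hu]
    have hnot : u ∉ Q.take h := by
      have := hO.nodup.sublist (List.take_sublist (h + 1) Q)
      rw [htake, List.nodup_append] at this
      exact fun h => this.2.2 u h u (by simp) rfl
    have hbl := hO.length_eq h7
    have hul := hO.length_eq huQ
    have hle := L.out_le u
    have hu2 := u.2
    have hinit : Run B M nodeInit s' fun t s2 => t ≤ 30 ∧ s2.mem = s'.mem ∧ s2.reg 3 = h + 1 ∧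
        s2.reg 4 = s'.reg 4 ∧ (∃ b' ∈ Q, s2.reg 10 = b' ∧
          (L.str b).length ≤ (L.str b').length ∧ (L.str u).length ≤ (L.str b').length) ∧
        s2.reg 5 = u ∧ s2.reg 6 = L.first u ∧ s2.reg 7 = L.first u + L.deg u := by
      refine Run.of_wp (τ := 30) hB.one_le hB.bound (by decide) hs' (by decide) ?_
      by_cases hlt : (L.str b).length < (L.str u).length
      all_goals
        simp [nodeInit, Prog.wp, Expr.val, Test.Holds, h4, hq, h8, hbl, hul, hlt, hi'.first, hi'.deg]
        repeat refine ⟨by omega, ?_⟩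
        intro t ht
        refine ⟨ht, ?_⟩
      · exact ⟨u, huQ, rfl, hlt.le, le_rfl⟩
      · exact ⟨b, h7, rfl, le_rfl, not_lt.1 hlt⟩
    refine Run.seq (hinit.mono ?_)
    rintro t s2 hs2 hf2 ⟨ht, m2, h3, h4, ⟨b', hb', h10', hbb, hub⟩, r5, r6, r7⟩
    have hO2 : L.OrderSpec s2 Q D := by
      obtain ⟨o1, o2, o3, o4, o5, o6, o7⟩ := hO
      constructor <;> simpa only [m2, h4]
    refine (run_visitProg hB hs2 (hi'.frame hf2 (by decide) (by decide) (by decide)) hO2 huQ r5 r6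
      r7 fun e he hD => hnot (he ▸ (h6 e).1 hD)).mono ?_
    rintro t3 s3 - hf3 ⟨Q', D', hQQ, hO3, hD', ht3⟩
    have hlen := hQQ.length_le
    have hD'm : D'.card ≤ L.edges := by simpa using Finset.card_le_univ D'
    have htk : Q'.take (h + 1) = Q.take h ++ [u] := by
      rw [← htake]
      obtain ⟨R, rfl⟩ := hQQ
      exact List.take_append_of_le_length hh
    refine ⟨64 * L.edges + 50 * L.nodes - (64 * D'.card + 50 * (h + 1)), ?_, Q', D', h + 1, b', hO3,
      by rw [hf3.reg 3 (by decide), h3], by omega, fun e => ?_, hQQ.subset hb',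
      by rw [hf3.reg 10 (by decide), h10'], fun v hv => ?_, by omega⟩
    · simp only [Test.cost, Expr.cost]; omega
    · rw [hD', htk, h6, List.mem_append, List.mem_singleton]
    · rw [htk, List.mem_append, List.mem_singleton] at hv
      rcases hv with hv | rfl
      · exact (h9 v hv).trans hbb
      · exact hub
  · rintro t s' hs' hf ⟨n, h1, ⟨Q, D, h, b, hO, h4, h5, h6, h7, h8, h9, h10⟩, hh⟩
    simp only [Test.Holds, Expr.val, h4, hO.tail] at hh
    simp only [Test.cost, Expr.cost] at h1
    have htake : Q.take h = Q := List.take_of_length_le (by omega)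
    rw [htake] at h6 h9
    -- Every node gets into the queue, by induction on the length of its string: its in-coming edges
    -- start at nodes with shorter strings.
    have hall : ∀ k, ∀ v, (L.str v).length = k → v ∈ Q := by
      intro k
      induction k using Nat.strong_induction_on with
      | _ k ih =>
        intro v hv
        rw [hO.mem]
        rintro e rfl
        rw [h6]
        exact ih _ (hv ▸ L.length_str_hi_lt e) _ rfl
    refine ⟨by omega, ⟨b, h8, ?_⟩, fun v hv => ?_⟩
    · obtain ⟨i, hi⟩ := L.exists_text_node
      have h11 := h9 i (hall _ i rfl)
      rw [hi] at h11
      exact L.str_eq_text (le_antisymm (L.length_str_le b) h11)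
    · have hvQ := hall _ v rfl
      have hl := hO.length_eq hvQ
      rw [← hl]
      refine hO.pred v ?_
      obtain ⟨e, he, hle⟩ := L.exists_primary_edge hv
      have := L.slen_pos e
      omega

end LCDAWG
end Program
end LinCDAWG

namespace LinCDAWG

/-! ### The path of the text -/

section Program

open Prog

def traceInit : Prog :=
  .seq (.set 4 (.read 16 (.reg 10))) <|
  .seq (.set 5 (.reg 4)) <|
  .seq (.set 3 (.read 4 (.reg 4))) <|
  .set 6 (.plus (.reg 1) (.reg 1))

def traceBody : Prog :=
  .seq (.set 4 (.read 16 (.reg 3))) <|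
  .seq (.write 7 (.reg 6) (.const 1)) <|
  .seq (.write 8 (.reg 6) (.reg 4)) <|
  .seq (.write 9 (.reg 6) (.reg 5)) <|
  .seq (.set 5 (.reg 6)) <|
  .seq (.set 6 (.plus (.reg 6) (.const 1))) <|
  .set 3 (.read 4 (.reg 4))

/-- The sum of the two truncated differences is positive exactly if the current node is not the
source; there is no test for inequality. -/
def traceLoop : Prog :=
  .loop (.lt (.const 0) (.plus (.minus (.reg 3) (.reg 2)) (.minus (.reg 2) (.reg 3)))) traceBody

/-- Follows the longest path backwards and adds the rules for the text. -/
def traceProg : Prog :=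
  .seq traceInit <| .seq traceLoop <| .seq (.set 0 (.reg 6)) (.set 1 (.reg 5))

/-- The whole program. -/
def slpProg : Prog :=
  .seq tailProg <| .seq headProg <| .seq jumpProg <| .seq degProg <| .seq orderProg traceProg

variable {α : Type*} [LinearOrder α] {T : List α}

namespace LCDAWG

variable {L : LCDAWG T} {s s' : State α} {B M : ℕ}

/-- The rules of the variables below `n` expand the variable `y` along the path. -/
inductive Traced (L : LCDAWG T) (s : State α) : List (Fin L.edges) → ℕ → ℕ → Prop
  | single (e : Fin L.edges) : L.Traced s [e] e (L.edges + L.edges)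
  | cons {e : Fin L.edges} {p y n} : L.Traced s p y n → s.mem 7 n = 1 → s.mem 8 n = e →
      s.mem 9 n = y → L.Traced s (e :: p) n (n + 1)

theorem Traced.length {p y n} (h : L.Traced s p y n) : n + 1 = L.edges + L.edges + p.length := by
  induction h with
  | single => rfl
  | cons _ _ _ _ ih => rw [List.length_cons]; omega

theorem Traced.lt {p y n} (h : L.Traced s p y n) : y < n := by
  cases h with
  | single e => have := e.2; omega
  | cons => exact Nat.lt_succ_self _

theorem Traced.congr {p y n} (h : L.Traced s p y n)
    (hs : ∀ i < n, s'.mem 7 i = s.mem 7 i ∧ s'.mem 8 i = s.mem 8 i ∧ s'.mem 9 i = s.mem 9 i) :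
    L.Traced s' p y n := by
  induction h with
  | single e => exact .single e
  | @cons e p y n _ h7 h8 h9 ih =>
    obtain ⟨u7, u8, u9⟩ := hs n (Nat.lt_succ_self _)
    exact .cons (ih fun i hi => hs i (by omega)) (u7.trans h7) (u8.trans h8) (u9.trans h9)

/-- The last edge of the path is its own variable, and each edge before it gets a new variable,
numbered from `2m` on. The strings of the nodes shorten on the way back, so the edges are distinct
and at most `m` in number. -/
theorem run_traceProg (hB : L.Big B M) (hs : s.Bdd M) (hi : L.Inp s) (hT : T ≠ [])
    {b : Fin L.nodes} (hb : s.reg 10 = b) (hbT : L.str b = T)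
    (hpred : ∀ v, v ≠ L.root → ∃ e : Fin L.edges, s.mem 16 v = e ∧ L.lo e = v ∧
        (L.str (L.hi e)).length + L.slen e = (L.str v).length) :
    Run B M traceProg s fun t s' => t ≤ 40 * L.edges + 30 ∧
      (∀ i, i < L.edges + L.edges →
        s'.mem 7 i = s.mem 7 i ∧ s'.mem 8 i = s.mem 8 i ∧ s'.mem 9 i = s.mem 9 i) ∧
      ∃ p y n, L.Traced s' p y n ∧ p.length ≤ L.edges ∧ L.IsPathFrom L.root p ∧
        L.pathLabel p = T ∧ s'.reg 0 = n ∧ s'.reg 1 = y := by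
  have hM := hB.edges
  have hMn := hB.nodes
  have hbr : b ≠ L.root := by
    rintro rfl
    rw [str_root] at hbT
    exact hT hbT.symm
  obtain ⟨e, he, heb, hel⟩ := hpred b hbr
  have hee := e.2
  have hhi := (L.hi e).2
  have hinit : Run B M traceInit s fun t s1 => t ≤ 14 ∧ s1.mem = s.mem ∧ s1.reg 1 = L.edges ∧
      s1.reg 2 = L.root ∧ s1.reg 3 = L.hi e ∧ s1.reg 5 = e ∧ s1.reg 6 = L.edges + L.edges := by
    refine Run.of_wp (τ := 14) hB.one_le hB.bound (by decide) hs (by decide) ?_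
    simp [traceInit, Prog.wp, Expr.val, hb, he, hi.hi, hi.edges, hi.root]
    repeat refine ⟨by omega, ?_⟩
    omega
  refine Run.seq (hinit.mono ?_)
  rintro t1 s1 hs1 hf1 ⟨ht1, m1, r1, r2, r3, r5, r6⟩
  have hloop := Run.loop (s := s1) (n := 40 * L.edges) (p := traceBody)
    (c := .lt (.const 0) (.plus (.minus (.reg 3) (.reg 2)) (.minus (.reg 2) (.reg 3))))
    hB.one_le hB.bound (by decide)
    (fun n s' => ∃ p, ∃ v : Fin L.nodes, ∃ y N, L.Traced s' p y N ∧ s'.reg 3 = v ∧ s'.reg 5 = y ∧ s'.reg 6 = N ∧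
      L.IsPathFrom v p ∧ L.str v ++ L.pathLabel p = T ∧ p.Nodup ∧
      (∀ q ∈ p, (L.str v).length ≤ (L.str (L.hi q)).length) ∧
      (∀ i, i < L.edges + L.edges →
        s'.mem 7 i = s.mem 7 i ∧ s'.mem 8 i = s.mem 8 i ∧ s'.mem 9 i = s.mem 9 i) ∧
      n + 40 * p.length = 40 * L.edges + 40) hs1 ?_ ?_
  · refine Run.seq (hloop.mono ?_)
    rintro t2 s2 hs2 hf2 ⟨n, h1, ⟨p, v, y, N, h2, h3, h4, h5, h6, h7, h8, h9, h10, h11⟩, hh⟩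
    have q2 : s2.reg 2 = L.root := by rw [hf2.reg 2 (by decide), r2]
    simp only [Test.Holds, Expr.val, h3, q2] at hh
    simp only [Test.cost, Expr.cost] at h1
    obtain rfl : v = L.root := Fin.ext (by omega)
    rw [str_root, List.nil_append] at h7
    have hlen : p.length ≤ L.edges := by simpa using h8.length_le_card
    have hN := h2.length
    have hyN := h2.lt
    refine Run.of_wp (τ := 4) hB.one_le hB.bound (by decide) hs2 (by decide) ?_
    simp [Prog.wp, Expr.val, h4, h5]
    refine ⟨by omega, by omega, fun t ht => ⟨by omega, h10, p, h2.congr fun _ _ => ⟨rfl, rfl, rfl⟩,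
      hlen, h6, h7⟩⟩
  · refine ⟨[e], L.hi e, e, _, .single e, r3, r5, r6, ⟨rfl, trivial⟩, ?_, by simp, by simp,
      fun _ _ => by simp only [m1, and_self], by simp⟩
    rw [pathLabel_cons, pathLabel_nil, List.append_nil, L.str_lo_eq (by rw [heb]; exact hel), heb, hbT]
  · rintro n s' hs' hf ⟨p, v, y, N, h2, h3, h4, h5, h6, h7, h8, h9, h10, h11⟩ hh
    have q2 : s'.reg 2 = L.root := by rw [hf.reg 2 (by decide), r2]
    have m4 : s'.mem 4 = s.mem 4 := by rw [hf.mem 4 (by decide), m1]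
    have m16 : s'.mem 16 = s.mem 16 := by rw [hf.mem 16 (by decide), m1]
    simp only [Test.Holds, Expr.val, h3, q2] at hh
    have hv : v ≠ L.root := by rintro rfl; omega
    obtain ⟨q, hq, hqv, hql⟩ := hpred v hv
    have hqp := L.slen_pos q
    have hqn : q ∉ p := fun h => by
      have := h9 q h
      omega
    have hnd := List.nodup_cons.2 ⟨hqn, h8⟩
    have hlen : (q :: p).length ≤ L.edges := by simpa using hnd.length_le_card
    rw [List.length_cons] at hlen
    have hN := h2.length
    have hyN := h2.lt
    have hqe := q.2
    have hqh := (L.hi q).2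
    refine Run.of_wp (τ := 25) hB.one_le hB.bound (by decide) hs' (by decide) ?_
    simp [traceBody, Prog.wp, Expr.val, h3, h4, h5, m16, hq, m4, hi.hi]
    repeat refine ⟨by omega, ?_⟩
    intro t ht
    refine ⟨n - 40, ?_, q :: p, ?_, L.hi q, rfl, ⟨rfl, ?_⟩, ?_, hnd, ?_, ?_, ?_⟩
    · simp only [Test.cost, Expr.cost]; omega
    · refine .cons (y := y) (h2.congr fun i hi => ?_) ?_ ?_ ?_
      · simp [hi.ne]
      · simp
      · simp
      · simp
    · rw [hqv]; exact h6
    · rw [pathLabel_cons, ← List.append_assoc, L.str_lo_eq (by rw [hqv]; exact hql), hqv, h7]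
    · intro q' hq'
      rcases List.mem_cons.1 hq' with rfl | h
      · exact le_rfl
      · have := h9 q' h
        omega
    · intro i hiN
      have hp0 : 0 < p.length := by cases h2 <;> simp
      have : i ≠ N := by omega
      simpa [this] using h10 i hiN
    · rw [List.length_cons]; omega

end LCDAWG
end Program

/-! ### The straight-line program in memory -/

section SLPs

variable {α : Type*}

/-- The intended phrases `lab` are the certificate: each rule splits a phrase into two nonempty
ones, so lengths decrease and there are no loops, and induction over the rules shows that the
phrases are indeed `lab`. -/
theorem SLP.exists_of_state (s : State α) {n y : ℕ} (hy : y < n) (lab : ℕ → List α)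
    (h : ∀ i < n, (∃ a, s.mem 7 i = 0 ∧ s.chr 1 i = some a ∧ lab i = [a]) ∨
      (s.mem 7 i = 1 ∧ s.mem 8 i < n ∧ s.mem 9 i < n ∧
        lab i = lab (s.mem 8 i) ++ lab (s.mem 9 i) ∧ lab (s.mem 8 i) ≠ [] ∧ lab (s.mem 9 i) ≠ [])) :
    ∃ R : SLP α, R.size = n ∧ R.start = y ∧ (∀ i, R.phrase i = lab i) ∧
      (∀ i a, R.rule i = Sum.inl a ↔ s.mem 7 i = 0 ∧ s.chr 1 i = some a) ∧
      ∀ i j k, R.rule i = Sum.inr (j, k) ↔ s.mem 7 i = 1 ∧ s.mem 8 i = j ∧ s.mem 9 i = k := by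
  have h' : ∀ i : Fin n, ∃ r : α ⊕ (Fin n × Fin n),
      (∃ a, s.mem 7 i = 0 ∧ s.chr 1 i = some a ∧ lab i = [a] ∧ r = Sum.inl a) ∨
      ∃ j k : Fin n, s.mem 7 i = 1 ∧ s.mem 8 i = j ∧ s.mem 9 i = k ∧ lab i = lab j ++ lab k ∧
        lab j ≠ [] ∧ lab k ≠ [] ∧ r = Sum.inr (j, k) := by
    intro i
    rcases h i i.2 with ⟨a, h1, h2, h3⟩ | ⟨h1, h2, h3, h4, h5, h6⟩
    · exact ⟨_, Or.inl ⟨a, h1, h2, h3, rfl⟩⟩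
    · exact ⟨_, Or.inr ⟨⟨_, h2⟩, ⟨_, h3⟩, h1, rfl, rfl, h4, h5, h6, rfl⟩⟩
  choose rule hrule using h'
  have hr : ∀ i j k, rule i = Sum.inr (j, k) →
      lab i = lab j ++ lab k ∧ lab j ≠ [] ∧ lab k ≠ [] := by
    intro i j k hi
    rcases hrule i with ⟨a, -, -, -, h1⟩ | ⟨j', k', -, -, -, h1, h2, h3, h4⟩
    · rw [hi] at h1; cases h1
    · rw [hi] at h4
      obtain ⟨rfl, rfl⟩ := Prod.mk.inj (Sum.inr.inj h4)
      exact ⟨h1, h2, h3⟩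
  have hac : WellFounded fun j i : Fin n =>
      ∃ k, rule i = Sum.inr (j, k) ∨ rule i = Sum.inr (k, j) := by
    refine Subrelation.wf (r := InvImage (· < ·) fun i : Fin n => (lab i).length) ?_
      (InvImage.wf _ wellFounded_lt)
    rintro j i ⟨k, hk | hk⟩
    all_goals
      obtain ⟨h1, h2, h3⟩ := hr _ _ _ hk
      have h4 := List.length_pos_iff.2 h2
      have h5 := List.length_pos_iff.2 h3
      have h6 := congrArg List.length h1
      rw [List.length_append] at h6
      simp only [InvImage]
      omega
  refine ⟨⟨n, rule, ⟨y, hy⟩, hac⟩, rfl, rfl, fun i => ?_, fun i a => ?_, fun i j k => ?_⟩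
  · refine hac.induction (C := fun i => SLP.phrase ⟨n, rule, ⟨y, hy⟩, hac⟩ i = lab i) i fun i ih => ?_
    rcases hrule i with ⟨a, -, -, h1, h2⟩ | ⟨j, k, -, -, -, h1, -, -, h2⟩
    · rw [SLP.phrase_inl _ h2, h1]
    · rw [SLP.phrase_inr _ h2, ih j ⟨k, Or.inl h2⟩, ih k ⟨j, Or.inr h2⟩, h1]
  · simp only
    rcases hrule i with ⟨a', h1, h2, -, h3⟩ | ⟨j, k, h1, -, -, -, -, -, h3⟩
    · rw [h3, h1, h2]; simp
    · rw [h3, h1]; simp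
  · simp only
    rcases hrule i with ⟨a', h1, h2, -, h3⟩ | ⟨j', k', h1, h2, h4, -, -, -, h3⟩
    · rw [h3, h1]; simp
    · rw [h3, h1, h2, h4]; simp [Fin.ext_iff]

end SLPs

/-! ### Phrases and expansions of the stored rules -/

section Result

variable {α : Type*} [LinearOrder α] {T : List α}

namespace LCDAWG

variable {L : LCDAWG T} {s : State α}

/-- The strings of the variables of edges and of the strings down to the next type-1 node. -/
noncomputable def varLabel (L : LCDAWG T) (i : ℕ) : List α :=
  if h : i < L.edges then L.label ⟨i, h⟩
  else if h : i - L.edges < L.edges then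
    if L.type2 (L.lo ⟨i - L.edges, h⟩) then
      L.label ⟨i - L.edges, h⟩ ++ L.rest (L.lo ⟨i - L.edges, h⟩)
    else [L.chr ⟨i - L.edges, h⟩]
  else []

theorem varLabel_edge (e : Fin L.edges) : L.varLabel e = L.label e := by simp [varLabel]

theorem varLabel_tail (e : Fin L.edges) : L.varLabel (e + L.edges) =
    if L.type2 (L.lo e) then L.label e ++ L.rest (L.lo e) else [L.chr e] := by simp [varLabel]

theorem restVar_lt (f : Fin L.edges) : L.restVar f < L.edges + L.edges := by
  have := f.2
  unfold restVar
  split <;> omega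

theorem varLabel_restVar {f : Fin L.edges} (h : L.type2 (L.hi f) = true) :
    L.varLabel (L.restVar f) = L.rest (L.hi f) := by
  rw [L.rest_type2 h, restVar]
  cases hf : L.type2 (L.lo f)
  · simp [varLabel_edge, L.rest_type1 hf]
  · simp [varLabel_tail, hf]

theorem rest_ne_nil {f : Fin L.edges} (h : L.type2 (L.hi f) = true) : L.rest (L.hi f) ≠ [] := by
  rw [L.rest_type2 h]
  simp [L.label_ne_nil]

/-- Each new variable refers only to edges and to earlier variables, so its phrase can be defined
without changing those already fixed. -/
theorem Traced.exists_label {p y n} (h : L.Traced s p y n) :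
    ∃ lab : ℕ → List α, (∀ i < L.edges + L.edges, lab i = L.varLabel i) ∧
      lab y = L.pathLabel p ∧ ∀ i, L.edges + L.edges ≤ i → i < n →
        s.mem 7 i = 1 ∧ s.mem 8 i < n ∧ s.mem 9 i < n ∧
        lab i = lab (s.mem 8 i) ++ lab (s.mem 9 i) ∧ lab (s.mem 8 i) ≠ [] ∧
        lab (s.mem 9 i) ≠ [] := by
  induction h with
  | single e =>
    refine ⟨L.varLabel, fun _ _ => rfl, ?_, fun i h h' => by omega⟩
    rw [varLabel_edge, pathLabel_cons, pathLabel_nil, List.append_nil]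
  | @cons e p y n hp h7 h8 h9 ih =>
    obtain ⟨lab, h1, h2, h3⟩ := ih
    have hl := hp.length
    have hy := hp.lt
    have he := e.2
    have hp0 : 0 < p.length := by cases hp <;> simp
    refine ⟨Function.update lab n (L.label e ++ L.pathLabel p), fun i hi => ?_, ?_, fun i hi hin => ?_⟩
    · rw [Function.update_of_ne (by omega), h1 i hi]
    · rw [Function.update_self, pathLabel_cons]
    · rcases Nat.lt_succ_iff_lt_or_eq.1 hin with hin | rfl
      · obtain ⟨u1, u2, u3, u4, u5, u6⟩ := h3 i hi hin
        rw [Function.update_of_ne hin.ne, Function.update_of_ne u2.ne, Function.update_of_ne u3.ne]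
        exact ⟨u1, by omega, by omega, u4, u5, u6⟩
      · rw [h8, h9, Function.update_self, Function.update_of_ne (by omega),
          Function.update_of_ne hy.ne, h1 _ (by omega), h2, varLabel_edge]
        refine ⟨h7, by omega, by omega, rfl, L.label_ne_nil e, ?_⟩
        obtain - | ⟨e', p⟩ := p
        · simp at hp0
        · simp [pathLabel_cons, L.label_ne_nil]

/-- The straight-line program and the table of its variables. -/
theorem exists_slp {p y n} (hT : L.TailSpec L.edges s) (hJ : ∀ e, 2 ≤ L.slen e → L.HasJump s e)
    (hz : ∀ e : Fin L.edges, L.slen e = 1 → s.mem 7 e = 0) (hp : L.Traced s p y n)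
    (hpT : L.pathLabel p = T) (h0 : s.reg 0 = n) (h1 : s.reg 1 = y) :
    ∃ (R : SLP α) (X : Fin L.edges → Fin R.size), s.Stores R X ∧ R.size = n ∧
      (∀ e, R.phrase (X e) = L.label e) ∧ R.phrase R.start = T ∧ Function.Injective X ∧
      (∀ e, L.slen e = 1 → R.rule (X e) = Sum.inl (L.chr e)) ∧
      (∀ e, 2 ≤ L.slen e → ∃ p, L.IsJump e p ∧ 2 ≤ p.length ∧ R.Expands X (X e) p) ∧
      R.Expands X R.start p := by
  obtain ⟨lab, hl1, hl2, hl3⟩ := hp.exists_label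
  have hn := hp.length
  have hp0 : 0 < p.length := by cases hp <;> simp
  have hle : ∀ e : Fin L.edges, lab e = L.label e := fun e => by
    rw [hl1 _ (by omega), varLabel_edge]
  have hrest : ∀ f, lab (L.restVar f) = L.varLabel (L.restVar f) := fun f => hl1 _ (restVar_lt f)
  have hone : ∀ e : Fin L.edges, ¬ 2 ≤ L.slen e → L.slen e = 1 := fun e he => by
    have := L.slen_pos e
    omega
  have hrule : ∀ (i : ℕ) (g : Fin L.edges), L.type2 (L.lo g) = true → L.HasRule s i g →
      lab i = L.label g ++ L.rest (L.lo g) →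
      s.mem 7 i = 1 ∧ s.mem 8 i < n ∧ s.mem 9 i < n ∧ lab i = lab (s.mem 8 i) ++ lab (s.mem 9 i) ∧
        lab (s.mem 8 i) ≠ [] ∧ lab (s.mem 9 i) ≠ [] := by
    rintro i g hg ⟨h7, h8, f, hf, h9⟩ hi
    rw [← hf] at hg
    have := restVar_lt f
    rw [h8, h9, hle, hrest, varLabel_restVar hg, hf, hi]
    exact ⟨h7, by omega, by omega, rfl, L.label_ne_nil g, hf ▸ rest_ne_nil hg⟩
  obtain ⟨R, hRn, hRy, hRl, hR1, hR2⟩ := SLP.exists_of_state s hp.lt lab fun i hi => by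
    by_cases h : i < L.edges
    · obtain ⟨e, rfl⟩ : ∃ e : Fin L.edges, i = e := ⟨⟨i, h⟩, rfl⟩
      by_cases he : 2 ≤ L.slen e
      · obtain ⟨g, hg, hr⟩ := hJ e he
        exact Or.inr (hrule e g hg.type2 hr (by rw [hle, hg.label_eq]))
      · refine Or.inl ⟨L.chr e, hz e (hone e he), hT.letter e e.2, ?_⟩
        obtain ⟨x, hx⟩ := L.label_eq_cons e
        have := hone e he
        rw [L.slen_spec, hx] at this
        rw [hle, hx, List.length_eq_zero_iff.1 (Nat.succ_injective this)]
    · by_cases h' : i < L.edges + L.edges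
      · obtain ⟨e, rfl⟩ : ∃ e : Fin L.edges, i = e + L.edges :=
          ⟨⟨i - L.edges, by omega⟩, by simp; omega⟩
        have hl := hl1 _ h'
        rw [varLabel_tail] at hl
        cases he : L.type2 (L.lo e)
        · obtain ⟨h7, h8⟩ := hT.dummy e e.2 he
          exact Or.inl ⟨_, h7, h8, by simpa [he] using hl⟩
        · exact Or.inr (hrule _ e he (hT.rule e e.2 he) (by simpa [he] using hl))
      · exact Or.inr (hl3 i (by omega) hi)
  have hX : ∀ e : Fin L.edges, (e : ℕ) < R.size := fun e => by omega
  let X : Fin L.edges → Fin R.size := fun e => ⟨e, hX e⟩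
  -- The shared variables expand along the chain to the next type-1 node; the last edge of the chain
  -- is represented by its own variable.
  have hchain : ∀ i q, L.Chain i q → L.type2 i = true → ∀ f, L.hi f = i →
      ∀ v : Fin R.size, (v : ℕ) = L.restVar f → R.Expands X v q := by
    intro i q hq
    induction hq with
    | nil h => intro h'; rw [h] at h'; cases h'
    | @cons e q he hq ih =>
      intro _ f hf v hv
      obtain ⟨e₁, -, hu⟩ := L.exists_unique_edge he
      obtain rfl : f = e := (hu _ hf).trans (hu _ rfl).symm
      cases h2 : L.type2 (L.lo f)
      · obtain rfl := hq.unique (.nil h2)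
        obtain rfl : v = X f := Fin.ext (by simpa [restVar, h2] using hv)
        exact .single f
      · obtain ⟨h7, h8, f', hf', h9⟩ := hT.rule f f.2 h2
        have hlt := restVar_lt f'
        have hv' : (v : ℕ) = f + L.edges := by simpa [restVar, h2] using hv
        refine .cons (y := ⟨L.restVar f', by omega⟩) ((hR2 _ _ _).2 ?_) (ih h2 f' hf' _ rfl)
        rw [hv']
        exact ⟨h7, h8, h9⟩
  refine ⟨R, X, ⟨h0.trans hRn.symm, h1.trans hRy.symm, fun i a h => (hR1 i a).1 h,
    fun i j k h => (hR2 i j k).1 h, fun e => hT.table e e.2⟩, hRn, fun e => ?_, ?_, ?_, ?_, ?_, ?_⟩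
  · rw [hRl]; exact hle e
  · rw [hRl, hRy, hl2, hpT]
  · intro e e' h
    have h' : (X e : ℕ) = X e' := by rw [h]
    exact Fin.ext h'
  · intro e he
    exact (hR1 _ _).2 ⟨hz e he, hT.letter e e.2⟩
  · intro e he
    obtain ⟨g, hg, h7, h8, f, hf, h9⟩ := hJ e he
    have h2 := hg.type2
    obtain ⟨q, hq0, hq, hqc⟩ := hg
    have hlt := restVar_lt f
    have := List.length_pos_iff.2 hq0
    refine ⟨g :: q, hq, by simp; omega, .cons (y := ⟨L.restVar f, by omega⟩) ((hR2 _ _ _).2 ?_) ?_⟩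
    · exact ⟨h7, h8, h9⟩
    · exact hchain _ q hqc h2 f hf _ rfl
  · have key : ∀ {q z k}, L.Traced s q z k → k ≤ n → ∀ v : Fin R.size, (v : ℕ) = z →
        R.Expands X v q := by
      intro q z k hq
      induction hq with
      | single e =>
        intro _ v hv
        obtain rfl : v = X e := Fin.ext hv
        exact .single e
      | @cons e q z k hq h7 h8 h9 ih =>
        intro hk v hv
        have := hq.lt
        refine .cons (y := ⟨z, by omega⟩) ((hR2 _ _ _).2 ?_) (ih (by omega) _ rfl)
        rw [hv]
        exact ⟨h7, h8, h9⟩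
    exact key hp le_rfl _ hRy

end LCDAWG
end Result
end LinCDAWG

namespace LinCDAWG

/-! ### Running time and word size -/

section Result

variable {α : Type*} [LinearOrder α] {T : List α}

namespace LCDAWG

variable {L : LCDAWG T} {s s' : State α} {B M : ℕ}

theorem TailSpec.congr (h : L.TailSpec L.edges s)
    (hm : ∀ i, i < L.edges + L.edges →
      s'.mem 7 i = s.mem 7 i ∧ s'.mem 8 i = s.mem 8 i ∧ s'.mem 9 i = s.mem 9 i)
    (h10 : s'.mem 10 = s.mem 10) (hc : s'.chr 1 = s.chr 1) : L.TailSpec L.edges s' := by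
  have hlt : ∀ e : Fin L.edges, (e : ℕ) + L.edges < L.edges + L.edges := fun e => by omega
  refine ⟨fun e he => by rw [h10]; exact h.table e he, fun e he => by rw [hc]; exact h.letter e he,
    fun e he h2 => ?_, fun e he h2 => ?_⟩
  · obtain ⟨h7, h8, h9⟩ := hm _ (hlt e)
    have := h.rule e he h2
    rw [HasRule] at this ⊢
    rwa [h7, h8, h9]
  · have := h.dummy e he h2
    rw [HasLetter] at this ⊢
    rwa [(hm _ (hlt e)).1, hc]

theorem HasJump.congr {e : Fin L.edges} (h : L.HasJump s e)
    (hm : ∀ i, i < L.edges + L.edges →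
      s'.mem 7 i = s.mem 7 i ∧ s'.mem 8 i = s.mem 8 i ∧ s'.mem 9 i = s.mem 9 i) :
    L.HasJump s' e := by
  obtain ⟨g, hg, h7, h8, f, hf, h9⟩ := h
  obtain ⟨m7, m8, m9⟩ := hm e (by omega)
  exact ⟨g, hg, m7.trans h7, m8.trans h8, f, hf, m9.trans h9⟩

theorem bdd_initState (hB : L.Big B M) : L.initState.Bdd M := by
  have h1 := hB.one_le
  have h2 := hB.edges
  have h3 := hB.nodes
  have h4 := hB.length
  refine ⟨fun r => ?_, fun a i => ?_⟩
  · match r with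
    | 0 => exact h3
    | 1 => exact (by omega : L.edges ≤ M)
    | 2 => exact L.root.2.le.trans h3
    | _ + 3 => exact Nat.zero_le _
  · have hcells : ∀ {n} (f : Fin n → ℕ), (∀ i, f i ≤ M) → cells 0 f i ≤ M := by
      intro n f hf
      rw [cells]
      split
      · exact hf _
      · exact Nat.zero_le _
    match a with
    | 0 => exact hcells (fun i => if L.type2 i then 1 else 0) fun i => by split <;> omega
    | 1 => exact hcells _ fun i => (L.slink i).2.le.trans h3
    | 2 => exact hcells _ fun i => by have := L.out_le i; omega
    | 3 => exact hcells _ fun i => by have := L.out_le i; omega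
    | 4 => exact hcells _ fun e => (L.hi e).2.le.trans h3
    | 5 => exact hcells _ fun e => (L.lo e).2.le.trans h3
    | 6 =>
      refine hcells _ fun e => ?_
      have := L.slen_add_le e
      have := L.length_str_le (L.lo e)
      omega
    | _ + 7 => exact Nat.zero_le _

theorem run_slpProg (hB : L.Big B M) (hT : T ≠ []) {D : ℕ} (hD : ∀ i, L.deg i ≤ D) :
    Run B M slpProg L.initState fun t s =>
      t ≤ (416 + 20 * Nat.clog 2 D) * L.edges + 120 ∧ L.TailSpec L.edges s ∧
      (∀ e, 2 ≤ L.slen e → L.HasJump s e) ∧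
      (∀ e : Fin L.edges, L.slen e = 1 → s.mem 7 e = 0) ∧
      ∃ p y n, L.Traced s p y n ∧ p.length ≤ L.edges ∧ L.IsPathFrom L.root p ∧
        L.pathLabel p = T ∧ s.reg 0 = n ∧ s.reg 1 = y := by
  have i0 := L.inp_initState
  refine Run.seq ((run_tailProg hB (bdd_initState hB) i0 fun _ => rfl).mono ?_)
  rintro t1 s1 b1 f1 ⟨h1, z1, T1⟩
  have i1 := i0.frame f1 (by decide) (by decide) (by decide)
  refine Run.seq ((run_headProg hB b1 i1 hD T1 z1 fun i => by
    rw [f1.mem 12 (by decide)]; rfl).mono ?_)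
  rintro t2 s2 b2 f2 ⟨h2, T2, J2⟩
  have i2 := i1.frame f2 (by decide) (by decide) (by decide)
  refine Run.seq ((run_jumpProg hB b2 i2 T2 J2).mono ?_)
  rintro t3 s3 b3 f3 ⟨h3, T3, J3, z3⟩
  have i3 := i2.frame f3 (by decide) (by decide) (by decide)
  refine Run.seq ((run_degProg hB b3 i3 fun i => by
    rw [f3.mem 13 (by decide), f2.mem 13 (by decide), f1.mem 13 (by decide)]; rfl).mono ?_)
  rintro t4 s4 b4 f4 ⟨h4, d4⟩
  have i4 := i3.frame f4 (by decide) (by decide) (by decide)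
  refine Run.seq ((run_orderProg hB b4 i4 d4 fun i => by
    rw [f4.mem 15 (by decide), f3.mem 15 (by decide), f2.mem 15 (by decide),
      f1.mem 15 (by decide)]; rfl).mono ?_)
  rintro t5 s5 b5 f5 ⟨h5, ⟨b, hb, hbT⟩, hpred⟩
  have i5 := i4.frame f5 (by decide) (by decide) (by decide)
  refine (run_traceProg hB b5 i5 hT hb hbT hpred).mono ?_
  rintro t6 s6 b6 f6 ⟨h6, hm, hp⟩
  have hm3 : ∀ i, i < L.edges + L.edges →
      s6.mem 7 i = s3.mem 7 i ∧ s6.mem 8 i = s3.mem 8 i ∧ s6.mem 9 i = s3.mem 9 i := by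
    intro i hi
    rw [← f4.mem 7 (by decide), ← f4.mem 8 (by decide), ← f4.mem 9 (by decide),
      ← f5.mem 7 (by decide), ← f5.mem 8 (by decide), ← f5.mem 9 (by decide)]
    exact hm i hi
  refine ⟨?_, T3.congr hm3 ?_ ?_, fun e he => (J3 e he).congr hm3, fun e he => ?_, hp⟩
  · have := L.nodes_le
    -- The 313 collects the other parts: 63 + 76 + 20 + (64 + 50) + 40, where the 50 per node is
    -- charged to edges by `nodes_le`.
    have h : (103 + 20 * Nat.clog 2 D) * L.edges + 313 * L.edges =
        (416 + 20 * Nat.clog 2 D) * L.edges := by ring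
    omega
  · rw [f6.mem 10 (by decide), f5.mem 10 (by decide), f4.mem 10 (by decide)]
  · rw [f6.chr 1 (by decide), f5.chr 1 (by decide), f4.chr 1 (by decide)]
  · rw [(hm3 e (by omega)).1]
    exact z3 e he

/-- There are at most `2(|T|+1)²` edges, so `M = 8(|T|+1)²` suffices; and `4M = 2⁵(|T|+1)² ≤
(|T|+1)⁷` since `|T|+1 ≥ 2`. -/
theorem big_of_length (hT : T ≠ []) {C : ℕ} (hC : 7 ≤ C) :
    L.Big ((T.length + 1) ^ C) (8 * (T.length + 1) ^ 2) := by
  have h1 : 1 ≤ T.length := List.length_pos_iff.2 hT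
  have h2 := L.edges_le.trans numExt_le
  have h3 := L.nodes_le
  have h4 : 2 ^ 2 ≤ (T.length + 1) ^ 2 := Nat.pow_le_pow_left (by omega) 2
  have h5 : T.length + 1 ≤ (T.length + 1) ^ 2 := Nat.le_self_pow (by decide) _
  refine ⟨by omega, by omega, by omega, ?_⟩
  calc 4 * (8 * (T.length + 1) ^ 2) = 2 ^ 5 * (T.length + 1) ^ 2 := by ring
    _ ≤ (T.length + 1) ^ 5 * (T.length + 1) ^ 2 :=
      Nat.mul_le_mul_right _ (Nat.pow_le_pow_left (by omega) 5)
    _ = (T.length + 1) ^ 7 := by ring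
    _ ≤ (T.length + 1) ^ C := Nat.pow_le_pow_right (by omega) hC

end LCDAWG

/-- Rounding up adds less than 1, which is at most the logarithm itself as `σ ≥ 2`. -/
theorem clog_le_two_mul_logb {σ : ℕ} (hσ : 2 ≤ σ) :
    1 ≤ Real.logb 2 σ ∧ (Nat.clog 2 σ : ℝ) ≤ 2 * Real.logb 2 σ := by
  have h1 : 1 ≤ Real.logb 2 σ := by
    rw [Real.le_logb_iff_rpow_le (by norm_num) (by positivity), Real.rpow_one]
    exact_mod_cast hσ
  have h2 := Nat.ceil_lt_add_one (zero_le_one.trans h1)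
  have h3 : ⌈Real.logb 2 (σ : ℝ)⌉₊ = Nat.clog 2 σ := by
    simpa using Real.natCeil_logb_natCast 2 σ
  rw [h3] at h2
  exact ⟨h1, by linarith⟩

end Result
end LinCDAWG

open LinCDAWG in
/-- One program, for all ordered alphabets and all texts, constructs from the L-CDAWG of `T` a
straight-line program for all edge labels and for `T`. -/
theorem mainTheorem3 :
    ∃ (P : Prog) (C : ℕ), ∀ (α : Type*) [Fintype α] [LinearOrder α], 2 ≤ Fintype.card α →
      ∀ T : List α, HasEndMarker T → ∀ L : LCDAWG T,
        ∃ (t : ℕ) (s : State α) (R : SLP α) (X : Fin L.edges → Fin R.size),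
          -- the program halts after `t` steps with `R` and `X` in memory, on words of `O(log |T|)` bits
          Exec ((T.length + 1) ^ C) P L.initState t s ∧
          s.Stores R X ∧
          (t : ℝ) ≤ C * numExt T * Real.logb 2 (Fintype.card α) ∧
          R.size ≤ C * numExt T ∧
          -- the straight-line program produces all edge labels and the text
          (∀ e, R.phrase (X e) = L.label e) ∧
          R.phrase R.start = T ∧
          -- its productions follow the jump links and the path that spells out the text
          Function.Injective X ∧
          (∀ e, L.slen e = 1 → R.rule (X e) = Sum.inl (L.chr e)) ∧
          (∀ e, 2 ≤ L.slen e → ∃ p, L.IsJump e p ∧ 2 ≤ p.length ∧ R.Expands X (X e) p) ∧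
          (∃ p, L.IsPathFrom L.root p ∧ L.pathLabel p = T ∧ R.Expands X R.start p) := by
  refine ⟨slpProg, 600, fun α _ _ hσ T hT L => ?_⟩
  have hT0 : T ≠ [] := by
    obtain ⟨w, d, rfl, -⟩ := hT
    simp
  obtain ⟨t, s, hx, -, -, ht, hs, hj, hz, p, y, n, hp, hpl, hpr, hpT, h0, h1⟩ :=
    LCDAWG.run_slpProg (L.big_of_length hT0 (C := 600) (by norm_num)) hT0 L.deg_le_card
  obtain ⟨R, X, hR, hn, h2, h3, h4, h5, h6, h7⟩ := LCDAWG.exists_slp hs hj hz hp hpT h0 h1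
  have hE := L.edges_le
  have hE1 : 1 ≤ L.edges := by
    have : 0 < p.length := by cases hp <;> simp
    omega
  have hlen := hp.length
  obtain ⟨hl1, hl2⟩ := clog_le_two_mul_logb hσ
  refine ⟨t, s, R, X, hx, hR, ?_, by omega, h2, h3, h4, h5, h6, p, hpr, hpT, h7⟩
  have ht' : (t : ℝ) ≤ (416 + 20 * Nat.clog 2 (Fintype.card α)) * L.edges + 120 := by
    exact_mod_cast ht
  have hE' : (L.edges : ℝ) ≤ numExt T := by exact_mod_cast hE
  have hE1' : (1 : ℝ) ≤ L.edges := by exact_mod_cast hE1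
  generalize Real.logb 2 (Fintype.card α) = l at *
  calc (t : ℝ) ≤ (416 + 20 * Nat.clog 2 (Fintype.card α)) * L.edges + 120 * L.edges := by linarith
    _ = (536 + 20 * Nat.clog 2 (Fintype.card α)) * L.edges := by ring
    -- Since `l ≥ 1`, one has `536 + 20 · 2l ≤ 576 l`.
    _ ≤ 600 * l * L.edges := by gcongr; linarith
    _ ≤ 600 * l * numExt T := by gcongr
    _ = (600 : ℕ) * numExt T * l := by push_cast; ring
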